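/- Let $d\ge 1$, $E>0$. For $\hbar>0$ let $\widehat H_\hbar=\sum_{j=1}^d\left(-\frac{\hbar^2}{2}\partial_{x_j}^2+\frac{x_j^2}{2}\right)$ be the isotropic harmonic oscillator on $L^2(\mathbb R^d)$, with eigenvalues $E_N(\hbar)=\hbar(N+d/2)$, $N=0,1,2,\dots$, let $\Pi_{\hbar,E_N(\hbar)}(x,y)$ be the (continuous) integral kernel of the orthogonal projection onto the eigenspace of $E_N(\hbar)$, and let $$W_{\hbar,E_N(\hbar)}(x,\xi)=\int_{\mathbb R^d}\Pi_{\hbar,E_N(\hbar)}\left(x+\tfrac v2,x-\tfrac v2\right)e^{-\frac i\hbar v\cdot\xi}\,\frac{dv}{(2\pi\hbar)^d}$$ be its Wigner distribution. Let $f\in\mathcal S(\mathbb R)$ be a (complex-valued) Schwartz function whose Fourier transform has compact support, and put $$W_{\hbar,f,2/3}(x,\xi)=\sum_{N\ge 0}f\left(\hbar^{-2/3}(E-E_N(\hbar))\right)W_{\hbar,E_N(\hbar)}(x,\xi),\qquad H(x,\xi)=\tfrac12(\|x\|^2+\|\xi\|^2).$$ The sum converges absolutely for all $\hbar>0$ and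 all $(x,\xi)\in\mathbb R^{2d}$. As $\hbar\to0$, uniformly over all $u\in\mathbb R$ with $|u|<\hbar^{-2/3}$ and all $(x,\xi)$ with $H(x,\xi)=E+u\left(\frac{\hbar}{2E}\right)^{2/3}$, $$W_{\hbar,f,2/3}(x,\xi)=(2\pi\hbar)^{-d}I_0(u;f,E)+O\left((1+|u|)\hbar^{-d+2/3}\right),$$ where $$I_0(u;f,E)=\int_{\mathbb R}f(\lambda/C_E)\,\mathrm{Ai}\left(\lambda+\frac uE\right)d\lambda,\qquad C_E=(4/E)^{1/3},$$ with an absolutely convergent integral, and $\mathrm{Ai}$ is the Airy function. More generally, there is a full asymptotic expansion $$W_{\hbar,f,2/3}(x,\xi)\simeq(2\pi\hbar)^{-d}\sum_{m\ge0}\hbar^{2m/3}I_m(u;f,E)$$ in powers of $\hbar^{2/3}$: there are functions $I_m(\,\cdot\,;f,E)$, $m\ge 0$, independent of $\hbar$ and of $(x,\xi)$ (they may depend on $d$), with $I_0$ as above, each bounded on every compact set of $u$, such that for every $M\ge0$, as $\hbar\to 0$ and uniformly over the same $u$ and $(x,\xi)$, $$W_{\hbar,f,2/3}(x,\xi)=(2\pi\hbar)^{-d}\sum_{m=0}^{M-1}\hbar^{2m/3}I_m(u;f,E)+O_M\left((1+|u|)^M\hbar^{-d+2M/3}\right);$$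 in particular the remainder is $O_M(\hbar^{-d+2M/3})$ uniformly for $u$ in compact sets. The implicit constants depend only on $d$, $E$, $f$ (and $M$). -/

import Mathlib

open MeasureTheory Laplacian
open scoped FourierTransform SchwartzMap

namespace WignerWeyl

noncomputable section

/-- Configuration space `ℝᵈ` with its Euclidean norm. -/
abbrev Conf (d : ℕ) : Type := EuclideanSpace ℝ (Fin d)

/-- The Hilbert space `L²(ℝᵈ, dx)` of complex-valued functions. -/
abbrev L2 (d : ℕ) : Type := Lp ℂ 2 (volume : Measure (Conf d))

/-- The isotropic harmonic oscillator `∑ⱼ (-ħ²/2 ∂²/∂xⱼ² + xⱼ²/2)` on Schwartz functions. -/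
def oscillator (d : ℕ) (ħ : ℝ) (φ : 𝓢(Conf d, ℂ)) : 𝓢(Conf d, ℂ) :=
  -((ħ ^ 2 / 2 : ℝ) • Δ φ) + SchwartzMap.smulLeftCLM ℂ (fun x : Conf d => ‖x‖ ^ 2 / 2) φ

theorem oscillator_apply (d : ℕ) (ħ : ℝ) (φ : 𝓢(Conf d, ℂ)) (x : Conf d) :
    oscillator d ħ φ x
      = -((ħ ^ 2 / 2 : ℝ) * (Δ (φ : Conf d → ℂ)) x) + (‖x‖ ^ 2 / 2 : ℝ) * φ x := by
  have h : Function.HasTemperateGrowth (fun x : Conf d => ‖x‖ ^ 2 / 2) := by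
    simp only [div_eq_mul_inv]
    fun_prop
  simp [oscillator, SchwartzMap.smulLeftCLM_apply_apply h, SchwartzMap.laplacian_apply]

/-- The eigenspace `{ψ ∈ L²(ℝᵈ) : Ĥ ψ = E ψ}`. The oscillator acts on `L²` as the adjoint (which
is also the closure) of its restriction to Schwartz functions; hence `Ĥ ψ = E ψ` means that
`⟪Ĥ φ, ψ⟫ = E ⟪φ, ψ⟫` for every Schwartz function `φ`. -/
def eigenspace (d : ℕ) (ħ E : ℝ) : Submodule ℂ (L2 d) where
  carrier := {ψ | ∀ φ : 𝓢(Conf d, ℂ),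
    inner ℂ ((oscillator d ħ φ).toLp 2 volume) ψ = (E : ℂ) * inner ℂ (φ.toLp 2 volume) ψ}
  add_mem' := by
    intro a b ha hb φ
    rw [inner_add_right, inner_add_right, ha φ, hb φ, mul_add]
  zero_mem' := by
    intro φ
    simp
  smul_mem' := by
    intro c a ha φ
    rw [inner_smul_right, inner_smul_right, ha φ]
    ring

theorem isClosed_eigenspace (d : ℕ) (ħ E : ℝ) :
    IsClosed (eigenspace d ħ E : Set (L2 d)) := by
  have h : (eigenspace d ħ E : Set (L2 d)) = ⋂ φ : 𝓢(Conf d, ℂ),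
      {ψ : L2 d | inner ℂ ((oscillator d ħ φ).toLp 2 volume) ψ
        = (E : ℂ) * inner ℂ (φ.toLp 2 volume) ψ} := by
    ext ψ
    simp only [Set.mem_iInter]
    rfl
  rw [h]
  exact isClosed_iInter fun φ => isClosed_eq (by fun_prop) (by fun_prop)

instance completeSpace_eigenspace (d : ℕ) (ħ E : ℝ) : CompleteSpace (eigenspace d ħ E) :=
  (isClosed_eigenspace d ħ E).completeSpace_coe

/-- The spectral projection: the orthogonal projection of `L²(ℝᵈ)` onto the eigenspace. -/
def spectralProj (d : ℕ) (ħ E : ℝ) : L2 d →L[ℂ] L2 d :=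
  (eigenspace d ħ E).starProjection

/-- `K` is a continuous integral kernel of `T`, that is `(T ψ)(x) = ∫ K(x, y) ψ(y) dy` for almost
every `x`, for each `ψ ∈ L²(ℝᵈ)`. An operator has at most one continuous kernel. -/
def IsKernel {d : ℕ} (T : L2 d →L[ℂ] L2 d) (K : Conf d → Conf d → ℂ) : Prop :=
  Continuous (Function.uncurry K) ∧
    ∀ ψ : L2 d, (T ψ : Conf d → ℂ) =ᵐ[volume] fun x => ∫ y, K x y * ψ y

open Classical in
/-- The continuous integral kernel `T(x, y)` of an operator `T` (zero if there is none). -/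
def kernel {d : ℕ} (T : L2 d →L[ℂ] L2 d) : Conf d → Conf d → ℂ :=
  if h : ∃ K, IsKernel T K then h.choose else 0

/-- The semiclassical Wigner transform
`(2πħ)⁻ᵈ ∫ K(x + v/2, x - v/2) exp(-(i/ħ) v·ξ) dv` of a kernel `K`. -/
def wignerTransform {d : ℕ} (ħ : ℝ) (K : Conf d → Conf d → ℂ) (x ξ : Conf d) : ℂ :=
  (((2 * Real.pi * ħ) ^ d : ℝ) : ℂ)⁻¹ *
    ∫ v : Conf d, K (x + (1 / 2 : ℝ) • v) (x - (1 / 2 : ℝ) • v) *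
      Complex.exp (-(Complex.I / ħ) * (inner ℝ v ξ : ℝ))

/-- The eigenvalues `E_N(ħ) = ħ (N + d/2)`. -/
def energy (d : ℕ) (ħ : ℝ) (N : ℕ) : ℝ := ħ * (N + d / 2)

/-- The Wigner distribution `W_{ħ, E_N(ħ)}` of the `N`-th spectral projection. -/
def wigner (d : ℕ) (ħ : ℝ) (N : ℕ) (x ξ : Conf d) : ℂ :=
  wignerTransform ħ (kernel (spectralProj d ħ (energy d ħ N))) x ξ

/-- The `N`-th term `f(ħ^(-2/3) (E - E_N(ħ))) W_{ħ, E_N(ħ)}(x, ξ)` of the localized sum. -/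
def weylTerm (d : ℕ) (E : ℝ) (f : ℝ → ℂ) (ħ : ℝ) (x ξ : Conf d) (N : ℕ) : ℂ :=
  f (ħ ^ (-(2 / 3) : ℝ) * (E - energy d ħ N)) * wigner d ħ N x ξ

/-- The interface-localized Wigner distribution `W_{ħ, f, 2/3}(x, ξ)` at the energy level `E`. -/
def weylSum (d : ℕ) (E : ℝ) (f : ℝ → ℂ) (ħ : ℝ) (x ξ : Conf d) : ℂ :=
  ∑' N : ℕ, weylTerm d E f ħ x ξ N

/-- The classical Hamiltonian `H(x, ξ) = (|x|² + |ξ|²)/2`. -/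
def hamiltonian {d : ℕ} (x ξ : Conf d) : ℝ := (‖x‖ ^ 2 + ‖ξ‖ ^ 2) / 2

/-- The Airy function `Ai(z) = (1/2πi) ∫_L exp(v³/3 - z v) dv`, where `L` is the upward vertical
line `v = 1 + i s`; on this contour the integral converges absolutely. -/
def airyAi (z : ℂ) : ℂ :=
  (2 * Real.pi * Complex.I)⁻¹ *
    ∫ s : ℝ, Complex.exp ((1 + s * Complex.I) ^ 3 / 3 - z * (1 + s * Complex.I)) * Complex.I

/-- The constant `C_E = (4/E)^(1/3)`. -/
def airyConst (E : ℝ) : ℝ := (4 / E) ^ (1 / 3 : ℝ)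

/-- The integrand `f(l/C_E) Ai(l + u/E)` of the leading coefficient. -/
def leadingIntegrand (E : ℝ) (f : ℝ → ℂ) (u l : ℝ) : ℂ :=
  f (l / airyConst E) * airyAi ((l + u / E : ℝ) : ℂ)

/-- The leading coefficient `I₀(u; f, E) = ∫ f(l/C_E) Ai(l + u/E) dl`. -/
def leadingCoeff (E : ℝ) (f : ℝ → ℂ) (u : ℝ) : ℂ :=
  ∫ l : ℝ, leadingIntegrand E f u l

end

end WignerWeyl

namespace WignerWeyl

noncomputable section

open LineDeriv

/-! The localized sum is an oscillatory integral whose large parameter can be scaled away exactly,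
leaving a function holomorphic and even in `ε = ħ^(1/3)`; the expansion is its Taylor series at `0`.

Algebra. The level `N` is spanned by words of `N` raising operators applied to the Gaussian ground
state. A multi-index `α` with `|α| = N` arises from `N!/α!` words, each giving a vector of squared
norm `α! (2ħ)^N`, so the sum over words divided by `N! (2ħ)^N` is a trace over an orthonormal basis,
without multi-indices. Bilinear maps are taken over `ℝ` so that sesquilinear forms are included.
Completeness of these states (`eq_zero_of_inner_excited_eq_zero`) identifies the spectral projection
and its kernel. Moving ladder operators through the Wigner form gives two coupled recurrences in
`N`, which are those of the Taylor coefficients of `genFun d t`, `t = 4H/ħ`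
(`wignerLevel_eq_taylorCoeff`). This is the Laguerre formula for the Wigner function, in the form of
its generating function.

From sum to integral. Fourier inversion of `f` replaces the sum over `N` by an average of `genFun`
on the unit circle at `exp(-iθ)`, `θ = 2πτε`, after Abel summation
(`tsum_schwartz_mul_taylorCoeff`). There `genFun` becomes `cos(θ/2)^(-d) exp(-(2iH/ħ) tan(θ/2))`.
Compact support of the Fourier transform keeps `θ` away from the poles when `ħ` is small.

Expansion. Put `s = 2πτ` and `2 tan(z/2) = z tanQuot z = z + z³ tanRem z`. For `H = E +
u(ħ/2E)^(2/3)` the linear terms in `E` cancel, and the phase is `-E s³ tanRem(εs) - (2E)^(-2/3) u s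
tanQuot(εs)`, with no negative power of `ε`. Evenness leaves only the powers `ħ^(2m/3)`. Since
`tanQuot` is `1` up to second order, the integral is bounded uniformly in `u` on a complex disc of
radius comparable to `(1 + |u|)^(-1/2)`; for real `ε` the integrand is purely oscillatory. Cauchy
estimates then yield the remainder `((1 + |u|) ε²)^M` (`exists_expansion_profile`).

Leading term. At `ε = 0` the phase is `-(E s³/12 + (2E)^(-2/3) u s)`. Parseval against a damped Airy
function, followed by removal of the damping, turns this into the Airy integral
(`leadingCoeff_eq_integral`, `profile_zero`). -/

/-! ### Ladder operators on Schwartz functions -/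

/-- The standard basis vector of configuration space. -/
abbrev stdVec (d : ℕ) (j : Fin d) : Conf d := EuclideanSpace.basisFun (Fin d) ℝ j

/-- Multiplication by the `j`-th coordinate. -/
def position {d : ℕ} (j : Fin d) : Module.End ℝ 𝓢(Conf d, ℂ) :=
  (SchwartzMap.smulLeftCLM (E := Conf d) (𝕜 := ℝ) ℂ (fun x : Conf d => x j)).toLinearMap

/-- The partial derivative in the `j`-th coordinate. -/
def partialDeriv {d : ℕ} (j : Fin d) : Module.End ℝ 𝓢(Conf d, ℂ) :=
  (lineDerivOpCLM ℝ 𝓢(Conf d, ℂ) (stdVec d j)).toLinearMap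

/-- The lowering operator `x_j + ħ ∂_j`. -/
def lower {d : ℕ} (ħ : ℝ) (j : Fin d) : Module.End ℝ 𝓢(Conf d, ℂ) :=
  position j + ħ • partialDeriv j

/-- The raising operator `x_j - ħ ∂_j`. -/
def raise {d : ℕ} (ħ : ℝ) (j : Fin d) : Module.End ℝ 𝓢(Conf d, ℂ) :=
  position j - ħ • partialDeriv j

variable {d : ℕ} {ħ : ℝ}

theorem hasTemperateGrowth_coord (j : Fin d) :
    Function.HasTemperateGrowth (fun x : Conf d => x j) :=
  (EuclideanSpace.proj (𝕜 := ℝ) j : Conf d →L[ℝ] ℝ).hasTemperateGrowth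

@[simp]
theorem position_apply (j : Fin d) (φ : 𝓢(Conf d, ℂ)) (x : Conf d) :
    position j φ x = x j * φ x := by
  simp [position, SchwartzMap.smulLeftCLM_apply_apply (hasTemperateGrowth_coord j)]

theorem partialDeriv_apply (j : Fin d) (φ : 𝓢(Conf d, ℂ)) (x : Conf d) :
    partialDeriv j φ x = fderiv ℝ φ x (stdVec d j) := rfl

theorem lower_apply (j : Fin d) (φ : 𝓢(Conf d, ℂ)) (x : Conf d) :
    lower ħ j φ x = x j * φ x + ħ * fderiv ℝ φ x (stdVec d j) := by
  rw [← partialDeriv_apply]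
  simp [lower]

theorem raise_apply (j : Fin d) (φ : 𝓢(Conf d, ℂ)) (x : Conf d) :
    raise ħ j φ x = x j * φ x - ħ * fderiv ℝ φ x (stdVec d j) := by
  rw [← partialDeriv_apply]
  simp [raise]

theorem position_comm (i j : Fin d) :
    (position i : Module.End ℝ 𝓢(Conf d, ℂ)) * position j = position j * position i := by
  ext φ x
  simp only [Module.End.mul_apply, position_apply]
  ring

theorem partialDeriv_comm (i j : Fin d) :
    (partialDeriv i : Module.End ℝ 𝓢(Conf d, ℂ)) * partialDeriv j
      = partialDeriv j * partialDeriv i := by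
  ext φ x
  simp only [Module.End.mul_apply]
  have h (k l : Fin d) : partialDeriv k (partialDeriv l φ) x
      = fderiv ℝ (fderiv ℝ φ) x (stdVec d k) (stdVec d l) := by
    rw [partialDeriv_apply]
    have : (partialDeriv l φ : Conf d → ℂ) = fun y => fderiv ℝ φ y (stdVec d l) := rfl
    rw [this, fderiv_clm_apply]
    · simp
    · exact ((φ.smooth 2).fderiv_right (m := 1) (by norm_num)).differentiable (by norm_num) x
    · fun_prop
  rw [h, h]
  exact ((φ.contDiffAt 2).isSymmSndFDerivAt (by simp)) _ _

theorem partialDeriv_mul_position (i j : Fin d) :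
    (partialDeriv i : Module.End ℝ 𝓢(Conf d, ℂ)) * position j
      = position j * partialDeriv i + if i = j then 1 else 0 := by
  ext φ x
  simp only [Module.End.mul_apply, LinearMap.add_apply, add_apply, position_apply]
  rw [partialDeriv_apply]
  have h1 : (position j φ : Conf d → ℂ) = fun y => (y j : ℝ) • φ y := by
    ext y; simp
  have h2 : HasFDerivAt (fun y : Conf d => y j)
      (EuclideanSpace.proj (𝕜 := ℝ) j : Conf d →L[ℝ] ℝ) x :=
    (EuclideanSpace.proj (𝕜 := ℝ) j : Conf d →L[ℝ] ℝ).hasFDerivAt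
  have h3 : fderiv ℝ (fun y : Conf d => (y j : ℝ) • φ y) x = _ := (h2.smul (φ.hasFDerivAt x)).fderiv
  rw [h1, h3]
  by_cases hij : i = j
  · subst hij
    simp [partialDeriv_apply]
  · simp [partialDeriv_apply, hij, Ne.symm hij]

theorem lower_mul_raise (i j : Fin d) :
    (lower ħ i : Module.End ℝ 𝓢(Conf d, ℂ)) * raise ħ j
      = raise ħ j * lower ħ i + (2 * ħ) • if i = j then 1 else 0 := by
  simp only [lower, raise, add_mul, mul_add, sub_mul, mul_sub, smul_mul_assoc, mul_smul_comm,
    partialDeriv_mul_position, partialDeriv_comm i j, position_comm i j, smul_add, smul_sub,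
    eq_comm (a := j) (b := i)]
  module

theorem raise_comm (i j : Fin d) :
    (raise ħ i : Module.End ℝ 𝓢(Conf d, ℂ)) * raise ħ j = raise ħ j * raise ħ i := by
  simp only [raise, sub_mul, mul_sub, smul_mul_assoc, mul_smul_comm,
    partialDeriv_mul_position, partialDeriv_comm i j, position_comm i j, smul_add, smul_sub,
    eq_comm (a := j) (b := i)]
  module

theorem lower_raise_apply (i j : Fin d) (φ : 𝓢(Conf d, ℂ)) :
    lower ħ i (raise ħ j φ) = raise ħ j (lower ħ i φ) + (2 * ħ) • if i = j then φ else 0 := by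
  have := LinearMap.congr_fun (lower_mul_raise (ħ := ħ) i j) φ
  simp only [Module.End.mul_apply, LinearMap.add_apply, LinearMap.smul_apply] at this
  rw [this]
  split_ifs <;> simp

theorem raise_raise_apply (i j : Fin d) (φ : 𝓢(Conf d, ℂ)) :
    raise ħ i (raise ħ j φ) = raise ħ j (raise ħ i φ) :=
  LinearMap.congr_fun (raise_comm (ħ := ħ) i j) φ

/-- Each product `b_j a_j` equals `x_j² - ħ - ħ² ∂_j²`; the commutator terms `-ħ` add up to the
zero-point energy `ħ d / 2`. -/
theorem oscillator_eq_sum (φ : 𝓢(Conf d, ℂ)) :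
    oscillator d ħ φ = (1 / 2 : ℝ) • ∑ j, raise ħ j (lower ħ j φ) + (ħ * d / 2) • φ := by
  have h1 (j : Fin d) : raise ħ j (lower ħ j φ)
      = position j (position j φ) - ħ • φ - (ħ ^ 2) • partialDeriv j (partialDeriv j φ) := by
    have := LinearMap.congr_fun (partialDeriv_mul_position j j) φ
    simp only [Module.End.mul_apply, LinearMap.add_apply, if_true, Module.End.one_apply] at this
    simp only [raise, lower, LinearMap.sub_apply, LinearMap.add_apply, LinearMap.smul_apply,
      map_add, map_smul, this]
    module
  have h2 : Δ φ = ∑ j, partialDeriv j (partialDeriv j φ) :=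
    SchwartzMap.laplacian_eq_sum (EuclideanSpace.basisFun (Fin d) ℝ) φ
  have h3 : SchwartzMap.smulLeftCLM ℂ (fun x : Conf d => ‖x‖ ^ 2 / 2) φ
      = (1 / 2 : ℝ) • ∑ j, position j (position j φ) := by
    have h : Function.HasTemperateGrowth (fun x : Conf d => ‖x‖ ^ 2 / 2) := by
      simp only [div_eq_mul_inv]
      fun_prop
    ext x
    rw [SchwartzMap.smulLeftCLM_apply_apply h]
    simp only [smul_apply, sum_apply, position_apply, EuclideanSpace.norm_sq_eq, Real.norm_eq_abs,
      sq_abs, Complex.real_smul, ← mul_assoc, ← Finset.sum_mul]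
    push_cast
    simp only [sq]
    ring
  rw [oscillator, h2, h3]
  simp only [h1, Finset.sum_sub_distrib, Finset.sum_const, Finset.card_univ, Fintype.card_fin,
    ← Finset.smul_sum]
  module

/-- The `L²` inner product of Schwartz functions. -/
def pair (φ ψ : 𝓢(Conf d, ℂ)) : ℂ := inner ℂ (φ.toLp 2 volume) (ψ.toLp 2 volume)

theorem pair_eq_integral (φ ψ : 𝓢(Conf d, ℂ)) :
    pair φ ψ = ∫ x, (starRingEnd ℂ) (φ x) * ψ x := by
  refine (SchwartzMap.inner_toL2_toL2_eq φ ψ volume).trans ?_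
  simp [mul_comm]

/-- `toLp` for `p = 2`, as a real-linear map. -/
def toL2 : 𝓢(Conf d, ℂ) →ₗ[ℝ] L2 d :=
  (SchwartzMap.toLpCLM ℝ ℂ 2 (volume : Measure (Conf d))).toLinearMap

theorem toL2_apply (φ : 𝓢(Conf d, ℂ)) : toL2 φ = φ.toLp 2 volume := rfl

theorem inner_toL2 (φ ψ : 𝓢(Conf d, ℂ)) : inner ℂ (toL2 φ) (toL2 ψ) = pair φ ψ := rfl

theorem pair_raise (j : Fin d) (φ ψ : 𝓢(Conf d, ℂ)) :
    pair (raise ħ j φ) ψ = pair φ (lower ħ j ψ) := by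
  have hconj (x : Conf d) : (starRingEnd ℂ) (partialDeriv j φ x)
      = partialDeriv j (φ.postcompCLM (𝕜 := ℝ) Complex.conjCLE.toContinuousLinearMap) x := by
    rw [partialDeriv_apply, partialDeriv_apply]
    have : (φ.postcompCLM (𝕜 := ℝ) Complex.conjCLE.toContinuousLinearMap : Conf d → ℂ)
      = fun y => Complex.conjCLE.toContinuousLinearMap (φ y) := by
      ext y; rfl
    have h : fderiv ℝ (fun y => Complex.conjCLE.toContinuousLinearMap (φ y)) x = _ :=
      ((Complex.conjCLE.toContinuousLinearMap).hasFDerivAt.comp x (φ.hasFDerivAt x)).fderiv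
    rw [this, h]
    rfl
  -- The conjugate of `φ` is again a Schwartz function, so integration by parts applies to it; the
  -- sign change of `∂_j` exchanges raising and lowering.
  have hparts := SchwartzMap.integral_mul_lineDerivOp_right_eq_neg_left (μ := volume)
    (φ.postcompCLM (𝕜 := ℝ) Complex.conjCLE.toContinuousLinearMap) ψ (stdVec d j)
  have h3 : ∫ x, (starRingEnd ℂ) (φ x) * partialDeriv j ψ x
      = -∫ x, (starRingEnd ℂ) (partialDeriv j φ x) * ψ x := by
    simp only [hconj]
    exact hparts
  have e1 : pair (raise ħ j φ) ψ = pair (position j φ) ψ - ħ * pair (partialDeriv j φ) ψ := by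
    simp only [← inner_toL2, raise, LinearMap.sub_apply, LinearMap.smul_apply, map_sub, map_smul,
      inner_sub_left, inner_smul_left_eq_smul]
    simp
  have e2 : pair φ (lower ħ j ψ) = pair φ (position j ψ) + ħ * pair φ (partialDeriv j ψ) := by
    simp only [← inner_toL2, lower, LinearMap.add_apply, LinearMap.smul_apply, map_add, map_smul,
      inner_add_right, inner_smul_right_eq_smul]
    simp
  have e3 : pair (position j φ) ψ = pair φ (position j ψ) := by
    simp only [pair_eq_integral, position_apply, map_mul, Complex.conj_ofReal]
    congr 1; ext x; ring
  rw [e1, e2, e3, pair_eq_integral φ (partialDeriv j ψ), h3, pair_eq_integral (partialDeriv j φ)]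
  ring

theorem pair_conj_symm (φ ψ : 𝓢(Conf d, ℂ)) : (starRingEnd ℂ) (pair ψ φ) = pair φ ψ :=
  inner_conj_symm _ _

theorem pair_lower (j : Fin d) (φ ψ : 𝓢(Conf d, ℂ)) :
    pair (lower ħ j φ) ψ = pair φ (raise ħ j ψ) := by
  rw [← pair_conj_symm, ← pair_raise, pair_conj_symm]

theorem pair_oscillator (φ ψ : 𝓢(Conf d, ℂ)) :
    pair (oscillator d ħ φ) ψ = pair φ (oscillator d ħ ψ) := by
  have (j : Fin d) : pair (raise ħ j (lower ħ j φ)) ψ = pair φ (raise ħ j (lower ħ j ψ)) := by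
    rw [pair_raise, pair_lower]
  simp only [oscillator_eq_sum, ← inner_toL2, map_add, map_smul, map_sum, inner_add_left,
    inner_add_right, inner_smul_left_eq_smul, inner_smul_right_eq_smul, inner_sum, sum_inner] at this ⊢
  simp [this]

/-! ### The ground state -/

/-- One term of the exponential series bounds the power by `p! exp(1 + r)`; completing the square
gives `r - b r² ≤ 1/(4b)`. -/
theorem one_add_pow_mul_exp_neg_sq_le {b : ℝ} (hb : 0 < b) (p : ℕ) {r : ℝ} (hr : 0 ≤ r) :
    (1 + r) ^ p * Real.exp (-b * r ^ 2) ≤ p.factorial * Real.exp (1 + 1 / (4 * b)) := by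
  have h1 : (1 + r) ^ p ≤ p.factorial * Real.exp (1 + r) := by
    have := Real.pow_div_factorial_le_exp (1 + r) (by positivity) p
    rwa [div_le_iff₀' (by positivity)] at this
  have h2 : r - b * r ^ 2 ≤ 1 / (4 * b) := by
    rw [le_div_iff₀ (by positivity)]
    nlinarith [sq_nonneg (2 * b * r - 1)]
  calc (1 + r) ^ p * Real.exp (-b * r ^ 2)
      ≤ p.factorial * Real.exp (1 + r) * Real.exp (-b * r ^ 2) := by gcongr
    _ = p.factorial * Real.exp (1 + (r - b * r ^ 2)) := by
        rw [mul_assoc, ← Real.exp_add]; ring_nf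
    _ ≤ _ := by gcongr

/-- The Gaussian `exp(-b |x|²)` as a Schwartz function. -/
def gaussianSchwartz {E : Type*} [NormedAddCommGroup E] [InnerProductSpace ℝ E] (b : ℝ)
    (hb : 0 < b) : 𝓢(E, ℝ) where
  toFun x := Real.exp (-b * ‖x‖ ^ 2)
  smooth' := (contDiff_const.mul (contDiff_norm_sq ℝ)).exp
  decay' k n := by
    have hq : Function.HasTemperateGrowth (fun x : E => -b * ‖x‖ ^ 2) := by fun_prop
    obtain ⟨m, C, hC, hle⟩ := hq.norm_iteratedFDeriv_le_uniform n
    refine ⟨n.factorial * (1 + C) ^ n * ((k + m * n).factorial * Real.exp (1 + 1 / (4 * b))),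
      fun x => ?_⟩
    have hx : 1 ≤ 1 + ‖x‖ := by simp
    have h1 : ‖iteratedFDeriv ℝ n (Real.exp ∘ fun x : E => -b * ‖x‖ ^ 2) x‖
        ≤ n.factorial * Real.exp (-b * ‖x‖ ^ 2) * ((1 + C) * (1 + ‖x‖) ^ m) ^ n := by
      refine norm_iteratedFDeriv_comp_le (N := n) Real.contDiff_exp
        (contDiff_const.mul (contDiff_norm_sq ℝ)) le_rfl x
        (fun i _ => ?_) fun i hi hin => ?_
      · rw [norm_iteratedFDeriv_eq_norm_iteratedDeriv, iteratedDeriv_eq_iterate,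
          Real.iter_deriv_exp]
        simp
      -- The composition bound wants the `i`-th derivative of the quadratic below the `i`-th power
      -- of one number. Enlarging `C` to `1 + C` makes that number at least `1`, hence below its own
      -- powers.
      · have h2 : 1 ≤ (1 + C) * (1 + ‖x‖) ^ m :=
          one_le_mul_of_one_le_of_one_le (by linarith) (one_le_pow₀ hx)
        calc _ ≤ C * (1 + ‖x‖) ^ m := hle i hin x
          _ ≤ (1 + C) * (1 + ‖x‖) ^ m := by gcongr; linarith
          _ ≤ _ := le_self_pow₀ h2 (by lia)
    calc ‖x‖ ^ k * ‖iteratedFDeriv ℝ n (fun x : E => Real.exp (-b * ‖x‖ ^ 2)) x‖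
        ≤ (1 + ‖x‖) ^ k *
          (n.factorial * Real.exp (-b * ‖x‖ ^ 2) * ((1 + C) * (1 + ‖x‖) ^ m) ^ n) := by
          refine mul_le_mul ?_ h1 (norm_nonneg _) (by positivity)
          gcongr; linarith
      _ = n.factorial * (1 + C) ^ n * ((1 + ‖x‖) ^ (k + m * n) * Real.exp (-b * ‖x‖ ^ 2)) := by
          rw [mul_pow, ← pow_mul, pow_add]; ring
      _ ≤ _ := by
          exact mul_le_mul_of_nonneg_left (one_add_pow_mul_exp_neg_sq_le hb _ (norm_nonneg x))
            (by positivity)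

@[simp]
theorem gaussianSchwartz_apply {E : Type*} [NormedAddCommGroup E] [InnerProductSpace ℝ E] {b : ℝ}
    (hb : 0 < b) (x : E) : gaussianSchwartz b hb x = Real.exp (-b * ‖x‖ ^ 2) := rfl

/-- The `L²`-normalized ground state `(πħ)^(-d/4) exp(-|x|²/(2ħ))`. -/
def ground (d : ℕ) (hħ : 0 < ħ) : 𝓢(Conf d, ℂ) :=
  ((Real.pi * ħ) ^ (-(d / 4 : ℝ)) : ℝ) •
    (gaussianSchwartz (E := Conf d) (1 / (2 * ħ)) (by positivity)).postcompCLM (𝕜 := ℝ)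
      Complex.ofRealCLM

theorem ground_apply (hħ : 0 < ħ) (x : Conf d) :
    ground d hħ x
      = (((Real.pi * ħ) ^ (-(d / 4 : ℝ)) * Real.exp (-(1 / (2 * ħ)) * ‖x‖ ^ 2) : ℝ) : ℂ) := by
  simp [ground]

theorem lower_ground (hħ : 0 < ħ) (j : Fin d) : lower ħ j (ground d hħ) = 0 := by
  ext x
  rw [lower_apply]
  have h1 : (ground d hħ : Conf d → ℂ) = fun y => Complex.ofRealCLM
      ((Real.pi * ħ) ^ (-(d / 4 : ℝ)) * Real.exp (-(1 / (2 * ħ)) * ‖y‖ ^ 2)) := by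
    ext y
    rw [ground_apply]; rfl
  have h2 : HasFDerivAt (fun y : Conf d => Complex.ofRealCLM
      ((Real.pi * ħ) ^ (-(d / 4 : ℝ)) * Real.exp (-(1 / (2 * ħ)) * ‖y‖ ^ 2))) _ x :=
    (Complex.ofRealCLM.hasFDerivAt).comp x
      ((((hasStrictFDerivAt_norm_sq x).hasFDerivAt.const_mul (-(1 / (2 * ħ)))).exp).const_mul
        ((Real.pi * ħ) ^ (-(d / 4 : ℝ))))
  have h3 : inner ℝ x (EuclideanSpace.single j (1 : ℝ)) = x j := by
    simp [EuclideanSpace.inner_single_right]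
  have hne : (ħ : ℂ) ≠ 0 := by exact_mod_cast hħ.ne'
  rw [h1, h2.fderiv]
  simp only [stdVec, EuclideanSpace.basisFun_apply, ContinuousLinearMap.comp_apply,
    smul_apply, innerSL_apply_apply, h3, smul_eq_mul, Complex.ofRealCLM_apply,
    nsmul_eq_mul, Complex.ofReal_mul, Complex.ofReal_neg, Complex.ofReal_div]
  simp
  field_simp
  ring

theorem pair_ground (hħ : 0 < ħ) : pair (ground d hħ) (ground d hħ) = 1 := by
  rw [pair_eq_integral]
  simp only [ground_apply, Complex.conj_ofReal, ← Complex.ofReal_mul]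
  rw [integral_complex_ofReal]
  have h (x : Conf d) : (Real.pi * ħ) ^ (-(d / 4 : ℝ)) * Real.exp (-(1 / (2 * ħ)) * ‖x‖ ^ 2) *
      ((Real.pi * ħ) ^ (-(d / 4 : ℝ)) * Real.exp (-(1 / (2 * ħ)) * ‖x‖ ^ 2))
      = (Real.pi * ħ) ^ (-(d / 2 : ℝ)) * Real.exp (-(1 / ħ) * ‖x‖ ^ 2) := by
    rw [mul_mul_mul_comm, ← Real.rpow_add (by positivity), ← Real.exp_add]
    congr 2 <;> ring
  simp only [h]
  rw [integral_const_mul, GaussianFourier.integral_rexp_neg_mul_sq_norm (by positivity)]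
  rw [finrank_euclideanSpace, Fintype.card_fin, div_div_eq_mul_div, div_one,
    ← Real.rpow_add (by positivity)]
  simp

/-! ### Excited states and traces over the levels -/

/-- The unnormalized excited states `b_{J 0} ⋯ b_{J (N-1)} h₀`. -/
def excited (hħ : 0 < ħ) : (N : ℕ) → (Fin N → Fin d) → 𝓢(Conf d, ℂ)
  | 0, _ => ground d hħ
  | N + 1, J => raise ħ (J 0) (excited hħ N (Fin.tail J))

/-- The trace `∑ B(h_α, h_α)` of a bilinear map over the level `|α| = N`. -/
def levelTrace (hħ : 0 < ħ) (N : ℕ) {M : Type*} [AddCommGroup M] [Module ℝ M]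
    (B : 𝓢(Conf d, ℂ) →ₗ[ℝ] 𝓢(Conf d, ℂ) →ₗ[ℝ] M) : M :=
  (N.factorial * (2 * ħ) ^ N : ℝ)⁻¹ • ∑ J : Fin N → Fin d, B (excited hħ N J) (excited hħ N J)

section Trace

variable {M : Type*} [AddCommGroup M] [Module ℝ M] (hħ : 0 < ħ)
  (B B' : 𝓢(Conf d, ℂ) →ₗ[ℝ] 𝓢(Conf d, ℂ) →ₗ[ℝ] M)

theorem levelTrace_zero : levelTrace hħ 0 B = B (ground d hħ) (ground d hħ) := by
  simp [levelTrace, excited]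

theorem levelTrace_add (N : ℕ) :
    levelTrace hħ N (B + B') = levelTrace hħ N B + levelTrace hħ N B' := by
  simp [levelTrace, Finset.sum_add_distrib]

theorem levelTrace_smul (N : ℕ) (c : ℝ) : levelTrace hħ N (c • B) = c • levelTrace hħ N B := by
  simp only [levelTrace, LinearMap.smul_apply, ← Finset.smul_sum]
  rw [smul_comm]

theorem levelTrace_flip (N : ℕ) : levelTrace hħ N B.flip = levelTrace hħ N B := by
  simp [levelTrace]

theorem levelTrace_map {M' : Type*} [AddCommGroup M'] [Module ℝ M'] (L : M →ₗ[ℝ] M') (N : ℕ) :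
    levelTrace hħ N (B.compr₂ L) = L (levelTrace hħ N B) := by
  simp [levelTrace]

/-- Splits off the first letter of the word; `2ħ(N + 1)` is the ratio of consecutive normalizations.
-/
theorem levelTrace_succ (N : ℕ) :
    levelTrace hħ (N + 1) B = (2 * ħ * (N + 1))⁻¹ •
      ∑ j, levelTrace hħ N (B.compl₁₂ (raise ħ j) (raise ħ j)) := by
  simp only [levelTrace, ← Finset.smul_sum, smul_smul]
  congr 1
  · rw [Nat.factorial_succ, ← mul_inv]
    push_cast
    ring
  · rw [← (Fin.consEquiv fun _ : Fin (N + 1) => Fin d).sum_comp, Fintype.sum_prod_type]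
    simp [excited, Fin.consEquiv]

/-- Cyclicity of the trace: lowering maps level `N + 1` to level `N`, with the raising operator as
its adjoint, so it can be transferred to the other slot at the price of a change of level. All later
recurrences rest on this. -/
theorem levelTrace_lower_left (N : ℕ) (i : Fin d) :
    levelTrace hħ (N + 1) (B.compl₁₂ (lower ħ i) LinearMap.id)
      = levelTrace hħ N (B.compl₁₂ LinearMap.id (raise ħ i)) := by
  -- Commuting `a_i` past the split-off `b_j` yields one commutator term `2ħ`; if the commuted terms
  -- contribute `2ħN`, the total `2ħ(N + 1)` cancels the normalization of `levelTrace_succ`.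
  have key (B : 𝓢(Conf d, ℂ) →ₗ[ℝ] 𝓢(Conf d, ℂ) →ₗ[ℝ] M) (N : ℕ) (h : ∑ j, levelTrace hħ N
        ((B.compl₁₂ (raise ħ j) (raise ħ j)).compl₁₂ (lower ħ i) LinearMap.id)
      = (2 * ħ * N) • levelTrace hħ N (B.compl₁₂ LinearMap.id (raise ħ i))) :
      levelTrace hħ (N + 1) (B.compl₁₂ (lower ħ i) LinearMap.id)
      = levelTrace hħ N (B.compl₁₂ LinearMap.id (raise ħ i)) := by
    have h1 (j : Fin d) : (B.compl₁₂ (lower ħ i) LinearMap.id).compl₁₂ (raise ħ j) (raise ħ j)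
        = (B.compl₁₂ (raise ħ j) (raise ħ j)).compl₁₂ (lower ħ i) LinearMap.id
          + (if i = j then 2 * ħ else 0) • B.compl₁₂ LinearMap.id (raise ħ j) := by
      ext φ ψ
      by_cases hij : i = j <;> simp [lower_raise_apply, hij]
    have h2 : ∑ j, (if i = j then 2 * ħ else 0) •
          levelTrace hħ N (B.compl₁₂ LinearMap.id (raise ħ j))
        = (2 * ħ) • levelTrace hħ N (B.compl₁₂ LinearMap.id (raise ħ i)) := by
      simp
    rw [levelTrace_succ]
    simp only [h1, levelTrace_add, levelTrace_smul, Finset.sum_add_distrib, h, h2]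
    rw [← add_smul, smul_smul]
    convert one_smul ℝ _
    field_simp
  induction N generalizing B with
  | zero =>
    apply key
    simp [levelTrace_zero, lower_ground]
  | succ N ih =>
    apply key
    -- After the induction hypothesis, commuting the raising operators shows the sum over `j` in the
    -- form of `levelTrace_succ` read backwards, which supplies the factor `2ħ(N + 1)` needed here.
    have h1 (j : Fin d) : (B.compl₁₂ (raise ħ j) (raise ħ j)).compl₁₂ LinearMap.id (raise ħ i)
        = (B.compl₁₂ LinearMap.id (raise ħ i)).compl₁₂ (raise ħ j) (raise ħ j) := by
      ext φ ψ
      simp [raise_raise_apply j i]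
    simp only [ih, h1]
    rw [levelTrace_succ, smul_smul]
    push_cast
    rw [mul_inv_cancel₀ (by positivity), one_smul]

theorem levelTrace_lower_right (N : ℕ) (i : Fin d) :
    levelTrace hħ (N + 1) (B.compl₁₂ LinearMap.id (lower ħ i))
      = levelTrace hħ N (B.compl₁₂ (raise ħ i) LinearMap.id) := by
  rw [← levelTrace_flip, ← levelTrace_flip (B := B.compl₁₂ (raise ħ i) LinearMap.id)]
  exact levelTrace_lower_left hħ B.flip N i

end Trace

/-! ### The level projections -/

theorem number_excited (hħ : 0 < ħ) (N : ℕ) (J : Fin N → Fin d) :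
    ∑ j, raise ħ j (lower ħ j (excited hħ N J)) = (2 * ħ * N) • excited hħ N J := by
  induction N with
  | zero => simp [excited, lower_ground]
  | succ N ih =>
    have h := congrArg (raise ħ (J 0)) (ih (Fin.tail J))
    have h2 : ∑ j, (2 * ħ) • raise ħ j (if j = J 0 then excited hħ N (Fin.tail J) else 0)
        = (2 * ħ) • excited hħ (N + 1) J := by
      rw [Finset.sum_eq_single (J 0)]
      · simp [excited]
      · intro j _ hj
        simp [hj]
      · simp
    simp only [map_sum, map_smul, raise_raise_apply (J 0)] at h
    simp only [excited, lower_raise_apply, map_add, map_smul, Finset.sum_add_distrib] at h2 ⊢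
    rw [h, h2]
    push_cast
    module

theorem oscillator_excited (hħ : 0 < ħ) (N : ℕ) (J : Fin N → Fin d) :
    oscillator d ħ (excited hħ N J) = energy d ħ N • excited hħ N J := by
  rw [oscillator_eq_sum, number_excited, energy]
  module

theorem toL2_excited_mem_eigenspace (hħ : 0 < ħ) (N : ℕ) (J : Fin N → Fin d) :
    toL2 (excited hħ N J) ∈ eigenspace d ħ (energy d ħ N) := by
  intro φ
  change pair _ _ = _ * pair _ _
  rw [pair_oscillator, oscillator_excited, ← inner_toL2, map_smul, inner_smul_right_eq_smul,
    inner_toL2, Complex.real_smul]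

/-- The ladder operators are bundled as real-linear maps; complex scalars arise as the coefficients
in `rankOne`. -/
theorem raise_smul_complex (j : Fin d) (c : ℂ) (φ : 𝓢(Conf d, ℂ)) :
    raise ħ j (c • φ) = c • raise ħ j φ := by
  ext x
  have h : (⇑(c • φ) : Conf d → ℂ) = c • ⇑φ := rfl
  rw [raise_apply, smul_apply, smul_apply, raise_apply, h, fderiv_const_smul φ.differentiableAt]
  simp only [smul_eq_mul, smul_apply]
  ring

/-- The rank-one form `(p, q) ↦ ⟨q, φ⟩ p`. -/
def rankOne (φ : 𝓢(Conf d, ℂ)) : 𝓢(Conf d, ℂ) →ₗ[ℝ] 𝓢(Conf d, ℂ) →ₗ[ℝ] 𝓢(Conf d, ℂ) :=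
  LinearMap.mk₂ ℝ (fun p q => pair q φ • p)
    (fun p p' q => smul_add _ _ _) (fun c p q => smul_comm _ _ _)
    (fun p q q' => by simp only [← inner_toL2, map_add, inner_add_left, add_smul])
    (fun c p q => by
      simp only [← inner_toL2, map_smul, inner_smul_left_eq_smul, smul_assoc])

theorem rankOne_apply (φ p q : 𝓢(Conf d, ℂ)) : rankOne φ p q = pair q φ • p := rfl

/-- In terms of the level projections this is `P_{N+1} b_j = b_j P_N`. Starting from the normalized
ground state it gives `P_N` the identity on every word of length `N`, with no orthogonality relation
between words. -/
theorem levelTrace_rankOne_raise (hħ : 0 < ħ) (N : ℕ) (j : Fin d) (φ : 𝓢(Conf d, ℂ)) :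
    levelTrace hħ (N + 1) (rankOne (raise ħ j φ))
      = raise ħ j (levelTrace hħ N (rankOne φ)) := by
  have h1 : rankOne (raise ħ j φ) = (rankOne φ).compl₁₂ LinearMap.id (lower ħ j) := by
    apply LinearMap.ext₂
    intro p q
    simp [rankOne_apply, pair_lower]
  have h2 : (rankOne φ).compl₁₂ (raise ħ j) LinearMap.id = (rankOne φ).compr₂ (raise ħ j) := by
    apply LinearMap.ext₂
    intro p q
    simp [rankOne_apply, raise_smul_complex]
  rw [h1, levelTrace_lower_right, h2, levelTrace_map]

theorem levelTrace_rankOne_excited (hħ : 0 < ħ) (N : ℕ) (J : Fin N → Fin d) :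
    levelTrace hħ N (rankOne (excited hħ N J)) = excited hħ N J := by
  induction N with
  | zero => simp [levelTrace_zero, excited, rankOne_apply, pair_ground]
  | succ N ih => rw [excited, levelTrace_rankOne_raise, ih]

/-- The projection `ψ ↦ ∑ ⟨h_α, ψ⟩ h_α` onto the level `|α| = N`. -/
def levelProj (hħ : 0 < ħ) (N : ℕ) (ψ : L2 d) : L2 d :=
  (N.factorial * (2 * ħ) ^ N : ℝ)⁻¹ • ∑ J : Fin N → Fin d,
    inner ℂ (toL2 (excited hħ N J)) ψ • toL2 (excited hħ N J)

theorem toL2_smul_complex (c : ℂ) (φ : 𝓢(Conf d, ℂ)) : toL2 (c • φ) = c • toL2 φ :=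
  (SchwartzMap.toLpCLM ℂ ℂ 2 (volume : Measure (Conf d))).map_smul c φ

theorem levelProj_excited (hħ : 0 < ħ) (N : ℕ) (J : Fin N → Fin d) :
    levelProj hħ N (toL2 (excited hħ N J)) = toL2 (excited hħ N J) := by
  conv_rhs => rw [← levelTrace_rankOne_excited hħ N J]
  simp only [levelProj, levelTrace, map_smul, map_sum, rankOne_apply, toL2_smul_complex, inner_toL2]

theorem inner_levelProj_left (hħ : 0 < ħ) (N : ℕ) (ψ χ : L2 d) :
    inner ℂ (levelProj hħ N ψ) χ = inner ℂ ψ (levelProj hħ N χ) := by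
  simp only [levelProj, inner_smul_left_eq_smul, inner_smul_right_eq_smul, sum_inner, inner_sum,
    inner_smul_left, inner_conj_symm, smul_eq_mul]
  simp only [mul_comm]

theorem levelProj_mem_eigenspace (hħ : 0 < ħ) (N : ℕ) (ψ : L2 d) :
    levelProj hħ N ψ ∈ eigenspace d ħ (energy d ħ N) := by
  exact Submodule.smul_of_tower_mem _ _ (Submodule.sum_mem _ fun J _ =>
    Submodule.smul_mem _ _ (toL2_excited_mem_eigenspace hħ N J))

/-! ### Completeness of the excited states -/

/-- An integrable function with vanishing Fourier transform vanishes almost everywhere. -/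
theorem ae_eq_zero_of_fourier_eq_zero {V : Type*} [NormedAddCommGroup V] [InnerProductSpace ℝ V]
    [FiniteDimensional ℝ V] [MeasurableSpace V] [BorelSpace V] {g : V → ℂ} (hg : Integrable g)
    (h : ∀ w, 𝓕 g w = 0) : ∀ᵐ x, g x = 0 := by
  refine ae_eq_zero_of_integral_contDiff_smul_eq_zero hg.locallyIntegrable fun k hk hks => ?_
  have hk1 : HasCompactSupport (Complex.ofRealCLM ∘ k) := hks.comp_left rfl
  have hk2 : ContDiff ℝ (⊤ : ℕ∞) (Complex.ofRealCLM ∘ k) := by fun_prop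
  set φ : 𝓢(V, ℂ) := hk1.toSchwartzMap hk2
  have h1 : 𝓕 (𝓕⁻ φ) = φ := FourierTransform.fourier_fourierInv_eq φ
  have h2 : ∫ ξ, 𝓕 g ξ • (𝓕⁻ φ) ξ = ∫ x, g x • 𝓕 ((𝓕⁻ φ : 𝓢(V, ℂ)) : V → ℂ) x := by
    simpa using! VectorFourier.integral_fourierIntegral_smul_eq_flip (L := innerₗ V)
      Real.continuous_fourierChar continuous_inner hg (𝓕⁻ φ : 𝓢(V, ℂ)).integrable
  rw [← SchwartzMap.fourier_coe, h1] at h2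
  simp only [h, zero_smul, integral_zero] at h2
  rw [h2]
  congr 1
  ext x
  change _ = g x • (k x : ℂ)
  simp [mul_comm]

/-- The real span of all excited states. -/
def excitedSpan (d : ℕ) (hħ : 0 < ħ) : Submodule ℝ 𝓢(Conf d, ℂ) :=
  Submodule.span ℝ (⋃ N, Set.range (excited hħ N : (Fin N → Fin d) → 𝓢(Conf d, ℂ)))

theorem excited_mem_excitedSpan (hħ : 0 < ħ) (N : ℕ) (J : Fin N → Fin d) :
    excited hħ N J ∈ excitedSpan d hħ :=
  Submodule.subset_span (Set.mem_iUnion.mpr ⟨N, J, rfl⟩)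

theorem excitedSpan_map_le (hħ : 0 < ħ) (T : Module.End ℝ 𝓢(Conf d, ℂ))
    (h : ∀ N J, T (excited hħ N J) ∈ excitedSpan d hħ) {φ : 𝓢(Conf d, ℂ)}
    (hφ : φ ∈ excitedSpan d hħ) : T φ ∈ excitedSpan d hħ := by
  refine (Submodule.span_le (p := (excitedSpan d hħ).comap T)).mpr ?_ hφ
  rintro _ hx
  obtain ⟨N, J, rfl⟩ := Set.mem_iUnion.mp hx
  exact h N J

theorem raise_mem_excitedSpan (hħ : 0 < ħ) (j : Fin d) {φ : 𝓢(Conf d, ℂ)}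
    (hφ : φ ∈ excitedSpan d hħ) : raise ħ j φ ∈ excitedSpan d hħ := by
  refine excitedSpan_map_le hħ _ (fun N J => ?_) hφ
  have := excited_mem_excitedSpan hħ (N + 1) (Fin.cons j J)
  simpa [excited] using this

theorem lower_mem_excitedSpan (hħ : 0 < ħ) (j : Fin d) {φ : 𝓢(Conf d, ℂ)}
    (hφ : φ ∈ excitedSpan d hħ) : lower ħ j φ ∈ excitedSpan d hħ := by
  refine excitedSpan_map_le hħ _ (fun N J => ?_) hφ
  induction N with
  | zero => simp [excited, lower_ground]
  | succ N ih =>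
    rw [excited, lower_raise_apply]
    refine add_mem (raise_mem_excitedSpan hħ _ (ih _)) (Submodule.smul_mem _ _ ?_)
    split_ifs
    · exact excited_mem_excitedSpan hħ _ _
    · exact zero_mem _

theorem position_mem_excitedSpan (hħ : 0 < ħ) (j : Fin d) {φ : 𝓢(Conf d, ℂ)}
    (hφ : φ ∈ excitedSpan d hħ) : position j φ ∈ excitedSpan d hħ := by
  have : position j φ = (1 / 2 : ℝ) • (raise ħ j φ + lower ħ j φ) := by
    simp only [raise, lower, LinearMap.sub_apply, LinearMap.add_apply, LinearMap.smul_apply]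
    module
  rw [this]
  exact Submodule.smul_mem _ _
    (add_mem (raise_mem_excitedSpan hħ _ hφ) (lower_mem_excitedSpan hħ _ hφ))

/-- Coordinates are half the sum of raising and lowering, so the span is stable under multiplication
by polynomials. These elements produce the moments in the completeness argument. -/
theorem exists_mem_excitedSpan_inner_pow_mul_ground (hħ : 0 < ħ) (w : Conf d) (k : ℕ) :
    ∃ φ ∈ excitedSpan d hħ, ∀ x, φ x = (inner ℝ x w : ℂ) ^ k * ground d hħ x := by
  induction k with
  | zero => exact ⟨ground d hħ, excited_mem_excitedSpan hħ 0 Fin.elim0, by simp⟩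
  | succ k ih =>
    obtain ⟨φ, hφ, h⟩ := ih
    refine ⟨∑ j, w j • position j φ, Submodule.sum_mem _ fun j _ =>
      Submodule.smul_mem _ _ (position_mem_excitedSpan hħ j hφ), fun x => ?_⟩
    simp only [sum_apply, smul_apply, position_apply, h, PiLp.inner_apply, Complex.ofReal_sum,
      Complex.real_smul, pow_succ]
    rw [mul_comm _ (∑ i, _), Finset.sum_mul, Finset.sum_mul]
    refine Finset.sum_congr rfl fun i _ => ?_
    simp
    ring

/-- Half of the Gaussian decay absorbs the exponential, by completing the square. Paired with an
`L²` function this gives the integrable majorant for the moment series. -/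
theorem memLp_exp_mul_ground (hħ : 0 < ħ) (c : ℝ) :
    MemLp (fun x : Conf d => (Real.exp (c * ‖x‖) : ℂ) * ground d hħ x) 2 := by
  have h1 := (gaussianSchwartz (E := Conf d) (1 / (4 * ħ)) (by positivity)).memLp 2 volume
  refine (h1.const_mul (Real.exp (ħ * c ^ 2) * (Real.pi * ħ) ^ (-(d / 4 : ℝ)))).mono
    (by fun_prop) (Filter.Eventually.of_forall fun x => ?_)
  rw [ground_apply, ← Complex.ofReal_mul, Complex.norm_real, gaussianSchwartz_apply]
  have hp : 0 < (Real.pi * ħ) ^ (-(d / 4 : ℝ)) := by positivity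
  rw [Real.norm_of_nonneg (by positivity), Real.norm_of_nonneg (by positivity)]
  have h2 : Real.exp (c * ‖x‖) * Real.exp (-(1 / (2 * ħ)) * ‖x‖ ^ 2)
      ≤ Real.exp (ħ * c ^ 2) * Real.exp (-(1 / (4 * ħ)) * ‖x‖ ^ 2) := by
    rw [← Real.exp_add, ← Real.exp_add]
    refine Real.exp_le_exp.mpr ?_
    have : ħ * c ^ 2 + -(1 / (4 * ħ)) * ‖x‖ ^ 2 - (c * ‖x‖ + -(1 / (2 * ħ)) * ‖x‖ ^ 2)
        = (2 * ħ * c - ‖x‖) ^ 2 / (4 * ħ) := by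
      field_simp
      ring
    have h3 : 0 ≤ (2 * ħ * c - ‖x‖) ^ 2 / (4 * ħ) := by positivity
    linarith
  rw [mul_left_comm, mul_right_comm, mul_comm ((Real.pi * ħ) ^ _)]
  gcongr

/-- Orthogonality to the excited states kills every moment of `h₀ χ`, where `h₀` is the ground
state. Expanding the character in a power series then makes the Fourier transform of `h₀ χ` vanish,
so `h₀ χ = 0` almost everywhere, and `h₀` has no zeros. -/
theorem eq_zero_of_inner_excited_eq_zero (hħ : 0 < ħ) (χ : L2 d)
    (h : ∀ N (J : Fin N → Fin d), inner ℂ (toL2 (excited hħ N J)) χ = 0) : χ = 0 := by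
  have hspan : ∀ φ ∈ excitedSpan d hħ, inner ℂ (toL2 φ) χ = 0 := by
    intro φ hφ
    induction hφ using Submodule.span_induction with
    | mem x hx =>
      obtain ⟨N, J, rfl⟩ := Set.mem_iUnion.mp hx
      exact h N J
    | zero => simp
    | add x y _ _ hx hy => rw [map_add, inner_add_left, hx, hy, add_zero]
    | smul a x _ hx => rw [map_smul, inner_smul_left_eq_smul, hx, smul_zero]
  have hχ : MemLp (χ : Conf d → ℂ) 2 := Lp.memLp χ
  have hint (c : ℝ) : Integrable fun x : Conf d =>
      ((Real.exp (c * ‖x‖) : ℂ) * ground d hħ x) * χ x :=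
    (memLp_exp_mul_ground hħ c).integrable_mul hχ
  have hg : Integrable fun x : Conf d => ground d hħ x * χ x := by simpa using hint 0
  have hmom (w : Conf d) (k : ℕ) :
      ∫ x : Conf d, (inner ℝ x w : ℂ) ^ k * (ground d hħ x * χ x) = 0 := by
    obtain ⟨φ, hφ, hφx⟩ := exists_mem_excitedSpan_inner_pow_mul_ground hħ w k
    rw [← hspan φ hφ, L2.inner_def]
    refine integral_congr_ae ?_
    filter_upwards [φ.coeFn_toLp 2 volume] with x hx
    rw [toL2_apply, hx, hφx, RCLike.inner_apply, ground_apply]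
    simp only [map_mul, map_pow, Complex.conj_ofReal]
    ring
  have hF : ∀ w, 𝓕 (fun x : Conf d => ground d hħ x * χ x) w = 0 := by
    intro w
    rw [Real.fourier_eq']
    have hs := hasSum_integral_of_dominated_convergence (μ := (volume : Measure (Conf d)))
      (F := fun k x => (-2 * Real.pi * Complex.I) ^ k / k.factorial *
        ((inner ℝ x w : ℂ) ^ k * (ground d hħ x * χ x)))
      (f := fun x => Complex.exp ((↑(-2 * Real.pi * inner ℝ x w) * Complex.I)) •
        (ground d hħ x * χ x))
      (fun k x => (2 * Real.pi * ‖w‖ * ‖x‖) ^ k / k.factorial * ‖ground d hħ x * χ x‖)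
      (fun k => ?_) (fun k => ?_) ?_ ?_ ?_
    · simp only [integral_const_mul, hmom, mul_zero] at hs
      exact hs.unique hasSum_zero
    · exact ((Continuous.aestronglyMeasurable (by fun_prop)).mul hg.1).const_mul _
    · refine Filter.Eventually.of_forall fun x => ?_
      rw [← mul_assoc, norm_mul]
      gcongr
      rw [norm_mul, norm_div, norm_pow, norm_pow, Complex.norm_natCast, Complex.norm_real,
        div_mul_eq_mul_div, ← mul_pow]
      refine div_le_div_of_nonneg_right (pow_le_pow_left₀ (by positivity) ?_ _) (by positivity)
      have := abs_real_inner_le_norm x w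
      simp only [norm_mul, norm_neg, Complex.norm_ofNat, Complex.norm_real, Complex.norm_I,
        Real.norm_eq_abs, abs_of_pos Real.pi_pos, mul_one]
      calc 2 * Real.pi * |inner ℝ x w| ≤ 2 * Real.pi * (‖x‖ * ‖w‖) := by gcongr
        _ = _ := by ring
    · exact Filter.Eventually.of_forall fun x =>
        (Real.summable_pow_div_factorial _).mul_right _
    · refine (hint (2 * Real.pi * ‖w‖)).norm.congr (Filter.Eventually.of_forall fun x => ?_)
      simp only [tsum_mul_right]
      rw [Real.exp_eq_exp_ℝ, NormedSpace.exp_eq_tsum_div, mul_assoc, norm_mul, Complex.norm_real,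
        Real.norm_of_nonneg]
      exact tsum_nonneg fun k => by positivity
    · refine Filter.Eventually.of_forall fun x => ?_
      have := (NormedSpace.expSeries_div_hasSum_exp
        ((↑(-2 * Real.pi * inner ℝ x w) * Complex.I : ℂ))).mul_right (ground d hħ x * χ x)
      rw [← Complex.exp_eq_exp_ℂ] at this
      refine Eq.mp (congrArg (fun F : ℕ → ℂ => HasSum F _) (funext fun k => ?_)) this
      rw [show (↑(-2 * Real.pi * inner ℝ x w) * Complex.I : ℂ)
        = (-2 * Real.pi * Complex.I) * (inner ℝ x w : ℝ) by push_cast; ring,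
        mul_pow]
      ring
  have := ae_eq_zero_of_fourier_eq_zero hg hF
  rw [Lp.eq_zero_iff_ae_eq_zero]
  filter_upwards [this] with x hx
  refine (mul_eq_zero.mp hx).resolve_left ?_
  rw [ground_apply]
  exact_mod_cast (by positivity : (Real.pi * ħ) ^ (-(d / 4 : ℝ)) *
    Real.exp (-(1 / (2 * ħ)) * ‖x‖ ^ 2) ≠ 0)

/-- The difference of `χ` and its projection is orthogonal to all excited states: on the same level
because the symmetric projection fixes them, on other levels because the eigenvalues differ.
Completeness finishes the argument. -/
theorem levelProj_of_mem_eigenspace (hħ : 0 < ħ) (N : ℕ) {χ : L2 d}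
    (hχ : χ ∈ eigenspace d ħ (energy d ħ N)) : levelProj hħ N χ = χ := by
  rw [eq_comm, ← sub_eq_zero]
  refine eq_zero_of_inner_excited_eq_zero hħ _ fun K J => ?_
  by_cases hKN : K = N
  · subst hKN
    rw [inner_sub_right, ← inner_levelProj_left, levelProj_excited, sub_self]
  · have h1 := (Submodule.sub_mem _ hχ (levelProj_mem_eigenspace hħ N χ)) (excited hħ K J)
    have h2 : ((oscillator d ħ (excited hħ K J)).toLp 2 volume : L2 d)
        = energy d ħ K • toL2 (excited hħ K J) := by
      rw [← toL2_apply, oscillator_excited, map_smul]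
    rw [h2, inner_smul_left_eq_smul, Complex.real_smul, ← toL2_apply, ← sub_eq_zero,
      ← sub_mul] at h1
    refine (mul_eq_zero.mp h1).resolve_left ?_
    rw [sub_eq_zero, Complex.ofReal_inj, energy, energy]
    intro h3
    have := mul_left_cancel₀ hħ.ne' h3
    exact hKN (by exact_mod_cast add_right_cancel this)

theorem spectralProj_eq_levelProj (hħ : 0 < ħ) (N : ℕ) (ψ : L2 d) :
    spectralProj d ħ (energy d ħ N) ψ = levelProj hħ N ψ := by
  refine Submodule.eq_starProjection_of_mem_of_inner_eq_zero (levelProj_mem_eigenspace hħ N ψ)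
    fun χ hχ => ?_
  rw [inner_sub_left, inner_levelProj_left, levelProj_of_mem_eigenspace hħ N hχ, sub_self]

/-! ### The integral kernel -/

/-- Testing on compactly supported functions gives functions continuous in `x`, so equality almost
everywhere becomes equality at each `x`. Varying the test function then identifies the continuous
slices. -/
theorem IsKernel.unique {T : L2 d →L[ℂ] L2 d} {K K' : Conf d → Conf d → ℂ} (hK : IsKernel T K)
    (hK' : IsKernel T K') : K = K' := by
  have hcont (L : Conf d → Conf d → ℂ) (hL : Continuous (Function.uncurry L)) (g : Conf d → ℂ)
      (hg : Continuous g) (hgs : HasCompactSupport g) : Continuous fun x => ∫ y, L x y * g y := by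
    have : (fun x => ∫ y, L x y * g y) = fun x => ∫ y in tsupport g, L x y * g y := by
      ext x
      rw [setIntegral_eq_integral_of_forall_compl_eq_zero]
      intro y hy
      rw [image_eq_zero_of_notMem_tsupport hy, mul_zero]
    rw [this]
    exact continuous_parametric_integral_of_continuous
      (f := fun x y => L x y * g y) (hL.mul (hg.comp continuous_snd)) hgs
  funext x
  have hKx : Continuous (K x) := hK.1.comp (Continuous.prodMk_right x)
  have hKx' : Continuous (K' x) := hK'.1.comp (Continuous.prodMk_right x)
  refine (Continuous.ae_eq_iff_eq volume hKx hKx').mp ?_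
  refine ae_eq_of_integral_contDiff_smul_eq hKx.locallyIntegrable hKx'.locallyIntegrable
    fun g hg hgs => ?_
  have hgc : Continuous fun y => (g y : ℂ) := Complex.continuous_ofReal.comp hg.continuous
  have hgcs : HasCompactSupport fun y => (g y : ℂ) := hgs.comp_left (g := Complex.ofReal) rfl
  have hmem : MemLp (fun y => (g y : ℂ)) 2 (volume : Measure (Conf d)) :=
    hgc.memLp_of_hasCompactSupport hgcs
  have hrep (L : Conf d → Conf d → ℂ) :
      (fun x => ∫ y, L x y * hmem.toLp _ y) = fun x => ∫ y, L x y * (g y : ℂ) := by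
    ext x
    refine integral_congr_ae ?_
    filter_upwards [hmem.coeFn_toLp] with y hy
    rw [hy]
  have h1 := (hK.2 (hmem.toLp _)).symm.trans (hK'.2 (hmem.toLp _))
  rw [hrep, hrep] at h1
  have h2 := congrFun ((Continuous.ae_eq_iff_eq volume (hcont K hK.1 _ hgc hgcs)
    (hcont K' hK'.1 _ hgc hgcs)).mp h1) x
  simpa [mul_comm] using h2

theorem IsKernel.kernel_eq {T : L2 d →L[ℂ] L2 d} {K : Conf d → Conf d → ℂ} (hK : IsKernel T K) :
    kernel T = K := by
  have h : ∃ K, IsKernel T K := ⟨K, hK⟩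
  rw [kernel, dif_pos h]
  exact h.choose_spec.unique hK

/-- The kernel `∑ h_α(x) conj h_α(y)` over the level `|α| = N`. -/
def levelKernel (hħ : 0 < ħ) (N : ℕ) (x y : Conf d) : ℂ :=
  (N.factorial * (2 * ħ) ^ N : ℝ)⁻¹ • ∑ J : Fin N → Fin d,
    excited hħ N J x * (starRingEnd ℂ) (excited hħ N J y)

theorem isKernel_levelKernel (hħ : 0 < ħ) (N : ℕ) :
    IsKernel (spectralProj d ħ (energy d ħ N)) (levelKernel hħ N) := by
  constructor
  · unfold levelKernel Function.uncurry
    fun_prop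
  · intro ψ
    rw [spectralProj_eq_levelProj hħ]
    have h1 : ∀ᵐ x : Conf d, (levelProj hħ N ψ) x = (N.factorial * (2 * ħ) ^ N : ℝ)⁻¹ •
        ∑ J : Fin N → Fin d, inner ℂ (toL2 (excited hħ N J)) ψ * excited hħ N J x := by
      have h2 : ∀ᵐ x : Conf d, ∀ J : Fin N → Fin d, (inner ℂ (toL2 (excited hħ N J)) ψ •
          toL2 (excited hħ N J) : L2 d) x
          = inner ℂ (toL2 (excited hħ N J)) ψ * excited hħ N J x := by
        rw [ae_all_iff]
        intro J
        filter_upwards [Lp.coeFn_smul (inner ℂ (toL2 (excited hħ N J)) ψ)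
          (toL2 (excited hħ N J)), (excited hħ N J).coeFn_toLp 2 volume] with x h3 h4
        rw [h3, Pi.smul_apply, toL2_apply, h4, smul_eq_mul]
      filter_upwards [h2, Lp.coeFn_smul (N.factorial * (2 * ħ) ^ N : ℝ)⁻¹
        (∑ J : Fin N → Fin d, inner ℂ (toL2 (excited hħ N J)) ψ • toL2 (excited hħ N J)),
        Lp.coeFn_finsetSum Finset.univ fun J : Fin N → Fin d =>
          inner ℂ (toL2 (excited hħ N J)) ψ • toL2 (excited hħ N J)] with x h3 h4 h5
      rw [levelProj, h4, Pi.smul_apply, h5, Finset.sum_apply]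
      simp only [h3]
    filter_upwards [h1] with x hx
    rw [hx]
    have h3 (J : Fin N → Fin d) : inner ℂ (toL2 (excited hħ N J)) ψ
        = ∫ y, (starRingEnd ℂ) (excited hħ N J y) * ψ y := by
      rw [L2.inner_def]
      refine integral_congr_ae ?_
      filter_upwards [(excited hħ N J).coeFn_toLp 2 volume] with y hy
      rw [toL2_apply, hy, RCLike.inner_apply, mul_comm]
    have h4 (J : Fin N → Fin d) :
        Integrable fun y => (starRingEnd ℂ) (excited hħ N J y) * ψ y :=
      ((excited hħ N J).memLp 2 volume).star.integrable_mul (Lp.memLp ψ)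
    simp only [levelKernel, smul_mul_assoc, Finset.sum_mul, mul_assoc]
    rw [integral_smul, integral_finsetSum]
    · simp only [h3, integral_const_mul]
      simp only [mul_comm]
    · intro J _
      exact (h4 J).const_mul _

theorem kernel_spectralProj (hħ : 0 < ħ) (N : ℕ) :
    kernel (spectralProj d ħ (energy d ħ N)) = levelKernel hħ N :=
  (isKernel_levelKernel hħ N).kernel_eq

/-! ### The Wigner transform of the level kernels -/

/-- The integrand of the Wigner transform of `φ ⊗ conj ψ`. -/
def wignerIntegrand (ħ : ℝ) (x ξ : Conf d) (φ ψ : 𝓢(Conf d, ℂ)) (v : Conf d) : ℂ :=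
  φ (x + (1 / 2 : ℝ) • v) * (starRingEnd ℂ) (ψ (x - (1 / 2 : ℝ) • v)) *
    Complex.exp (-(Complex.I / ħ) * (inner ℝ v ξ : ℝ))

theorem norm_wignerPhase (ħ : ℝ) (v ξ : Conf d) :
    ‖Complex.exp (-(Complex.I / ħ) * (inner ℝ v ξ : ℝ))‖ = 1 := by
  rw [show -(Complex.I / ħ) * (inner ℝ v ξ : ℝ) = ((-(1 / ħ) * inner ℝ v ξ : ℝ) : ℂ) * Complex.I by
    push_cast; ring, Complex.norm_exp_ofReal_mul_I]

theorem integrable_wignerIntegrand (ħ : ℝ) (x ξ : Conf d) (φ ψ : 𝓢(Conf d, ℂ)) :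
    Integrable (wignerIntegrand ħ x ξ φ ψ) := by
  have h1 : Integrable fun v : Conf d => φ (x + (1 / 2 : ℝ) • v) :=
    (φ.integrable.comp_add_left x).comp_smul (by norm_num)
  obtain ⟨C, hC, hle⟩ := ψ.decay 0 0
  simp only [pow_zero, one_mul, norm_iteratedFDeriv_zero] at hle
  have h2 := h1.mul_bdd (c := C)
    (g := fun v : Conf d => (starRingEnd ℂ) (ψ (x - (1 / 2 : ℝ) • v)) *
      Complex.exp (-(Complex.I / ħ) * (inner ℝ v ξ : ℝ)))
    (Continuous.aestronglyMeasurable (by fun_prop))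
    (Filter.Eventually.of_forall fun v => by
      rw [norm_mul, norm_wignerPhase, mul_one, RCLike.norm_conj]
      exact hle _)
  exact h2.congr (Filter.Eventually.of_forall fun v => by simp only [wignerIntegrand]; ring)

/-- The sesquilinear form `(φ, ψ) ↦ ∫ φ(x + v/2) conj ψ(x - v/2) exp(-(i/ħ) v·ξ) dv`. -/
def wignerForm (ħ : ℝ) (x ξ : Conf d) : 𝓢(Conf d, ℂ) →ₗ[ℝ] 𝓢(Conf d, ℂ) →ₗ[ℝ] ℂ :=
  LinearMap.mk₂ ℝ (fun φ ψ => ∫ v, wignerIntegrand ħ x ξ φ ψ v)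
    (fun φ φ' ψ => by
      rw [← integral_add (integrable_wignerIntegrand _ _ _ _ _)
        (integrable_wignerIntegrand _ _ _ _ _)]
      congr 1; ext v
      simp only [wignerIntegrand, add_apply]
      ring)
    (fun c φ ψ => by
      rw [← integral_smul]
      congr 1; ext v
      simp only [wignerIntegrand, smul_apply, Complex.real_smul]
      ring)
    (fun φ ψ ψ' => by
      rw [← integral_add (integrable_wignerIntegrand _ _ _ _ _)
        (integrable_wignerIntegrand _ _ _ _ _)]
      congr 1; ext v
      simp only [wignerIntegrand, add_apply, map_add]
      ring)
    (fun c φ ψ => by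
      rw [← integral_smul]
      congr 1; ext v
      simp only [wignerIntegrand, smul_apply, Complex.real_smul, map_mul, Complex.conj_ofReal]
      ring)

theorem wignerForm_apply (x ξ : Conf d) (φ ψ : 𝓢(Conf d, ℂ)) :
    wignerForm ħ x ξ φ ψ = ∫ v, wignerIntegrand ħ x ξ φ ψ v := rfl

theorem wignerForm_position (x ξ : Conf d) (j : Fin d) (φ ψ : 𝓢(Conf d, ℂ)) :
    wignerForm ħ x ξ (position j φ) ψ + wignerForm ħ x ξ φ (position j ψ)
      = 2 * x j * wignerForm ħ x ξ φ ψ := by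
  simp only [wignerForm_apply]
  rw [← integral_add (integrable_wignerIntegrand _ _ _ _ _) (integrable_wignerIntegrand _ _ _ _ _),
    ← integral_const_mul]
  congr 1; ext v
  simp only [wignerIntegrand, position_apply, map_mul, Complex.conj_ofReal, PiLp.add_apply,
    PiLp.sub_apply, PiLp.smul_apply, smul_eq_mul]
  push_cast
  ring

/-- Differentiation in `v` produces half the difference of the two derivatives; integration by parts
moves it onto the phase, which contributes `-(i/ħ) ξ_j`. -/
theorem wignerForm_partialDeriv (x ξ : Conf d) (j : Fin d) (φ ψ : 𝓢(Conf d, ℂ)) :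
    wignerForm ħ x ξ (partialDeriv j φ) ψ - wignerForm ħ x ξ φ (partialDeriv j ψ)
      = 2 * Complex.I / ħ * ξ j * wignerForm ħ x ξ φ ψ := by
  set e : Conf d → ℂ := fun v => Complex.exp (-(Complex.I / ħ) * (inner ℝ v ξ : ℝ)) with he
  set f : Conf d → ℂ := fun v => φ (x + (1 / 2 : ℝ) • v) *
    (starRingEnd ℂ) (ψ (x - (1 / 2 : ℝ) • v)) with hf
  set f' : Conf d → ℂ := fun v =>
    (1 / 2 : ℝ) • (partialDeriv j φ (x + (1 / 2 : ℝ) • v) *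
      (starRingEnd ℂ) (ψ (x - (1 / 2 : ℝ) • v)) - φ (x + (1 / 2 : ℝ) • v) *
      (starRingEnd ℂ) (partialDeriv j ψ (x - (1 / 2 : ℝ) • v))) with hf'
  have hderivf (v : Conf d) : HasLineDerivAt ℝ f (f' v) v (stdVec d j) := by
    have a1 : HasFDerivAt (fun v : Conf d => x + (1 / 2 : ℝ) • v)
        ((1 / 2 : ℝ) • ContinuousLinearMap.id ℝ (Conf d)) v :=
      ((hasFDerivAt_id v).const_smul (1 / 2 : ℝ)).const_add x
    have a2 : HasFDerivAt (fun v : Conf d => x - (1 / 2 : ℝ) • v)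
        (-((1 / 2 : ℝ) • ContinuousLinearMap.id ℝ (Conf d))) v :=
      ((hasFDerivAt_id v).const_smul (1 / 2 : ℝ)).const_sub x
    have b1 := (φ.hasFDerivAt (x + (1 / 2 : ℝ) • v)).comp v a1
    have b2 := (Complex.conjCLE.toContinuousLinearMap.hasFDerivAt).comp v
      ((ψ.hasFDerivAt (x - (1 / 2 : ℝ) • v)).comp v a2)
    refine Eq.mp (congrArg (fun c => HasLineDerivAt ℝ f c v (stdVec d j)) ?_)
      ((b1.mul b2).hasLineDerivAt (stdVec d j))
    simp [hf', partialDeriv_apply]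
    ring
  have hderive (v : Conf d) :
      HasLineDerivAt ℝ e (-(Complex.I / ħ) * ξ j * e v) v (stdVec d j) := by
    have a1 : HasFDerivAt (fun v : Conf d => inner ℝ v ξ) ((innerSL ℝ ξ)) v := by
      have := (innerSL ℝ ξ).hasFDerivAt (x := v)
      refine this.congr_of_eventuallyEq (Filter.Eventually.of_forall fun w => ?_)
      simp [real_inner_comm]
    have a2 := ((Complex.ofRealCLM.hasFDerivAt.comp v a1).const_mul (-(Complex.I / ħ))).cexp
    refine Eq.mp (congrArg (fun c => HasLineDerivAt ℝ e c v (stdVec d j)) ?_)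
      (a2.hasLineDerivAt (stdVec d j))
    have h3 : inner ℝ ξ (EuclideanSpace.single j (1 : ℝ)) = ξ j := by
      simp [EuclideanSpace.inner_single_right]
    simp [he, h3]
    ring
  have hI := integrable_wignerIntegrand ħ x ξ φ ψ
  have h := integral_bilinear_hasLineDerivAt_right_eq_neg_left_of_integrable
    (μ := (volume : Measure (Conf d))) (f := f) (f' := f') (g := e)
    (g' := fun v => -(Complex.I / ħ) * ξ j * e v) (v := stdVec d j)
    (B := ContinuousLinearMap.mul ℝ ℂ) ?_ ?_ ?_ (fun v _ => hderivf v) (fun v _ => hderive v)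
  · have e1 : ∫ v, ContinuousLinearMap.mul ℝ ℂ (f v) (-(Complex.I / ħ) * ξ j * e v)
        = -(Complex.I / ħ) * ξ j * wignerForm ħ x ξ φ ψ := by
      rw [wignerForm_apply, ← integral_const_mul]
      congr 1; ext v
      simp only [hf, he, wignerIntegrand, ContinuousLinearMap.mul_apply']
      ring
    have e2 : ∫ v, ContinuousLinearMap.mul ℝ ℂ (f' v) (e v)
        = (1 / 2 : ℂ) * (wignerForm ħ x ξ (partialDeriv j φ) ψ
          - wignerForm ħ x ξ φ (partialDeriv j ψ)) := by
      simp only [wignerForm_apply]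
      rw [← integral_sub (integrable_wignerIntegrand _ _ _ _ _)
        (integrable_wignerIntegrand _ _ _ _ _), ← integral_const_mul]
      congr 1; ext v
      simp only [hf', he, wignerIntegrand, ContinuousLinearMap.mul_apply', Complex.real_smul]
      push_cast
      ring
    rw [e1, e2] at h
    linear_combination (2 : ℂ) * h
  · refine (((integrable_wignerIntegrand ħ x ξ (partialDeriv j φ) ψ).sub
      (integrable_wignerIntegrand ħ x ξ φ (partialDeriv j ψ))).const_mul (1 / 2 : ℂ)).congr
      (Filter.Eventually.of_forall fun v => ?_)
    simp only [hf', he, wignerIntegrand, ContinuousLinearMap.mul_apply', Complex.real_smul,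
      Pi.sub_apply]
    push_cast
    ring
  · refine (hI.const_mul (-(Complex.I / ħ) * ξ j)).congr (Filter.Eventually.of_forall fun v => ?_)
    simp only [hf, he, wignerIntegrand, ContinuousLinearMap.mul_apply']
    ring
  · exact hI

/-- Position moves between the slots with a change of sign, the derivative without one, so `x_j -
ħ∂_j` reappears in the other slot as minus `x_j + ħ∂_j`, up to the phase-space coordinate. -/
theorem wignerForm_raise_left (hħ : 0 < ħ) (x ξ : Conf d) (j : Fin d) (φ ψ : 𝓢(Conf d, ℂ)) :
    wignerForm ħ x ξ (raise ħ j φ) ψ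
      = 2 * (x j - Complex.I * ξ j) * wignerForm ħ x ξ φ ψ
        - wignerForm ħ x ξ φ (lower ħ j ψ) := by
  have h1 := wignerForm_position (ħ := ħ) x ξ j φ ψ
  have h2 := wignerForm_partialDeriv (ħ := ħ) x ξ j φ ψ
  have hne : (ħ : ℂ) ≠ 0 := by exact_mod_cast hħ.ne'
  field_simp at h2
  simp only [raise, lower, LinearMap.sub_apply, LinearMap.add_apply, LinearMap.smul_apply,
    map_sub, map_add, map_smul, Complex.real_smul]
  linear_combination h1 - h2

theorem wignerForm_raise_right (hħ : 0 < ħ) (x ξ : Conf d) (j : Fin d) (φ ψ : 𝓢(Conf d, ℂ)) :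
    wignerForm ħ x ξ φ (raise ħ j ψ)
      = 2 * (x j + Complex.I * ξ j) * wignerForm ħ x ξ φ ψ
        - wignerForm ħ x ξ (lower ħ j φ) ψ := by
  have h1 := wignerForm_position (ħ := ħ) x ξ j φ ψ
  have h2 := wignerForm_partialDeriv (ħ := ħ) x ξ j φ ψ
  have hne : (ħ : ℂ) ≠ 0 := by exact_mod_cast hħ.ne'
  field_simp at h2
  simp only [raise, lower, LinearMap.sub_apply, LinearMap.add_apply, LinearMap.smul_apply,
    map_sub, map_add, map_smul, Complex.real_smul]
  linear_combination h1 + h2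

theorem wignerForm_ground (hħ : 0 < ħ) (x ξ : Conf d) :
    wignerForm ħ x ξ (ground d hħ) (ground d hħ)
      = 2 ^ d * Complex.exp (-(2 * hamiltonian x ξ / ħ)) := by
  have hne : (ħ : ℂ) ≠ 0 := by exact_mod_cast hħ.ne'
  have hpt (v : Conf d) : wignerIntegrand ħ x ξ (ground d hħ) (ground d hħ) v
      = (((Real.pi * ħ) ^ (-(d / 2 : ℝ)) : ℝ) * Complex.exp (-(‖x‖ ^ 2 / ħ : ℝ))) *
        Complex.exp (-(1 / (4 * ħ) : ℂ) * ‖v‖ ^ 2 + (-(Complex.I / ħ)) * (inner ℝ ξ v : ℝ)) := by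
    -- The parallelogram law decouples `x` from `v`, leaving the Fourier transform of a Gaussian in
    -- `v`.
    have h1 : ‖x + (1 / 2 : ℝ) • v‖ ^ 2 + ‖x - (1 / 2 : ℝ) • v‖ ^ 2
        = 2 * ‖x‖ ^ 2 + ‖v‖ ^ 2 / 2 := by
      have := parallelogram_law_with_norm ℝ x ((1 / 2 : ℝ) • v)
      rw [norm_smul] at this
      norm_num at this
      norm_num
      linarith
    have h2 : -(1 / (2 * ħ)) * ‖x + (1 / 2 : ℝ) • v‖ ^ 2
        + -(1 / (2 * ħ)) * ‖x - (1 / 2 : ℝ) • v‖ ^ 2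
        = -(‖x‖ ^ 2 / ħ) + -(1 / (4 * ħ)) * ‖v‖ ^ 2 := by
      rw [← mul_add, h1]
      field_simp
      ring
    simp only [wignerIntegrand, ground_apply, Complex.conj_ofReal]
    rw [← Complex.ofReal_mul, mul_mul_mul_comm, ← Real.rpow_add (by positivity), ← Real.exp_add, h2,
      Complex.ofReal_mul, Complex.ofReal_exp, mul_assoc, mul_assoc, ← Complex.exp_add,
      ← Complex.exp_add, real_inner_comm]
    congr 2
    · congr 1
      ring
    · push_cast
      ring
  rw [wignerForm_apply]
  simp only [hpt]
  rw [integral_const_mul, GaussianFourier.integral_cexp_neg_mul_sq_norm_add (by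
    rw [show (1 / (4 * ħ) : ℂ) = ((1 / (4 * ħ) : ℝ) : ℂ) by push_cast; rfl, Complex.ofReal_re]
    positivity)]
  rw [finrank_euclideanSpace, Fintype.card_fin]
  have h3 : (Real.pi / (1 / (4 * ħ) : ℂ)) ^ (d / 2 : ℂ)
      = (((2 : ℝ) ^ d * (Real.pi * ħ) ^ (d / 2 : ℝ) : ℝ) : ℂ) := by
    rw [show (Real.pi / (1 / (4 * ħ) : ℂ)) = ((2 ^ 2 * (Real.pi * ħ) : ℝ) : ℂ) by
      push_cast; field_simp; norm_num, show (d / 2 : ℂ) = ((d / 2 : ℝ) : ℂ) by push_cast; rfl,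
      ← Complex.ofReal_cpow (by positivity), Real.mul_rpow (by positivity) (by positivity),
      ← Real.rpow_natCast, ← Real.rpow_mul (by positivity)]
    congr 2
    rw [← Real.rpow_natCast]
    congr 1
    push_cast
    ring
  rw [h3, hamiltonian, Real.rpow_neg (by positivity)]
  have hp : ((Real.pi * ħ) ^ (d / 2 : ℝ) : ℝ) ≠ 0 := by positivity
  have hpc : (((Real.pi * ħ) ^ (d / 2 : ℝ) : ℝ) : ℂ) ≠ 0 := by exact_mod_cast hp
  rw [Complex.ofReal_mul, Complex.ofReal_inv]
  have h4 : Complex.exp (-(‖x‖ ^ 2 / ħ : ℝ)) *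
      Complex.exp ((-(Complex.I / ħ)) ^ 2 * ‖ξ‖ ^ 2 / (4 * (1 / (4 * ħ))))
      = Complex.exp (-(2 * ((‖x‖ ^ 2 + ‖ξ‖ ^ 2) / 2 : ℝ) / ħ)) := by
    rw [← Complex.exp_add]
    congr 1
    push_cast
    rw [neg_sq, div_pow, Complex.I_sq]
    field_simp
    ring
  rw [← h4]
  push_cast
  field_simp

/-- The trace of the Wigner form over the `N`-th level. -/
def wignerLevel (hħ : 0 < ħ) (x ξ : Conf d) (N : ℕ) : ℂ := levelTrace hħ N (wignerForm ħ x ξ)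

theorem wigner_eq_wignerLevel (hħ : 0 < ħ) (N : ℕ) (x ξ : Conf d) :
    wigner d ħ N x ξ = (((2 * Real.pi * ħ) ^ d : ℝ) : ℂ)⁻¹ * wignerLevel hħ x ξ N := by
  rw [wigner, wignerTransform, kernel_spectralProj hħ, wignerLevel, levelTrace]
  congr 1
  simp only [levelKernel, smul_mul_assoc, Finset.sum_mul]
  rw [integral_smul, integral_finsetSum]
  · rfl
  · exact fun J _ => integrable_wignerIntegrand ħ x ξ _ _

/-- The auxiliary sequence `ħ⁻¹ ∑ⱼ (xⱼ - i ξⱼ) tr W(·, bⱼ ·)`. -/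
def wignerLevelAux (hħ : 0 < ħ) (x ξ : Conf d) (N : ℕ) : ℂ :=
  ∑ j, (x j - Complex.I * ξ j) / ħ *
    levelTrace hħ N ((wignerForm ħ x ξ).compl₁₂ LinearMap.id (raise ħ j))

theorem levelTrace_sub {M : Type*} [AddCommGroup M] [Module ℝ M] (hħ : 0 < ħ)
    (B B' : 𝓢(Conf d, ℂ) →ₗ[ℝ] 𝓢(Conf d, ℂ) →ₗ[ℝ] M) (N : ℕ) :
    levelTrace hħ N (B - B') = levelTrace hħ N B - levelTrace hħ N B' := by
  simp [levelTrace, Finset.sum_sub_distrib, smul_sub]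

theorem wignerLevel_zero (hħ : 0 < ħ) (x ξ : Conf d) :
    wignerLevel hħ x ξ 0 = 2 ^ d * Complex.exp (-(2 * hamiltonian x ξ / ħ)) := by
  rw [wignerLevel, levelTrace_zero, wignerForm_ground]

theorem sum_coord_mul (x ξ : Conf d) :
    ∑ j, (x j - Complex.I * ξ j) * (x j + Complex.I * ξ j) = 2 * hamiltonian x ξ := by
  rw [hamiltonian, EuclideanSpace.norm_sq_eq, EuclideanSpace.norm_sq_eq, ← Finset.sum_add_distrib]
  push_cast
  rw [mul_div_cancel₀ _ (by norm_num)]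
  refine Finset.sum_congr rfl fun j _ => ?_
  rw [← Complex.ofReal_pow, ← Complex.ofReal_pow, Real.norm_eq_abs, Real.norm_eq_abs, sq_abs, sq_abs]
  push_cast
  linear_combination (-(ξ j : ℂ) ^ 2) * Complex.I_sq

theorem compl₁₂_raise_right (hħ : 0 < ħ) (x ξ : Conf d) (j : Fin d) :
    (wignerForm ħ x ξ).compl₁₂ LinearMap.id (raise ħ j)
      = (wignerForm ħ x ξ).compr₂ (LinearMap.mulLeft ℝ (2 * (x j + Complex.I * ξ j)))
        - (wignerForm ħ x ξ).compl₁₂ (lower ħ j) LinearMap.id := by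
  apply LinearMap.ext₂
  intro p q
  simp [wignerForm_raise_right hħ, mul_assoc]

theorem wignerLevelAux_zero (hħ : 0 < ħ) (x ξ : Conf d) :
    wignerLevelAux hħ x ξ 0 = 4 * hamiltonian x ξ / ħ * wignerLevel hħ x ξ 0 := by
  have h (j : Fin d) : levelTrace hħ 0 ((wignerForm ħ x ξ).compl₁₂ LinearMap.id (raise ħ j))
      = 2 * (x j + Complex.I * ξ j) * wignerLevel hħ x ξ 0 := by
    simp [wignerLevel, levelTrace_zero, wignerForm_raise_right hħ, lower_ground]
  simp only [wignerLevelAux, h]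
  have h2 := sum_coord_mul x ξ
  have hne : (ħ : ℂ) ≠ 0 := by exact_mod_cast hħ.ne'
  calc _ = (∑ j, (x j - Complex.I * ξ j) * (x j + Complex.I * ξ j)) *
        (2 / ħ * wignerLevel hħ x ξ 0) := by
        rw [Finset.sum_mul]
        exact Finset.sum_congr rfl fun j _ => by ring
    _ = _ := by rw [h2]; ring

/-- Moving `b_j` to the left slot leaves a lowering operator at level `N + 1`, which
`levelTrace_lower_left` turns into the auxiliary trace at level `N`. -/
theorem wignerLevelAux_succ (hħ : 0 < ħ) (x ξ : Conf d) (N : ℕ) :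
    wignerLevelAux hħ x ξ (N + 1)
      = 4 * hamiltonian x ξ / ħ * wignerLevel hħ x ξ (N + 1) - wignerLevelAux hħ x ξ N := by
  have h (j : Fin d) : levelTrace hħ (N + 1) ((wignerForm ħ x ξ).compl₁₂ LinearMap.id (raise ħ j))
      = 2 * (x j + Complex.I * ξ j) * wignerLevel hħ x ξ (N + 1)
        - levelTrace hħ N ((wignerForm ħ x ξ).compl₁₂ LinearMap.id (raise ħ j)) := by
    conv_lhs => rw [compl₁₂_raise_right hħ, levelTrace_sub, levelTrace_map, levelTrace_lower_left]
    rfl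
  have h2 := sum_coord_mul x ξ
  calc _ = (∑ j, (x j - Complex.I * ξ j) * (x j + Complex.I * ξ j)) *
        (2 / ħ * wignerLevel hħ x ξ (N + 1)) - wignerLevelAux hħ x ξ N := by
        simp only [wignerLevelAux, h]
        rw [Finset.sum_mul, ← Finset.sum_sub_distrib]
        exact Finset.sum_congr rfl fun j _ => by ring
    _ = _ := by rw [h2]; ring

theorem sum_lower_raise_excited (hħ : 0 < ħ) (N : ℕ) (J : Fin N → Fin d) :
    ∑ j, lower ħ j (raise ħ j (excited hħ N J)) = (2 * ħ * (N + d)) • excited hħ N J := by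
  simp only [lower_raise_apply, if_true, Finset.sum_add_distrib, number_excited, Finset.sum_const,
    Finset.card_univ, Fintype.card_fin]
  module

/-- After one letter is split off, moving the left `b_j` to the right leaves `∑ a_j b_j`, which is
the scalar `2ħ(N + d)` on the level. -/
theorem wignerLevel_succ (hħ : 0 < ħ) (x ξ : Conf d) (N : ℕ) :
    (N + 1) * wignerLevel hħ x ξ (N + 1)
      = wignerLevelAux hħ x ξ N - (N + d) * wignerLevel hħ x ξ N := by
  have hne : (ħ : ℂ) ≠ 0 := by exact_mod_cast hħ.ne'
  have h1 (j : Fin d) : (wignerForm ħ x ξ).compl₁₂ (raise ħ j) (raise ħ j)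
      = ((wignerForm ħ x ξ).compl₁₂ LinearMap.id (raise ħ j)).compr₂
          (LinearMap.mulLeft ℝ (2 * (x j - Complex.I * ξ j)))
        - (wignerForm ħ x ξ).compl₁₂ LinearMap.id (lower ħ j * raise ħ j) := by
    apply LinearMap.ext₂
    intro p q
    simp [wignerForm_raise_left hħ, mul_assoc]
  have h2 : ∑ j, levelTrace hħ N
        ((wignerForm ħ x ξ).compl₁₂ LinearMap.id (lower ħ j * raise ħ j))
      = (2 * ħ * (N + d)) * wignerLevel hħ x ξ N := by
    simp only [levelTrace, wignerLevel, ← Finset.smul_sum]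
    rw [Finset.sum_comm]
    simp only [LinearMap.compl₁₂_apply, LinearMap.id_apply, Module.End.mul_apply, ← map_sum,
      sum_lower_raise_excited, map_smul]
    rw [← Finset.smul_sum, Complex.real_smul, Complex.real_smul, Complex.real_smul]
    push_cast
    ring
  rw [wignerLevel, levelTrace_succ]
  simp only [h1, levelTrace_sub, levelTrace_map, Finset.sum_sub_distrib, h2,
    LinearMap.mulLeft_apply]
  have h3 : ∑ j, 2 * (x j - Complex.I * ξ j) *
        levelTrace hħ N ((wignerForm ħ x ξ).compl₁₂ LinearMap.id (raise ħ j))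
      = 2 * ħ * wignerLevelAux hħ x ξ N := by
    rw [wignerLevelAux, Finset.mul_sum]
    refine Finset.sum_congr rfl fun j _ => ?_
    field_simp
  rw [h3, Complex.real_smul]
  have hN : (N + 1 : ℂ) ≠ 0 := by exact_mod_cast N.succ_ne_zero
  push_cast
  field_simp

/-! ### Taylor coefficients and the generating function -/

/-- The `N`-th Taylor coefficient of `f` at the origin. -/
def taylorCoeff (N : ℕ) (f : ℂ → ℂ) : ℂ := iteratedDeriv N f 0 / N.factorial

theorem taylorCoeff_congr {f g : ℂ → ℂ} (h : f =ᶠ[nhds 0] g) (N : ℕ) :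
    taylorCoeff N f = taylorCoeff N g := by
  rw [taylorCoeff, taylorCoeff, h.iteratedDeriv_eq]

theorem taylorCoeff_zero (f : ℂ → ℂ) : taylorCoeff 0 f = f 0 := by
  simp [taylorCoeff]

theorem taylorCoeff_add {f g : ℂ → ℂ} (hf : AnalyticAt ℂ f 0) (hg : AnalyticAt ℂ g 0) (N : ℕ) :
    taylorCoeff N (fun r => f r + g r) = taylorCoeff N f + taylorCoeff N g := by
  rw [taylorCoeff, iteratedDeriv_fun_add hf.contDiffAt hg.contDiffAt, add_div]
  rfl

theorem taylorCoeff_const_mul (c : ℂ) (f : ℂ → ℂ) (N : ℕ) :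
    taylorCoeff N (fun r => c * f r) = c * taylorCoeff N f := by
  rw [taylorCoeff, iteratedDeriv_const_mul_field, mul_div_assoc]
  rfl

theorem taylorCoeff_deriv (f : ℂ → ℂ) (N : ℕ) :
    taylorCoeff N (deriv f) = (N + 1) * taylorCoeff (N + 1) f := by
  have h : (N.factorial : ℂ) ≠ 0 := by exact_mod_cast N.factorial_ne_zero
  have h1 : (N + 1 : ℂ) ≠ 0 := by exact_mod_cast N.succ_ne_zero
  rw [taylorCoeff, taylorCoeff, iteratedDeriv_succ', Nat.factorial_succ]
  push_cast
  field_simp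

theorem taylorCoeff_id_mul_zero (f : ℂ → ℂ) : taylorCoeff 0 (fun r => r * f r) = 0 := by
  simp [taylorCoeff]

theorem taylorCoeff_id_mul_succ {f : ℂ → ℂ} (hf : AnalyticAt ℂ f 0) (N : ℕ) :
    taylorCoeff (N + 1) (fun r => r * f r) = taylorCoeff N f := by
  have h : (N.factorial : ℂ) ≠ 0 := by exact_mod_cast N.factorial_ne_zero
  have h1 : (N + 1 : ℂ) ≠ 0 := by exact_mod_cast N.succ_ne_zero
  rw [taylorCoeff, iteratedDeriv_fun_mul (f := fun r : ℂ => r) contDiffAt_id hf.contDiffAt,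
    Finset.sum_eq_single 1, taylorCoeff, Nat.factorial_succ]
  · rw [iteratedDeriv_fun_id_zero]
    simp
    field_simp
  · intro i _ hi
    rw [iteratedDeriv_fun_id_zero]
    simp [hi]
  · simp

/-- The generating function `(1 + r)^(-d) exp(-(t/2) (1 - r)/(1 + r))`. -/
def genFun (d : ℕ) (t : ℝ) (r : ℂ) : ℂ :=
  ((1 + r) ^ d)⁻¹ * Complex.exp (-(t / 2) * ((1 - r) / (1 + r)))

theorem one_add_ne_zero_of_norm_lt {r : ℂ} (hr : ‖r‖ < 1) : 1 + r ≠ 0 := by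
  intro h
  rw [add_comm, add_eq_zero_iff_eq_neg] at h
  rw [h] at hr
  simp at hr

theorem hasDerivAt_genFun (d : ℕ) (t : ℝ) {r : ℂ} (hr : 1 + r ≠ 0) :
    HasDerivAt (genFun d t) (-(d / (1 + r)) * genFun d t r + t / (1 + r) ^ 2 * genFun d t r) r := by
  have h1 : HasDerivAt (fun r : ℂ => 1 + r) 1 r := (hasDerivAt_id r).const_add 1
  have h2 : HasDerivAt (fun r : ℂ => 1 - r) (-1) r := (hasDerivAt_id r).const_sub 1
  have h3 := ((h1.pow d).inv (pow_ne_zero d hr)).mul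
    (((h2.div h1 hr).const_mul (-(t / 2 : ℂ))).cexp)
  refine HasDerivAt.congr_deriv (f := genFun d t) h3 ?_
  rcases d with _ | d
  · simp [genFun]
    field_simp
    ring
  · simp [genFun]
    field_simp
    ring

theorem differentiableOn_genFun (d : ℕ) (t : ℝ) :
    DifferentiableOn ℂ (genFun d t) (Metric.ball 0 1) := fun r hr =>
  (hasDerivAt_genFun d t (one_add_ne_zero_of_norm_lt
    (by simpa using hr))).differentiableAt.differentiableWithinAt

theorem eventually_one_add_ne_zero : ∀ᶠ r : ℂ in nhds 0, 1 + r ≠ 0 := by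
  filter_upwards [Metric.ball_mem_nhds (0 : ℂ) one_pos] with r hr
  exact one_add_ne_zero_of_norm_lt (by simpa using hr)

theorem analyticAt_genFun (d : ℕ) (t : ℝ) : AnalyticAt ℂ (genFun d t) 0 :=
  (differentiableOn_genFun d t).analyticAt (Metric.ball_mem_nhds 0 one_pos)

theorem analyticAt_genFun_div (d : ℕ) (t : ℝ) :
    AnalyticAt ℂ (fun r => t * genFun d t r / (1 + r)) 0 :=
  (analyticAt_const.mul (analyticAt_genFun d t)).div (analyticAt_const.add analyticAt_id) (by simp)

/-- Coefficients of the differential equation `(1 + r) G' = tG/(1 + r) - dG`. Its first right-hand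
term plays the part of the auxiliary sequence `wignerLevelAux`. -/
theorem genFun_recurrence (d : ℕ) (t : ℝ) (N : ℕ) :
    (N + 1) * taylorCoeff (N + 1) (genFun d t)
      = taylorCoeff N (fun r => t * genFun d t r / (1 + r)) - (N + d) * taylorCoeff N (genFun d t) := by
  have hA := analyticAt_genFun d t
  have h1 : (fun r => deriv (genFun d t) r + r * deriv (genFun d t) r)
      =ᶠ[nhds 0] fun r => t * genFun d t r / (1 + r) + (-d) * genFun d t r := by
    filter_upwards [eventually_one_add_ne_zero] with r hr
    rw [(hasDerivAt_genFun d t hr).deriv]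
    field_simp
    ring
  have h2 := taylorCoeff_congr h1 N
  have hB : AnalyticAt ℂ (fun r => r * deriv (genFun d t) r) 0 := analyticAt_id.mul hA.deriv
  have hC : AnalyticAt ℂ (fun r => (-d : ℂ) * genFun d t r) 0 := analyticAt_const.mul hA
  rw [taylorCoeff_add hA.deriv hB, taylorCoeff_add (analyticAt_genFun_div d t) hC, taylorCoeff_const_mul,
    taylorCoeff_deriv] at h2
  have h3 : taylorCoeff N (fun r => r * deriv (genFun d t) r) = N * taylorCoeff N (genFun d t) := by
    cases N with
    | zero => simp [taylorCoeff_id_mul_zero]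
    | succ N =>
      rw [taylorCoeff_id_mul_succ hA.deriv, taylorCoeff_deriv]
      push_cast
      ring
  rw [h3] at h2
  linear_combination h2

theorem genFun_div_recurrence (d : ℕ) (t : ℝ) (N : ℕ) :
    taylorCoeff (N + 1) (fun r => t * genFun d t r / (1 + r))
      = t * taylorCoeff (N + 1) (genFun d t)
        - taylorCoeff N (fun r => t * genFun d t r / (1 + r)) := by
  have hA := analyticAt_genFun_div d t
  have h1 : (fun r => t * genFun d t r / (1 + r) + r * (t * genFun d t r / (1 + r)))
      =ᶠ[nhds 0] fun r => t * genFun d t r := by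
    filter_upwards [eventually_one_add_ne_zero] with r hr
    field_simp
  have h2 := taylorCoeff_congr h1 (N + 1)
  have hB : AnalyticAt ℂ (fun r => r * (t * genFun d t r / (1 + r))) 0 := analyticAt_id.mul hA
  rw [taylorCoeff_add hA hB, taylorCoeff_const_mul,
    taylorCoeff_id_mul_succ hA] at h2
  linear_combination h2

theorem wignerLevel_eq_taylorCoeff (hħ : 0 < ħ) (x ξ : Conf d) (N : ℕ) :
    wignerLevel hħ x ξ N = 2 ^ d * taylorCoeff N (genFun d (4 * hamiltonian x ξ / ħ)) ∧
    wignerLevelAux hħ x ξ N = 2 ^ d * taylorCoeff N (fun r => (4 * hamiltonian x ξ / ħ : ℝ) *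
      genFun d (4 * hamiltonian x ξ / ħ) r / (1 + r)) := by
  have h0 : wignerLevel hħ x ξ 0 = 2 ^ d * taylorCoeff 0 (genFun d (4 * hamiltonian x ξ / ħ)) := by
    rw [wignerLevel_zero, taylorCoeff_zero]
    simp [genFun]
    congr 1
    ring
  induction N with
  | zero =>
    refine ⟨h0, ?_⟩
    rw [wignerLevelAux_zero, h0, taylorCoeff_zero, taylorCoeff_zero]
    push_cast
    simp
    ring
  | succ N ih =>
    have h1 : wignerLevel hħ x ξ (N + 1)
        = 2 ^ d * taylorCoeff (N + 1) (genFun d (4 * hamiltonian x ξ / ħ)) := by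
      have h := wignerLevel_succ hħ x ξ N
      have h' := genFun_recurrence d (4 * hamiltonian x ξ / ħ) N
      have hN : (N + 1 : ℂ) ≠ 0 := by exact_mod_cast N.succ_ne_zero
      apply mul_left_cancel₀ hN
      rw [h, ih.1, ih.2]
      linear_combination (-(2 : ℂ) ^ d) * h'
    refine ⟨h1, ?_⟩
    rw [wignerLevelAux_succ, h1, ih.2, genFun_div_recurrence]
    push_cast
    ring

/-- The Taylor coefficient is `(-1)^N exp(-t/2)` times the Laguerre polynomial of degree `N` and
parameter `d - 1` at `t = 4H/ħ`; only the generating function is used below. -/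
theorem wigner_eq_taylorCoeff (hħ : 0 < ħ) (N : ℕ) (x ξ : Conf d) :
    wigner d ħ N x ξ = (((2 * Real.pi * ħ) ^ d : ℝ) : ℂ)⁻¹ *
      (2 ^ d * taylorCoeff N (genFun d (4 * hamiltonian x ξ / ħ))) := by
  rw [wigner_eq_wignerLevel hħ, (wignerLevel_eq_taylorCoeff hħ x ξ N).1]

theorem re_cayley (r : ℂ) :
    ((1 - r) / (1 + r)).re = (1 - ‖r‖ ^ 2) / Complex.normSq (1 + r) := by
  rw [Complex.div_re, ← add_div, Complex.sq_norm, Complex.normSq_apply]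
  congr 1
  simp [Complex.normSq_apply]
  ring

/-- The Cayley transform `(1 - r)/(1 + r)` maps the disc to the right half plane, so the exponential
has modulus at most `1`, uniformly in `t`. -/
theorem norm_genFun_le {t : ℝ} (ht : 0 ≤ t) (d : ℕ) {r : ℂ} (hr : ‖r‖ ≤ 1) :
    ‖genFun d t r‖ ≤ (‖1 + r‖ ^ d)⁻¹ := by
  rw [genFun, norm_mul, norm_inv, norm_pow, Complex.norm_exp]
  refine mul_le_of_le_one_right (by positivity) (Real.exp_le_one_iff.mpr ?_)
  have h : (-(t / 2 : ℂ) * ((1 - r) / (1 + r))).re = -(t / 2) * ((1 - r) / (1 + r)).re := by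
    rw [show (-(t / 2 : ℂ)) = ((-(t / 2) : ℝ) : ℂ) by push_cast; rfl, Complex.re_ofReal_mul]
  rw [h, re_cayley]
  have : 0 ≤ (1 - ‖r‖ ^ 2) / Complex.normSq (1 + r) :=
    div_nonneg (by nlinarith [norm_nonneg r]) (Complex.normSq_nonneg _)
  nlinarith

theorem norm_taylorCoeff_le {f : ℂ → ℂ} {R C : ℝ} (hR : 0 < R)
    (hf : DiffContOnCl ℂ f (Metric.ball 0 R)) (hC : ∀ z ∈ Metric.sphere (0 : ℂ) R, ‖f z‖ ≤ C)
    (N : ℕ) : ‖taylorCoeff N f‖ ≤ C / R ^ N := by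
  rw [taylorCoeff, norm_div, Complex.norm_natCast, div_le_iff₀ (by positivity)]
  refine (Complex.norm_iteratedDeriv_le_of_forall_mem_sphere_norm_le N hR hf hC).trans (le_of_eq ?_)
  ring

theorem norm_taylorCoeff_genFun_le {t : ℝ} (ht : 0 ≤ t) (d N : ℕ) :
    ‖taylorCoeff N (genFun d t)‖ ≤ Real.exp 1 * (N + 2) ^ d := by
  -- With this Cauchy radius, `(1 - ρ)^(-d) = (N + 2)^d` while `ρ^(-N)` stays below `e`. The
  -- polynomial growth is beaten by the decay of `f`.
  set ρ : ℝ := (N + 1) / (N + 2) with hρ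
  have hρ0 : 0 < ρ := by positivity
  have hρ1 : ρ < 1 := by rw [hρ, div_lt_one (by positivity)]; linarith
  have h1 : ‖taylorCoeff N (genFun d t)‖ ≤ (N + 2) ^ d / ρ ^ N := by
    refine norm_taylorCoeff_le hρ0 ?_ (fun z hz => ?_) N
    · refine DifferentiableOn.diffContOnCl ((differentiableOn_genFun d t).mono ?_)
      rw [closure_ball _ hρ0.ne']
      exact Metric.closedBall_subset_ball hρ1
    · have hz' : ‖z‖ = ρ := by simpa using hz
      refine (norm_genFun_le ht d (by rw [hz']; exact hρ1.le)).trans ?_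
      have h2 : 1 - ρ ≤ ‖1 + z‖ := by
        have := norm_sub_norm_le (1 : ℂ) (-z)
        rw [norm_neg, sub_neg_eq_add, norm_one, hz'] at this
        exact this
      have h3 : (N + 2 : ℝ)⁻¹ = 1 - ρ := by
        rw [hρ]
        field_simp
        ring
      rw [← inv_pow]
      gcongr
      rw [inv_le_comm₀ (lt_of_lt_of_le (by linarith) h2) (by positivity), h3]
      exact h2
  refine h1.trans ?_
  rw [div_eq_mul_inv, mul_comm]
  gcongr
  rw [← inv_pow, hρ, inv_div]
  have h4 : ((N + 2 : ℝ) / (N + 1)) ≤ Real.exp (1 / (N + 1)) := by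
    have := Real.add_one_le_exp (1 / (N + 1) : ℝ)
    refine le_trans (le_of_eq ?_) this
    field_simp
    ring
  calc ((N + 2 : ℝ) / (N + 1)) ^ N ≤ (Real.exp (1 / (N + 1))) ^ N := by gcongr
    _ = Real.exp (N / (N + 1)) := by rw [← Real.exp_nat_mul]; congr 1; ring
    _ ≤ Real.exp 1 := by
        gcongr
        rw [div_le_one (by positivity)]
        linarith

theorem hasSum_taylorCoeff_genFun (d : ℕ) (t : ℝ) {r : ℂ} (hr : ‖r‖ < 1) :
    HasSum (fun N => taylorCoeff N (genFun d t) * r ^ N) (genFun d t r) := by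
  have h := Complex.hasSum_taylorSeries_on_ball (differentiableOn_genFun d t)
    (z := r) (by simpa using hr)
  refine Eq.mp (congrArg (fun F : ℕ → ℂ => HasSum F _) (funext fun N => ?_)) h
  simp only [taylorCoeff, sub_zero, smul_eq_mul]
  ring

open Filter Topology

/-! ### Absolute convergence and the integral representation of the localized sum -/

theorem hamiltonian_nonneg (x ξ : Conf d) : 0 ≤ hamiltonian x ξ := by
  unfold hamiltonian
  positivity

theorem summable_schwartz_mul_pow (f : 𝓢(ℝ, ℂ)) (α : ℝ) {β : ℝ} (hβ : 0 < β) (d : ℕ) :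
    Summable fun N : ℕ => ‖f (α - β * N)‖ * (N + 2 : ℝ) ^ d := by
  obtain ⟨C, hC⟩ : ∃ C : ℝ, ∀ x : ℝ, (1 + ‖x‖) ^ (d + 2) * ‖f x‖ ≤ C := by
    have h := fun x : ℝ => SchwartzMap.one_add_le_sup_seminorm_apply (𝕜 := ℝ) (k := d + 2) (n := 0)
      (m := (d + 2, 0)) le_rfl le_rfl f x
    simp only [norm_iteratedFDeriv_zero] at h
    exact ⟨_, h⟩
  -- Chosen so that `N + 2 ≤ K (1 + |α - βN|)`. Decay of `f` of order `d + 2` then leaves the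
  -- summable `(N + 2)^(-2)`.
  set K : ℝ := |α| / β + 2 + 1 / β with hK
  have hle (N : ℕ) : (N + 2 : ℝ) ≤ K * (1 + ‖α - β * N‖) := by
    have h1 : β * N ≤ |α| + |α - β * N| := by
      have := neg_abs_le (α - β * N)
      have := le_abs_self α
      linarith
    have h2 : (N : ℝ) ≤ |α| / β + 1 / β * |α - β * N| := by
      rw [div_mul_eq_mul_div, one_mul, ← add_div, le_div_iff₀ hβ]
      linarith
    have h3 : 0 ≤ |α| / β := by positivity
    have h4 : 0 ≤ 1 / β := by positivity
    rw [Real.norm_eq_abs, hK]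
    nlinarith [abs_nonneg (α - β * N), mul_nonneg h3 (abs_nonneg (α - β * N))]
  have hs : Summable fun N : ℕ => K ^ (d + 2) * C * (1 / ((N + 2 : ℕ) : ℝ) ^ 2) :=
    ((summable_nat_add_iff 2).mpr (Real.summable_one_div_nat_pow.mpr one_lt_two)).mul_left _
  refine hs.of_nonneg_of_le (fun N => by positivity) fun N => ?_
  rw [mul_one_div, le_div_iff₀ (by positivity)]
  push_cast
  have hK0 : 0 ≤ K := by positivity
  calc ‖f (α - β * N)‖ * (N + 2 : ℝ) ^ d * (N + 2 : ℝ) ^ 2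
      = (N + 2 : ℝ) ^ (d + 2) * ‖f (α - β * N)‖ := by rw [pow_add]; ring
    _ ≤ (K * (1 + ‖α - β * N‖)) ^ (d + 2) * ‖f (α - β * N)‖ := by gcongr; exact hle N
    _ = K ^ (d + 2) * ((1 + ‖α - β * N‖) ^ (d + 2) * ‖f (α - β * N)‖) := by
        rw [mul_pow, mul_assoc]
    _ ≤ K ^ (d + 2) * C := by gcongr; exact hC _

theorem summable_schwartz_mul_taylorCoeff (f : 𝓢(ℝ, ℂ)) (α : ℝ) {β : ℝ} (hβ : 0 < β) (d : ℕ)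
    {t : ℝ} (ht : 0 ≤ t) :
    Summable fun N : ℕ => ‖f (α - β * N) * taylorCoeff N (genFun d t)‖ := by
  refine ((summable_schwartz_mul_pow f α hβ d).mul_left (Real.exp 1)).of_nonneg_of_le
    (fun N => norm_nonneg _) fun N => ?_
  rw [norm_mul]
  calc _ ≤ ‖f (α - β * N)‖ * (Real.exp 1 * (N + 2) ^ d) := by
        gcongr
        exact norm_taylorCoeff_genFun_le ht d N
    _ = _ := by ring

theorem energy_argument (hħ : 0 < ħ) (d : ℕ) (E : ℝ) (N : ℕ) :
    ħ ^ (-(2 / 3) : ℝ) * (E - energy d ħ N)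
      = ħ ^ (1 / 3 : ℝ) * (E / ħ - d / 2) - ħ ^ (1 / 3 : ℝ) * N := by
  have h : ħ ^ (1 / 3 : ℝ) = ħ ^ (-(2 / 3) : ℝ) * ħ := by
    rw [← Real.rpow_add_one hħ.ne']
    norm_num
  rw [h, energy]
  field_simp
  ring

theorem weylTerm_eq (hħ : 0 < ħ) (E : ℝ) (f : ℝ → ℂ) (x ξ : Conf d) (N : ℕ) :
    weylTerm d E f ħ x ξ N = (((2 * Real.pi * ħ) ^ d : ℝ) : ℂ)⁻¹ * 2 ^ d *
      (f (ħ ^ (1 / 3 : ℝ) * (E / ħ - d / 2) - ħ ^ (1 / 3 : ℝ) * N) *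
        taylorCoeff N (genFun d (4 * hamiltonian x ξ / ħ))) := by
  rw [weylTerm, energy_argument hħ, wigner_eq_taylorCoeff hħ]
  ring

theorem summable_weylTerm (hħ : 0 < ħ) (E : ℝ) (f : 𝓢(ℝ, ℂ)) (x ξ : Conf d) :
    Summable (weylTerm d E f ħ x ξ) := by
  have hH := hamiltonian_nonneg x ξ
  have h := (summable_schwartz_mul_taylorCoeff f (ħ ^ (1 / 3 : ℝ) * (E / ħ - d / 2))
    (β := ħ ^ (1 / 3 : ℝ)) (by positivity) d (t := 4 * hamiltonian x ξ / ħ) (by positivity)).of_norm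
  exact (h.mul_left ((((2 * Real.pi * ħ) ^ d : ℝ) : ℂ)⁻¹ * 2 ^ d)).congr fun N =>
    (weylTerm_eq hħ E f x ξ N).symm

theorem schwartz_eq_integral_fourier (f : 𝓢(ℝ, ℂ)) (s : ℝ) :
    f s = ∫ τ : ℝ, 𝓕 (f : ℝ → ℂ) τ * Complex.exp (2 * Real.pi * τ * s * Complex.I) := by
  have h : 𝓕⁻ (𝓕 f) = f := FourierTransform.fourierInv_fourier_eq f
  conv_lhs => rw [← h]
  rw [SchwartzMap.fourierInv_coe, Real.fourierInv_eq', SchwartzMap.fourier_coe]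
  congr 1
  ext τ
  simp only [RCLike.inner_apply, conj_trivial, smul_eq_mul]
  rw [mul_comm]
  congr 2
  push_cast
  ring

theorem norm_exp_two_pi (a b : ℝ) : ‖Complex.exp (2 * Real.pi * a * b * Complex.I)‖ = 1 := by
  rw [show (2 * Real.pi * a * b * Complex.I : ℂ) = ((2 * Real.pi * a * b : ℝ) : ℂ) * Complex.I by
    push_cast; ring, Complex.norm_exp_ofReal_mul_I]

theorem one_le_norm_one_add_smul_exp {ρ θ : ℝ} (hρ : 0 ≤ ρ) (hθ : |θ| ≤ 1) :
    1 ≤ ‖1 + ρ * Complex.exp (-(θ * Complex.I))‖ := by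
  refine le_trans ?_ (Complex.re_le_norm _)
  have h : -(θ * Complex.I) = ((-θ : ℝ) : ℂ) * Complex.I := by push_cast; ring
  rw [h, Complex.add_re, Complex.re_ofReal_mul, Complex.exp_ofReal_mul_I_re, Real.cos_neg]
  have := Real.cos_nonneg_of_mem_Icc (x := θ)
    ⟨by linarith [Real.pi_gt_three, (abs_le.mp hθ).1], by linarith [Real.pi_gt_three, (abs_le.mp hθ).2]⟩
  simp only [Complex.one_re, le_add_iff_nonneg_right]
  positivity

/-- The Abel factor `ρ^N` keeps the argument of `genFun` inside the disc, where the power series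
converges absolutely and may be exchanged with the Fourier integral. -/
theorem tsum_geometric_weight (f : 𝓢(ℝ, ℂ)) (α β : ℝ) (d : ℕ) (t : ℝ)
    {ρ : ℝ} (hρ0 : 0 ≤ ρ) (hρ1 : ρ < 1) :
    ∑' N : ℕ, f (α - β * N) * taylorCoeff N (genFun d t) * (ρ : ℂ) ^ N
      = ∫ τ : ℝ, 𝓕 (f : ℝ → ℂ) τ * Complex.exp (2 * Real.pi * τ * α * Complex.I) *
          genFun d t (ρ * Complex.exp (-((2 * Real.pi * τ * β : ℝ) * Complex.I))) := by
  have hint : Integrable (𝓕 (f : ℝ → ℂ)) := (𝓕 f : 𝓢(ℝ, ℂ)).integrable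
  set r : ℝ → ℂ := fun τ => ρ * Complex.exp (-((2 * Real.pi * τ * β : ℝ) * Complex.I)) with hr
  have hrn (τ : ℝ) : ‖r τ‖ = ρ := by
    rw [hr]
    simp only
    rw [show -(((2 * Real.pi * τ * β : ℝ) : ℂ) * Complex.I)
      = ((-(2 * Real.pi * τ * β) : ℝ) : ℂ) * Complex.I by push_cast; ring, norm_mul,
      Complex.norm_exp_ofReal_mul_I, mul_one, Complex.norm_real, Real.norm_of_nonneg hρ0]
  set F : ℕ → ℝ → ℂ := fun N τ => 𝓕 (f : ℝ → ℂ) τ *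
    Complex.exp (2 * Real.pi * τ * α * Complex.I) * (taylorCoeff N (genFun d t) * r τ ^ N) with hF
  have hFn (N : ℕ) (τ : ℝ) :
      ‖F N τ‖ = ‖𝓕 (f : ℝ → ℂ) τ‖ * (‖taylorCoeff N (genFun d t)‖ * ρ ^ N) := by
    simp only [hF, norm_mul, norm_pow, hrn, norm_exp_two_pi, mul_one]
  have hFint (N : ℕ) : Integrable (F N) := by
    refine (hint.mul_const (taylorCoeff N (genFun d t) * ρ ^ N)).mono ?_
      (Eventually.of_forall fun τ => ?_)
    · exact ((hint.1.mul (Continuous.aestronglyMeasurable (by fun_prop))).mul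
        (Continuous.aestronglyMeasurable (by fun_prop)))
    · rw [hFn, norm_mul, norm_mul, norm_pow, Complex.norm_real, Real.norm_of_nonneg hρ0]
  have hsum : Summable fun N => ∫ τ, ‖F N τ‖ := by
    simp only [hFn, integral_mul_const]
    have h := (hasSum_taylorCoeff_genFun d t (r := (ρ : ℂ)) (by
      rwa [Complex.norm_real, Real.norm_of_nonneg hρ0])).summable.norm
    simp only [norm_mul, norm_pow, Complex.norm_real, Real.norm_of_nonneg hρ0] at h
    exact h.mul_left _
  have h1 := (hasSum_integral_of_summable_integral_norm hFint hsum).tsum_eq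
  have h2 (N : ℕ) : ∫ τ, F N τ = f (α - β * N) * taylorCoeff N (genFun d t) * (ρ : ℂ) ^ N := by
    rw [schwartz_eq_integral_fourier f, mul_assoc, ← integral_mul_const]
    congr 1
    ext τ
    simp only [hF, hr, mul_pow, ← Complex.exp_nat_mul]
    have : Complex.exp (2 * Real.pi * τ * (α - β * N : ℝ) * Complex.I)
        = Complex.exp (2 * Real.pi * τ * α * Complex.I) *
          Complex.exp (N * -((2 * Real.pi * τ * β : ℝ) * Complex.I)) := by
      rw [← Complex.exp_add]
      congr 1
      push_cast
      ring
    rw [this]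
    ring
  have h3 (τ : ℝ) : ∑' N, F N τ = 𝓕 (f : ℝ → ℂ) τ *
      Complex.exp (2 * Real.pi * τ * α * Complex.I) * genFun d t (r τ) := by
    simp only [hF]
    rw [tsum_mul_left, (hasSum_taylorCoeff_genFun d t (by rw [hrn]; exact hρ1)).tsum_eq]
  simp only [h2, h3] at h1
  exact h1

/-- Abel limit `ρ → 1`. On the support of the Fourier transform the angle is at most `1`, so `|1 +
r| ≥ 1` along the limit: the singularity `r = -1` is avoided and `genFun` is bounded by `1`. -/
theorem tsum_schwartz_mul_taylorCoeff (f : 𝓢(ℝ, ℂ)) (α : ℝ) {β : ℝ} (hβ : 0 < β) (d : ℕ)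
    {t : ℝ} (ht : 0 ≤ t) (hsupp : ∀ τ, 𝓕 (f : ℝ → ℂ) τ ≠ 0 → |2 * Real.pi * τ * β| ≤ 1) :
    ∑' N : ℕ, f (α - β * N) * taylorCoeff N (genFun d t)
      = ∫ τ : ℝ, 𝓕 (f : ℝ → ℂ) τ * Complex.exp (2 * Real.pi * τ * α * Complex.I) *
          genFun d t (Complex.exp (-((2 * Real.pi * τ * β : ℝ) * Complex.I))) := by
  have hint : Integrable (𝓕 (f : ℝ → ℂ)) := (𝓕 f : 𝓢(ℝ, ℂ)).integrable
  have hev : ∀ᶠ ρ : ℝ in 𝓝[<] 1, 0 ≤ ρ ∧ ρ < 1 := by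
    filter_upwards [Ioo_mem_nhdsLT (zero_lt_one' ℝ)] with ρ hρ
    exact ⟨hρ.1.le, hρ.2⟩
  have h1 : Tendsto (fun ρ : ℝ => ∑' N : ℕ,
      f (α - β * N) * taylorCoeff N (genFun d t) * (ρ : ℂ) ^ N) (𝓝[<] 1)
      (𝓝 (∑' N : ℕ, f (α - β * N) * taylorCoeff N (genFun d t))) := by
    refine tendsto_tsum_of_dominated_convergence
      (summable_schwartz_mul_taylorCoeff f α hβ d ht) (fun N => ?_) ?_
    · have : Tendsto (fun ρ : ℝ => f (α - β * N) * taylorCoeff N (genFun d t) * (ρ : ℂ) ^ N)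
          (𝓝 1) (𝓝 (f (α - β * N) * taylorCoeff N (genFun d t) * ((1 : ℝ) : ℂ) ^ N)) :=
        Continuous.tendsto (by fun_prop) 1
      simpa using this.mono_left nhdsWithin_le_nhds
    · filter_upwards [hev] with ρ hρ N
      rw [norm_mul _ ((ρ : ℂ) ^ N), norm_pow, Complex.norm_real, Real.norm_of_nonneg hρ.1]
      exact mul_le_of_le_one_right (norm_nonneg _) (pow_le_one₀ hρ.1 hρ.2.le)
  have h2 : Tendsto (fun ρ : ℝ => ∫ τ : ℝ, 𝓕 (f : ℝ → ℂ) τ *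
      Complex.exp (2 * Real.pi * τ * α * Complex.I) *
      genFun d t (ρ * Complex.exp (-((2 * Real.pi * τ * β : ℝ) * Complex.I)))) (𝓝[<] 1)
      (𝓝 (∫ τ : ℝ, 𝓕 (f : ℝ → ℂ) τ * Complex.exp (2 * Real.pi * τ * α * Complex.I) *
          genFun d t (Complex.exp (-((2 * Real.pi * τ * β : ℝ) * Complex.I))))) := by
    refine tendsto_integral_filter_of_dominated_convergence (fun τ => ‖𝓕 (f : ℝ → ℂ) τ‖) ?_ ?_
      hint.norm ?_
    · filter_upwards [hev] with ρ hρ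
      have hcont : Continuous fun τ : ℝ => genFun d t
          (ρ * Complex.exp (-((2 * Real.pi * τ * β : ℝ) * Complex.I))) := by
        refine (differentiableOn_genFun d t).continuousOn.comp_continuous (by fun_prop) fun τ => ?_
        rw [show -(((2 * Real.pi * τ * β : ℝ) : ℂ) * Complex.I)
          = ((-(2 * Real.pi * τ * β) : ℝ) : ℂ) * Complex.I by push_cast; ring]
        rw [mem_ball_zero_iff, norm_mul, Complex.norm_exp_ofReal_mul_I, mul_one, Complex.norm_real,
          Real.norm_of_nonneg hρ.1]
        exact hρ.2
      exact (hint.1.mul (Continuous.aestronglyMeasurable (by fun_prop))).mul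
        hcont.aestronglyMeasurable
    · filter_upwards [hev] with ρ hρ
      refine Eventually.of_forall fun τ => ?_
      by_cases hτ : 𝓕 (f : ℝ → ℂ) τ = 0
      · simp [hτ]
      · rw [norm_mul, norm_mul, norm_exp_two_pi, mul_one]
        refine mul_le_of_le_one_right (norm_nonneg _) ?_
        refine (norm_genFun_le ht d ?_).trans ?_
        · rw [show -(((2 * Real.pi * τ * β : ℝ) : ℂ) * Complex.I)
            = ((-(2 * Real.pi * τ * β) : ℝ) : ℂ) * Complex.I by push_cast; ring, norm_mul,
            Complex.norm_exp_ofReal_mul_I, mul_one, Complex.norm_real, Real.norm_of_nonneg hρ.1]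
          exact hρ.2.le
        · exact inv_le_one_of_one_le₀
            (one_le_pow₀ (one_le_norm_one_add_smul_exp hρ.1 (hsupp τ hτ)))
    · refine Eventually.of_forall fun τ => ?_
      by_cases hτ : 𝓕 (f : ℝ → ℂ) τ = 0
      · simp [hτ]
      · refine Tendsto.const_mul _ ?_
        have h3 := one_le_norm_one_add_smul_exp (ρ := 1) zero_le_one (hsupp τ hτ)
        rw [Complex.ofReal_one, one_mul] at h3
        have h4 := (hasDerivAt_genFun d t (norm_pos_iff.mp (zero_lt_one.trans_le h3))).continuousAt
        refine h4.tendsto.comp (Tendsto.mono_left ?_ nhdsWithin_le_nhds)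
        have : Continuous fun ρ : ℝ =>
          (ρ : ℂ) * Complex.exp (-((2 * Real.pi * τ * β : ℝ) * Complex.I)) := by fun_prop
        simpa using this.tendsto 1
  refine tendsto_nhds_unique h1 (h2.congr' ?_)
  filter_upwards [hev] with ρ hρ
  exact (tsum_geometric_weight f α β d t hρ.1 hρ.2).symm

/-- From `1 + exp(-iθ) = 2 cos(θ/2) exp(-iθ/2)`. The half-angle factors cancel against
`exp(-iθd/2)`, which in the application is the contribution of the zero-point energy. -/
theorem genFun_exp (d : ℕ) (t θ : ℝ) (hθ : Real.cos (θ / 2) ≠ 0) :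
    2 ^ d * Complex.exp (-(θ * d / 2 * Complex.I)) * genFun d t (Complex.exp (-(θ * Complex.I)))
      = ((Real.cos (θ / 2) : ℂ) ^ d)⁻¹ *
        Complex.exp (-(t / 2 * Real.tan (θ / 2) * Complex.I)) := by
  set c : ℂ := ((Real.cos (θ / 2) : ℝ) : ℂ) with hc
  set s : ℂ := ((Real.sin (θ / 2) : ℝ) : ℂ) with hs
  have hc0 : c ≠ 0 := by rw [hc]; exact_mod_cast hθ
  set e : ℂ := Complex.exp (-(θ / 2 * Complex.I)) with he
  have hee : e = c - s * Complex.I := by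
    rw [he, show -(θ / 2 * Complex.I) = (-(θ / 2 : ℂ)) * Complex.I by ring, Complex.exp_mul_I,
      Complex.cos_neg, Complex.sin_neg, hc, hs]
    push_cast
    ring
  have he0 : e ≠ 0 := Complex.exp_ne_zero _
  have hsq : Complex.exp (-(θ * Complex.I)) = e * e := by
    rw [he, ← Complex.exp_add]
    congr 1
    ring
  have hcs : s ^ 2 + c ^ 2 = 1 := by
    rw [hc, hs]
    exact_mod_cast Real.sin_sq_add_cos_sq (θ / 2)
  have hinv : (c + s * Complex.I) * e = 1 := by
    rw [hee]
    linear_combination hcs - s ^ 2 * Complex.I_sq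
  have h1 : 1 + Complex.exp (-(θ * Complex.I)) = 2 * c * e := by
    rw [hsq]
    linear_combination -hinv + e * hee
  have h2 : 1 - Complex.exp (-(θ * Complex.I)) = 2 * (s * Complex.I) * e := by
    rw [hsq]
    linear_combination -hinv - e * hee
  have h3 : Complex.exp (-(θ * d / 2 * Complex.I)) = e ^ d := by
    rw [he, ← Complex.exp_nat_mul]
    congr 1
    ring
  have h4 : (Real.tan (θ / 2) : ℂ) = s / c := by
    rw [Real.tan_eq_sin_div_cos, hs, hc]
    push_cast
    rfl
  rw [genFun, h1, h2, h3, h4, mul_pow, mul_pow]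
  have h5 : -(t / 2 : ℂ) * (2 * (s * Complex.I) * e / (2 * c * e))
      = -(t / 2 * (s / c) * Complex.I) := by
    field_simp
  rw [h5]
  field_simp

/-- The oscillatory integral representing the localized Wigner distribution. -/
theorem weylSum_eq_integral (hħ : 0 < ħ) (E : ℝ) (f : 𝓢(ℝ, ℂ)) (x ξ : Conf d)
    (hsupp : ∀ τ, 𝓕 (f : ℝ → ℂ) τ ≠ 0 → |2 * Real.pi * τ * ħ ^ (1 / 3 : ℝ)| ≤ 1) :
    weylSum d E f ħ x ξ = (((2 * Real.pi * ħ) ^ d : ℝ) : ℂ)⁻¹ *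
      ∫ τ : ℝ, 𝓕 (f : ℝ → ℂ) τ *
        (((Real.cos (2 * Real.pi * τ * ħ ^ (1 / 3 : ℝ) / 2) : ℂ) ^ d)⁻¹ *
        Complex.exp (((2 * Real.pi * τ * ħ ^ (1 / 3 : ℝ) * E
          - 2 * hamiltonian x ξ * Real.tan (2 * Real.pi * τ * ħ ^ (1 / 3 : ℝ) / 2)) / ħ : ℝ)
            * Complex.I)) := by
  have hH := hamiltonian_nonneg x ξ
  rw [weylSum]
  simp only [weylTerm_eq hħ]
  rw [tsum_mul_left, tsum_schwartz_mul_taylorCoeff f _ (by positivity) d (by positivity) hsupp,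
    mul_assoc, ← integral_const_mul]
  congr 2
  ext τ
  by_cases hτ : 𝓕 (f : ℝ → ℂ) τ = 0
  · simp [hτ]
  set θ : ℝ := 2 * Real.pi * τ * ħ ^ (1 / 3 : ℝ) with hθ
  have hθ1 := abs_le.mp (hsupp τ hτ)
  have hcos : Real.cos (θ / 2) ≠ 0 := (Real.cos_pos_of_mem_Ioo
    ⟨by linarith [Real.pi_gt_three], by linarith [Real.pi_gt_three]⟩).ne'
  have h1 := genFun_exp d (4 * hamiltonian x ξ / ħ) θ hcos
  have h2 : Complex.exp (2 * Real.pi * τ * (ħ ^ (1 / 3 : ℝ) * (E / ħ - d / 2) : ℝ) * Complex.I)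
      = Complex.exp ((θ * E / ħ : ℝ) * Complex.I) * Complex.exp (-(θ * d / 2 * Complex.I)) := by
    rw [← Complex.exp_add, hθ]
    congr 1
    push_cast
    ring
  have h3 : Complex.exp (((θ * E - 2 * hamiltonian x ξ * Real.tan (θ / 2)) / ħ : ℝ) * Complex.I)
      = Complex.exp ((θ * E / ħ : ℝ) * Complex.I) *
        Complex.exp (-((4 * hamiltonian x ξ / ħ : ℝ) / 2 * Real.tan (θ / 2) * Complex.I)) := by
    rw [← Complex.exp_add]
    congr 1
    push_cast
    ring
  rw [h2, h3]
  linear_combination (𝓕 (f : ℝ → ℂ) τ * Complex.exp ((θ * E / ħ : ℝ) * Complex.I)) * h1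

open Metric

/-! ### Taylor expansion of bounded holomorphic functions -/

/-- The point `ε` may lie outside the disc, where only the bound at `ε` itself is available. This is
what makes the expansion uniform when `u` is so large that the disc of holomorphic control is
smaller than `ε`. -/
theorem norm_sub_sum_taylorCoeff_le {Γ : ℂ → ℂ} {r C : ℝ} (hr : 0 < r)
    (hΓ : DiffContOnCl ℂ Γ (ball 0 r)) (hC : ∀ z ∈ closedBall (0 : ℂ) r, ‖Γ z‖ ≤ C)
    {ε : ℝ} (hε : 0 ≤ ε) (hεC : ‖Γ ε‖ ≤ C) (K : ℕ) :
    ‖Γ ε - ∑ m ∈ Finset.range K, taylorCoeff m Γ * (ε : ℂ) ^ m‖ ≤ C * (K + 2) * (2 * ε / r) ^ K := by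
  have hC0 : 0 ≤ C := (norm_nonneg _).trans hεC
  have hcoef (m : ℕ) : ‖taylorCoeff m Γ * (ε : ℂ) ^ m‖ ≤ C * (ε / r) ^ m := by
    rw [norm_mul, norm_pow, Complex.norm_real, Real.norm_of_nonneg hε, div_pow, ← mul_div_assoc,
      ← div_mul_eq_mul_div]
    gcongr
    exact norm_taylorCoeff_le hr hΓ (fun z hz => hC z (sphere_subset_closedBall hz)) m
  rcases le_or_gt (2 * ε) r with h | h
  · have hx : ε / r ≤ 1 / 2 := by rw [div_le_iff₀ hr]; linarith
    have hx0 : 0 ≤ ε / r := by positivity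
    have hs := Complex.hasSum_taylorSeries_on_ball hΓ.differentiableOn
      (z := (ε : ℂ)) (by
        rw [mem_ball_zero_iff, Complex.norm_real, Real.norm_of_nonneg hε]; linarith)
    have hs' : HasSum (fun m => taylorCoeff m Γ * (ε : ℂ) ^ m) (Γ ε) := by
      refine Eq.mp (congrArg (fun F : ℕ → ℂ => HasSum F _) (funext fun m => ?_)) hs
      simp only [taylorCoeff, sub_zero, smul_eq_mul]
      ring
    have htail := (hasSum_nat_add_iff' K).mpr hs'
    have hgeo : HasSum (fun m : ℕ => C * (ε / r) ^ K * (ε / r) ^ m)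
        (C * (ε / r) ^ K * (1 - ε / r)⁻¹) :=
      (hasSum_geometric_of_lt_one hx0 (by linarith)).mul_left _
    have h1 := htail.norm_le_of_bounded hgeo fun m => by
      refine (hcoef (m + K)).trans (le_of_eq ?_)
      rw [pow_add]
      ring
    refine h1.trans ?_
    have h2 : (1 - ε / r)⁻¹ ≤ 2 := by
      rw [inv_le_comm₀ (by linarith) two_pos]
      linarith
    have h3 : (ε / r) ^ K ≤ (2 * ε / r) ^ K :=
      pow_le_pow_left₀ hx0 (div_le_div_of_nonneg_right (by linarith) hr.le) K
    have h4 : (1 - ε / r)⁻¹ ≤ K + 2 := by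
      linarith [(Nat.cast_nonneg K : (0 : ℝ) ≤ K)]
    refine (mul_le_mul (mul_le_mul_of_nonneg_left h3 hC0) h4
      (inv_nonneg.mpr (by linarith)) (by positivity)).trans (le_of_eq ?_)
    ring
  -- Here the claimed error is already at least of size `C`, so the function and the `K` Taylor
  -- terms are estimated separately.
  · have hx : 1 ≤ 2 * ε / r := by rw [one_le_div hr]; exact h.le
    have h1 : ‖∑ m ∈ Finset.range K, taylorCoeff m Γ * (ε : ℂ) ^ m‖
        ≤ ∑ m ∈ Finset.range K, C * (2 * ε / r) ^ K := by
      refine (norm_sum_le _ _).trans (Finset.sum_le_sum fun m hm => (hcoef m).trans ?_)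
      have h2 : (2 * ε / r) ^ m ≤ (2 * ε / r) ^ K :=
        pow_le_pow_right₀ hx (Finset.mem_range.mp hm).le
      refine mul_le_mul_of_nonneg_left (le_trans ?_ h2) hC0
      gcongr
      linarith
    rw [Finset.sum_const, Finset.card_range, nsmul_eq_mul] at h1
    have h3 : C ≤ C * (2 * ε / r) ^ K := le_mul_of_one_le_right hC0 (one_le_pow₀ hx)
    calc _ ≤ ‖Γ ε‖ + ‖∑ m ∈ Finset.range K, taylorCoeff m Γ * (ε : ℂ) ^ m‖ := norm_sub_le _ _
      _ ≤ C * (2 * ε / r) ^ K + K * (C * (2 * ε / r) ^ K) := by linarith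
      _ ≤ _ := by nlinarith

theorem taylorCoeff_odd_of_even {Γ : ℂ → ℂ} (h : ∀ z, Γ (-z) = Γ z) (m : ℕ) :
    taylorCoeff (2 * m + 1) Γ = 0 := by
  have h1 := iteratedDeriv_comp_neg (2 * m + 1) Γ 0
  rw [funext h, neg_zero, pow_succ, pow_mul] at h1
  have h2 : iteratedDeriv (2 * m + 1) Γ 0 = 0 := by
    simp only [even_two, Even.neg_pow, one_pow, one_mul, neg_smul, one_smul] at h1
    exact self_eq_neg.mp h1
  rw [taylorCoeff, h2, zero_div]

theorem sum_taylorCoeff_even {Γ : ℂ → ℂ} (h : ∀ z, Γ (-z) = Γ z) (ε : ℂ) (M : ℕ) :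
    ∑ m ∈ Finset.range (2 * M), taylorCoeff m Γ * ε ^ m
      = ∑ m ∈ Finset.range M, taylorCoeff (2 * m) Γ * ε ^ (2 * m) := by
  induction M with
  | zero => simp
  | succ M ih =>
    rw [mul_add, mul_one, Finset.sum_range_succ, Finset.sum_range_succ, ih, Finset.sum_range_succ,
      taylorCoeff_odd_of_even h]
    ring

/-! ### Holomorphic oscillatory integrals -/

/-- Holomorphy of an integral over a compact set depending holomorphically on a parameter. -/
theorem differentiableOn_setIntegral {K : Set ℝ} (hK : IsCompact K) {U : Set ℂ} (hU : IsOpen U)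
    {F F' : ℂ → ℝ → ℂ} (hF : ∀ z ∈ U, ContinuousOn (F z) K)
    (hF' : ContinuousOn (Function.uncurry F') (U ×ˢ K))
    (hd : ∀ τ ∈ K, ∀ z ∈ U, HasDerivAt (F · τ) (F' z τ) z) :
    DifferentiableOn ℂ (fun z => ∫ τ in K, F z τ) U := by
  intro z hz
  obtain ⟨r, hr, hball⟩ := nhds_basis_closedBall.mem_iff.mp (hU.mem_nhds hz)
  obtain ⟨C, hC⟩ := ((isCompact_closedBall z r).prod hK).exists_bound_of_continuousOn
    (hF'.mono (Set.prod_mono hball le_rfl))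
  have hslice : ContinuousOn (F' z) K :=
    hF'.comp (f := fun τ => (z, τ)) (by fun_prop) fun τ hτ => ⟨hz, hτ⟩
  refine ((hasDerivAt_integral_of_dominated_loc_of_deriv_le (μ := volume.restrict K)
    (F := F) (F' := F') (bound := fun _ => C) (closedBall_mem_nhds z hr) ?_ ?_ ?_ ?_ ?_ ?_).2).differentiableAt.differentiableWithinAt
  · filter_upwards [hU.mem_nhds hz] with w hw
    exact (hF w hw).aestronglyMeasurable hK.measurableSet
  · exact (hF z hz).integrableOn_compact hK
  · exact hslice.aestronglyMeasurable hK.measurableSet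
  · filter_upwards [ae_restrict_mem hK.measurableSet] with τ hτ w hw
    exact hC (w, τ) ⟨hw, hτ⟩
  · exact integrableOn_const hK.measure_ne_top
  · filter_upwards [ae_restrict_mem hK.measurableSet] with τ hτ w hw
    exact hd τ hτ w (hball hw)

/-- The integrand of `oscIntegral`. -/
def oscIntegrand (g : ℝ → ℂ) (A B C : ℂ → ℂ) (u : ℝ) (ε : ℂ) (τ : ℝ) : ℂ :=
  g τ * (A (ε * (2 * Real.pi * τ : ℝ)) *
    Complex.exp (((2 * Real.pi * τ) ^ 3 : ℝ) * B (ε * (2 * Real.pi * τ : ℝ))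
      + (2 * Real.pi * τ * u : ℝ) * C (ε * (2 * Real.pi * τ : ℝ))))

/-- The oscillatory integral `∫ g(τ) A(εs) exp(s³ B(εs) + s u C(εs)) dτ` with `s = 2πτ`. -/
def oscIntegral (g : ℝ → ℂ) (A B C : ℂ → ℂ) (u : ℝ) (ε : ℂ) : ℂ :=
  ∫ τ : ℝ, oscIntegrand g A B C u ε τ

theorem oscIntegral_neg {g : ℝ → ℂ} {A B C : ℂ → ℂ} (hA : ∀ z, A (-z) = A z)
    (hB : ∀ z, B (-z) = B z) (hC : ∀ z, C (-z) = C z) (u : ℝ) (ε : ℂ) :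
    oscIntegral g A B C u (-ε) = oscIntegral g A B C u ε := by
  simp only [oscIntegral, oscIntegrand, neg_mul, hA, hB, hC]

theorem differentiableOn_oscIntegral {g : ℝ → ℂ} (hg : Continuous g) {T : ℝ} (hT : 0 < T)
    (hgT : ∀ τ, g τ ≠ 0 → |τ| ≤ T) {A B C : ℂ → ℂ} (hA : DifferentiableOn ℂ A (ball 0 2))
    (hB : DifferentiableOn ℂ B (ball 0 2)) (hC : DifferentiableOn ℂ C (ball 0 2)) (u : ℝ) :
    DifferentiableOn ℂ (oscIntegral g A B C u) (ball 0 (2 / (2 * Real.pi * T))) := by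
  have hmem {ε : ℂ} {τ : ℝ} (hε : ε ∈ ball (0 : ℂ) (2 / (2 * Real.pi * T)))
      (hτ : τ ∈ Set.Icc (-T) T) : ε * (2 * Real.pi * τ : ℝ) ∈ ball (0 : ℂ) 2 := by
    rw [mem_ball_zero_iff] at hε ⊢
    rw [lt_div_iff₀ (by positivity)] at hε
    rw [norm_mul, Complex.norm_real, Real.norm_eq_abs, abs_mul, abs_of_pos (by positivity)]
    refine lt_of_le_of_lt ?_ hε
    gcongr
    exact abs_le.mpr hτ
  have heq : oscIntegral g A B C u
      = fun ε => ∫ τ in Set.Icc (-T) T, oscIntegrand g A B C u ε τ := by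
    ext ε
    rw [oscIntegral, setIntegral_eq_integral_of_forall_compl_eq_zero]
    intro τ hτ
    have : g τ = 0 := by
      by_contra h
      exact hτ (abs_le.mp (hgT τ h))
    simp [oscIntegrand, this]
  have hcomp {G : ℂ → ℂ} (hG : ContinuousOn G (ball 0 2)) :
      ContinuousOn (fun p : ℂ × ℝ => G (p.1 * (2 * Real.pi * p.2 : ℝ)))
        (ball (0 : ℂ) (2 / (2 * Real.pi * T)) ×ˢ Set.Icc (-T) T) :=
    hG.comp (by fun_prop) fun p hp => hmem hp.1 hp.2
  have hcompT {G : ℂ → ℂ} (hG : ContinuousOn G (ball 0 2)) {ε : ℂ}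
      (hε : ε ∈ ball (0 : ℂ) (2 / (2 * Real.pi * T))) :
      ContinuousOn (fun τ : ℝ => G (ε * (2 * Real.pi * τ : ℝ))) (Set.Icc (-T) T) :=
    hG.comp (by fun_prop) fun τ hτ => hmem hε hτ
  have hA' := (hA.deriv isOpen_ball).continuousOn
  have hB' := (hB.deriv isOpen_ball).continuousOn
  have hC' := (hC.deriv isOpen_ball).continuousOn
  rw [heq]
  refine differentiableOn_setIntegral isCompact_Icc isOpen_ball
    (F' := fun ε τ => g τ * ((deriv A (ε * (2 * Real.pi * τ : ℝ)) * (2 * Real.pi * τ : ℝ)) *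
      Complex.exp (((2 * Real.pi * τ) ^ 3 : ℝ) * B (ε * (2 * Real.pi * τ : ℝ))
        + (2 * Real.pi * τ * u : ℝ) * C (ε * (2 * Real.pi * τ : ℝ)))
      + A (ε * (2 * Real.pi * τ : ℝ)) *
      (Complex.exp (((2 * Real.pi * τ) ^ 3 : ℝ) * B (ε * (2 * Real.pi * τ : ℝ))
        + (2 * Real.pi * τ * u : ℝ) * C (ε * (2 * Real.pi * τ : ℝ))) *
      (((2 * Real.pi * τ) ^ 3 : ℝ) * (deriv B (ε * (2 * Real.pi * τ : ℝ)) * (2 * Real.pi * τ : ℝ))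
        + (2 * Real.pi * τ * u : ℝ) *
          (deriv C (ε * (2 * Real.pi * τ : ℝ)) * (2 * Real.pi * τ : ℝ))))))
    (fun ε hε => ?_) ?_ fun τ hτ ε hε => ?_
  · have h1 := hcompT hA.continuousOn hε
    have h2 := hcompT hB.continuousOn hε
    have h3 := hcompT hC.continuousOn hε
    have hs {h : ℝ → ℝ} (hh : Continuous h) :
        ContinuousOn (fun τ => ((h τ : ℝ) : ℂ)) (Set.Icc (-T) T) :=
      (Complex.continuous_ofReal.comp hh).continuousOn
    exact hg.continuousOn.mul (h1.mul ((((hs (by fun_prop)).mul h2).add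
      ((hs (by fun_prop)).mul h3)).cexp))
  · have h1 := hcomp hA.continuousOn
    have h2 := hcomp hB.continuousOn
    have h3 := hcomp hC.continuousOn
    have h1' := hcomp hA'
    have h2' := hcomp hB'
    have h3' := hcomp hC'
    have hs {h : ℝ → ℝ} (hh : Continuous h) : ContinuousOn (fun p : ℂ × ℝ => ((h p.2 : ℝ) : ℂ))
        (ball (0 : ℂ) (2 / (2 * Real.pi * T)) ×ˢ Set.Icc (-T) T) :=
      (Complex.continuous_ofReal.comp (hh.comp continuous_snd)).continuousOn
    have he := (((hs (h := fun τ => (2 * Real.pi * τ) ^ 3) (by fun_prop)).mul h2).add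
      ((hs (h := fun τ => 2 * Real.pi * τ * u) (by fun_prop)).mul h3)).cexp
    have hs1 := hs (h := fun τ => 2 * Real.pi * τ) (by fun_prop)
    exact (hg.comp continuous_snd).continuousOn.mul (((h1'.mul hs1).mul he).add
      (h1.mul (he.mul (((hs (h := fun τ => (2 * Real.pi * τ) ^ 3) (by fun_prop)).mul
        (h2'.mul hs1)).add ((hs (h := fun τ => 2 * Real.pi * τ * u) (by fun_prop)).mul
          (h3'.mul hs1))))))
  · have hz := hmem hε hτ
    have hin : HasDerivAt (fun ε : ℂ => ε * (2 * Real.pi * τ : ℝ)) ((2 * Real.pi * τ : ℝ) : ℂ) ε := by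
      simpa using (hasDerivAt_id ε).mul_const ((2 * Real.pi * τ : ℝ) : ℂ)
    have hd {G : ℂ → ℂ} (hG : DifferentiableOn ℂ G (ball 0 2)) :
        HasDerivAt (fun ε : ℂ => G (ε * (2 * Real.pi * τ : ℝ)))
          (deriv G (ε * (2 * Real.pi * τ : ℝ)) * (2 * Real.pi * τ : ℝ)) ε :=
      ((hG.differentiableAt (isOpen_ball.mem_nhds hz)).hasDerivAt).comp ε hin
    exact ((hd hA).mul ((((hd hB).const_mul _).add ((hd hC).const_mul _)).cexp)).const_mul (g τ)

/-- Only the real part of the exponent matters. That of `C` is of second order, so the term `s u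
C(εs)` grows at most like `|u| |ε|²`, which the condition on `ε` controls uniformly in `u`. -/
theorem norm_oscIntegral_le {g : ℝ → ℂ} (hg : Integrable g) {T : ℝ} (hT : 0 < T)
    (hgT : ∀ τ, g τ ≠ 0 → |τ| ≤ T) {A B C : ℂ → ℂ} {D b c : ℝ}
    (hA : ∀ z, ‖z‖ ≤ 1 → ‖A z‖ ≤ D) (hB : ∀ z, ‖z‖ ≤ 1 → |(B z).re| ≤ b)
    (hC : ∀ z, ‖z‖ ≤ 1 → |(C z).re| ≤ c * ‖z‖ ^ 2) (u : ℝ) {ε : ℂ}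
    (hε : ‖ε‖ ^ 2 * (1 + |u|) * (2 * Real.pi * T) ^ 2 ≤ 1) :
    ‖oscIntegral g A B C u ε‖
      ≤ (∫ τ, ‖g τ‖) * (D * Real.exp ((2 * Real.pi * T) ^ 3 * b + 2 * Real.pi * T * c)) := by
  set S : ℝ := 2 * Real.pi * T with hS
  have hS0 : 0 < S := by positivity
  have hc0 : 0 ≤ c := by
    have := (abs_nonneg _).trans (hC 1 (by simp))
    simpa using this
  have hb0 : 0 ≤ b := (abs_nonneg _).trans (hB 0 (by simp))
  have hD0 : 0 ≤ D := (norm_nonneg _).trans (hA 0 (by simp))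
  rw [oscIntegral, ← integral_mul_const]
  refine norm_integral_le_of_norm_le (hg.norm.mul_const _) (Eventually.of_forall fun τ => ?_)
  by_cases hτ : g τ = 0
  · simp [oscIntegrand, hτ]
  have hs : |2 * Real.pi * τ| ≤ S := by
    rw [abs_mul, abs_of_pos (by positivity), hS]
    gcongr
    exact hgT τ hτ
  set s : ℝ := 2 * Real.pi * τ with hs'
  have hz2 : ‖ε * (s : ℂ)‖ ^ 2 ≤ ‖ε‖ ^ 2 * S ^ 2 := by
    rw [norm_mul, mul_pow, Complex.norm_real, Real.norm_eq_abs]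
    gcongr
  have hu : ‖ε‖ ^ 2 * S ^ 2 * |u| ≤ 1 := by
    nlinarith [mul_nonneg (sq_nonneg ‖ε‖) (sq_nonneg S)]
  have hz : ‖ε * (s : ℂ)‖ ≤ 1 := by
    have : ‖ε‖ ^ 2 * S ^ 2 ≤ 1 := by
      nlinarith [mul_nonneg (mul_nonneg (sq_nonneg ‖ε‖) (sq_nonneg S)) (abs_nonneg u)]
    exact (sq_le_one_iff₀ (norm_nonneg _)).mp (hz2.trans this)
  rw [oscIntegrand, norm_mul, norm_mul, Complex.norm_exp]
  refine mul_le_mul_of_nonneg_left (mul_le_mul (hA _ hz) ?_ (Real.exp_pos _).le hD0)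
    (norm_nonneg _)
  rw [Complex.add_re, Complex.re_ofReal_mul, Complex.re_ofReal_mul]
  refine Real.exp_le_exp.mpr (add_le_add ((le_abs_self _).trans ?_) ((le_abs_self _).trans ?_))
  · rw [abs_mul, abs_pow]
    exact mul_le_mul (pow_le_pow_left₀ (abs_nonneg _) hs 3) (hB _ hz) (abs_nonneg _)
      (by positivity)
  · rw [abs_mul, abs_mul]
    calc |s| * |u| * |(C (ε * s)).re| ≤ S * |u| * (c * (‖ε‖ ^ 2 * S ^ 2)) :=
          mul_le_mul (mul_le_mul_of_nonneg_right hs (abs_nonneg _))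
            ((hC _ hz).trans (mul_le_mul_of_nonneg_left hz2 hc0)) (abs_nonneg _) (by positivity)
      _ = S * c * (‖ε‖ ^ 2 * S ^ 2 * |u|) := by ring
      _ ≤ S * c * 1 := mul_le_mul_of_nonneg_left hu (by positivity)
      _ = S * c := mul_one _

/-! ### The phase function `2 tan (z / 2)` -/

theorem cos_half_ne_zero {z : ℂ} (hz : ‖z‖ < 2) : Complex.cos (z / 2) ≠ 0 := by
  rw [Ne, Complex.cos_eq_zero_iff]
  rintro ⟨k, hk⟩
  have h1 : ‖z / 2‖ < 1 := by
    rw [norm_div, Complex.norm_ofNat]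
    linarith
  have h2 : ‖((2 * k + 1) * Real.pi / 2 : ℂ)‖ = |((2 * k + 1 : ℤ) : ℝ)| * (Real.pi / 2) := by
    rw [← abs_of_pos (show 0 < Real.pi / 2 by positivity), ← abs_mul, ← Real.norm_eq_abs,
      ← Complex.norm_real]
    congr 1
    push_cast
    ring
  have h3 : (1 : ℝ) ≤ |((2 * k + 1 : ℤ) : ℝ)| := by
    rw [← Int.cast_abs]
    exact_mod_cast Int.one_le_abs (by omega)
  rw [hk, h2] at h1
  nlinarith [Real.pi_gt_three]

/-- The function `2 tan (z / 2)`. -/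
def tanHalf (z : ℂ) : ℂ := 2 * Complex.tan (z / 2)

/-- The function `2 tan (z / 2) / z`. -/
def tanQuot : ℂ → ℂ := dslope tanHalf 0

/-- The function `(2 tan (z / 2) - z) / z ^ 3`. -/
def tanRem : ℂ → ℂ := dslope (dslope tanQuot 0) 0

theorem hasDerivAt_tanHalf {z : ℂ} (hz : ‖z‖ < 2) :
    HasDerivAt tanHalf (1 + tanHalf z ^ 2 / 4) z := by
  have hc := cos_half_ne_zero hz
  have h1 : HasDerivAt (fun w : ℂ => w / 2) (1 / 2) z := (hasDerivAt_id z).div_const 2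
  have h2 := ((Complex.hasDerivAt_tan hc).comp z h1).const_mul 2
  refine h2.congr_deriv ?_
  rw [tanHalf, Complex.tan_eq_sin_div_cos]
  field_simp
  linear_combination 4 * (-Complex.sin_sq_add_cos_sq (z / 2))

theorem ball_mem_nhds_zero : ball (0 : ℂ) 2 ∈ 𝓝 0 := ball_mem_nhds 0 two_pos

theorem differentiableOn_tanHalf : DifferentiableOn ℂ tanHalf (ball 0 2) := fun _ hz =>
  (hasDerivAt_tanHalf (mem_ball_zero_iff.mp hz)).differentiableAt.differentiableWithinAt

theorem differentiableOn_tanQuot : DifferentiableOn ℂ tanQuot (ball 0 2) :=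
  (Complex.differentiableOn_dslope ball_mem_nhds_zero).mpr differentiableOn_tanHalf

theorem differentiableOn_tanRem : DifferentiableOn ℂ tanRem (ball 0 2) :=
  (Complex.differentiableOn_dslope ball_mem_nhds_zero).mpr
    ((Complex.differentiableOn_dslope ball_mem_nhds_zero).mpr differentiableOn_tanQuot)

theorem differentiableOn_inv_cos_half_pow (d : ℕ) :
    DifferentiableOn ℂ (fun z => (Complex.cos (z / 2) ^ d)⁻¹) (ball 0 2) := by
  refine DifferentiableOn.inv (by fun_prop) fun z hz => pow_ne_zero _ ?_
  exact cos_half_ne_zero (mem_ball_zero_iff.mp hz)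

theorem tanHalf_zero : tanHalf 0 = 0 := by simp [tanHalf]

theorem tanHalf_eq_mul_tanQuot (z : ℂ) : tanHalf z = z * tanQuot z := by
  have h := sub_smul_dslope tanHalf 0 z
  rw [sub_zero, tanHalf_zero, sub_zero, smul_eq_mul] at h
  exact h.symm

theorem tanQuot_zero : tanQuot 0 = 1 := by
  rw [tanQuot, dslope_same, (hasDerivAt_tanHalf (by simp)).deriv, tanHalf_zero]
  simp

theorem tanHalf_neg (z : ℂ) : tanHalf (-z) = -tanHalf z := by
  simp [tanHalf, neg_div]

theorem tanQuot_neg (z : ℂ) : tanQuot (-z) = tanQuot z := by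
  rcases eq_or_ne z 0 with rfl | hz
  · rw [neg_zero]
  · have h := tanHalf_neg z
    rw [tanHalf_eq_mul_tanQuot, tanHalf_eq_mul_tanQuot z] at h
    exact mul_left_cancel₀ hz (by linear_combination -h)

theorem deriv_tanQuot_zero : deriv tanQuot 0 = 0 := by
  have h := deriv_comp_neg tanQuot 0
  rw [funext tanQuot_neg, neg_zero] at h
  exact self_eq_neg.mp h

/-- Evenness makes the first-order coefficient vanish, so two divided differences remove exactly
`z²`. -/
theorem tanQuot_eq (z : ℂ) : tanQuot z = 1 + z ^ 2 * tanRem z := by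
  have h1 := sub_smul_dslope tanQuot 0 z
  have h2 := sub_smul_dslope (dslope tanQuot 0) 0 z
  rw [dslope_same, deriv_tanQuot_zero] at h2
  rw [tanQuot_zero] at h1
  simp only [sub_zero, smul_eq_mul] at h1 h2
  rw [tanRem]
  linear_combination -h1 - z * h2

theorem tanRem_neg (z : ℂ) : tanRem (-z) = tanRem z := by
  rcases eq_or_ne z 0 with rfl | hz
  · rw [neg_zero]
  · have h := tanQuot_neg z
    rw [tanQuot_eq, tanQuot_eq z] at h
    exact mul_left_cancel₀ (pow_ne_zero 2 hz) (by linear_combination h)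

/-- Writing `T = 2 tan(z/2) = z + z³R` and `T = zQ`, the equation `T' = 1 + T²/4` becomes `3R + zR'
= Q²/4` off the origin; continuity extends it to `z = 0`, where `Q = 1`. -/
theorem tanRem_zero : tanRem 0 = 1 / 12 := by
  have hcq := differentiableOn_tanQuot.continuousOn.continuousAt ball_mem_nhds_zero
  have hcr := differentiableOn_tanRem.continuousOn.continuousAt ball_mem_nhds_zero
  have hcd := (differentiableOn_tanRem.deriv isOpen_ball).continuousOn.continuousAt
    ball_mem_nhds_zero
  have h1 : ContinuousAt (fun z => 3 * tanRem z + z * deriv tanRem z) 0 := by fun_prop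
  have h2 : ContinuousAt (fun z => tanQuot z ^ 2 / 4) 0 := by fun_prop
  have h3 : (fun z => 3 * tanRem z + z * deriv tanRem z) =ᶠ[𝓝[≠] 0]
      fun z => tanQuot z ^ 2 / 4 := by
    filter_upwards [self_mem_nhdsWithin, mem_nhdsWithin_of_mem_nhds ball_mem_nhds_zero]
      with z hz hz2
    have hd := (differentiableOn_tanRem.differentiableAt (isOpen_ball.mem_nhds hz2)).hasDerivAt
    have hT : HasDerivAt tanHalf _ z :=
      (((hasDerivAt_id z).add ((hasDerivAt_pow 3 z).mul hd)).congr_of_eventuallyEq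
        (Eventually.of_forall fun w => by
          simp only [Pi.add_apply, Pi.mul_apply, id]
          rw [tanHalf_eq_mul_tanQuot, tanQuot_eq]
          ring))
    have h4 := hT.unique (hasDerivAt_tanHalf (mem_ball_zero_iff.mp hz2))
    rw [tanHalf_eq_mul_tanQuot] at h4
    refine mul_left_cancel₀ (pow_ne_zero 2 hz) ?_
    push_cast at h4
    linear_combination h4
  have h4 := ((h1.eventuallyEq_nhds_iff_eventuallyEq_nhdsNE h2).mp h3).eq_of_nhds
  rw [tanQuot_zero] at h4
  linear_combination h4 / 3

theorem tanQuot_ofReal_im (θ : ℝ) : (tanQuot θ).im = 0 := by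
  rcases eq_or_ne θ 0 with rfl | hθ
  · rw [Complex.ofReal_zero, tanQuot_zero, Complex.one_im]
  · have h : tanQuot θ = ((2 * Real.tan (θ / 2) / θ : ℝ) : ℂ) := by
      have h1 := tanHalf_eq_mul_tanQuot θ
      have h2 : (θ : ℂ) ≠ 0 := Complex.ofReal_ne_zero.mpr hθ
      push_cast
      rw [eq_div_iff h2, mul_comm, ← h1, tanHalf]
    rw [h, Complex.ofReal_im]

theorem tanRem_ofReal_im (θ : ℝ) : (tanRem θ).im = 0 := by
  rcases eq_or_ne θ 0 with rfl | hθ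
  · rw [Complex.ofReal_zero, tanRem_zero]
    norm_num
  · have h := congrArg Complex.im (tanQuot_eq θ)
    rw [tanQuot_ofReal_im, Complex.add_im, Complex.one_im, zero_add, ← Complex.ofReal_pow,
      Complex.im_ofReal_mul] at h
    exact (mul_eq_zero.mp h.symm).resolve_left (pow_ne_zero 2 hθ)

theorem exists_norm_le_of_differentiableOn {G : ℂ → ℂ} (hG : DifferentiableOn ℂ G (ball 0 2)) :
    ∃ D, ∀ z, ‖z‖ ≤ 1 → ‖G z‖ ≤ D := by
  obtain ⟨D, hD⟩ := (isCompact_closedBall (0 : ℂ) 1).exists_bound_of_continuousOn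
    (hG.continuousOn.mono (closedBall_subset_ball one_lt_two))
  exact ⟨D, fun z hz => hD z (mem_closedBall_zero_iff.mpr hz)⟩

/-- For real `ε` the exponent is purely imaginary, so the bound holds for every `u` without
shrinking `ε`. -/
theorem norm_oscIntegral_ofReal_le {g : ℝ → ℂ} (hg : Integrable g) {T : ℝ}
    (hgT : ∀ τ, g τ ≠ 0 → |τ| ≤ T) {A B C : ℂ → ℂ} {D : ℝ}
    (hA : ∀ z, ‖z‖ ≤ 1 → ‖A z‖ ≤ D) (hB : ∀ θ : ℝ, (B θ).re = 0) (hC : ∀ θ : ℝ, (C θ).re = 0)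
    (u : ℝ) {ε : ℝ} (hε : |ε| * (2 * Real.pi * T) ≤ 1) :
    ‖oscIntegral g A B C u ε‖ ≤ (∫ τ, ‖g τ‖) * D := by
  rw [oscIntegral, ← integral_mul_const]
  refine norm_integral_le_of_norm_le (hg.norm.mul_const _) (Eventually.of_forall fun τ => ?_)
  by_cases hτ : g τ = 0
  · simp [oscIntegrand, hτ]
  rw [oscIntegrand, norm_mul, norm_mul, Complex.norm_exp, ← Complex.ofReal_mul, Complex.add_re,
    Complex.re_ofReal_mul, Complex.re_ofReal_mul, hB, hC, mul_zero, mul_zero, add_zero,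
    Real.exp_zero, mul_one]
  refine mul_le_mul_of_nonneg_left (hA _ (le_trans ?_ hε)) (norm_nonneg _)
  rw [Complex.norm_real, Real.norm_eq_abs, abs_mul, abs_mul, abs_of_pos Real.two_pi_pos]
  gcongr
  exact hgT τ hτ

/-! ### The localized Wigner sum as an oscillatory integral -/

/-- The amplitude `cos (z / 2) ^ (-d)`. -/
def amplitude (d : ℕ) (z : ℂ) : ℂ := (Complex.cos (z / 2) ^ d)⁻¹

/-- The cubic part of the phase. -/
def cubicPhase (E : ℝ) (z : ℂ) : ℂ := -(Complex.I * E) * tanRem z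

/-- The linear part of the phase. -/
def linearPhase (E : ℝ) (z : ℂ) : ℂ :=
  -(Complex.I * (((2 * E) ^ (-(2 / 3) : ℝ) : ℝ) : ℂ)) * tanQuot z

/-- The localized Wigner sum near the energy surface, normalized, as a function of `ε = ħ^(1/3)`. -/
def profile (d : ℕ) (E : ℝ) (f : ℝ → ℂ) (u : ℝ) : ℂ → ℂ :=
  oscIntegral (𝓕 f) (amplitude d) (cubicPhase E) (linearPhase E) u

/-- With `ħ = ε³` and `θ = εs`, the energy term `θE` cancels the linear part of `2E tan(θ/2)`. The
cubic rest and the shift of order `ε²` in `H` both carry `ε³`, cancelling the `1/ħ`. -/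
theorem weylSum_eq_profile (hħ : 0 < ħ) {E : ℝ} (hE : 0 < E) (f : 𝓢(ℝ, ℂ)) {u : ℝ}
    {x ξ : Conf d} (hH : hamiltonian x ξ = E + u * (ħ / (2 * E)) ^ (2 / 3 : ℝ))
    (hsupp : ∀ τ, 𝓕 (f : ℝ → ℂ) τ ≠ 0 → |2 * Real.pi * τ * ħ ^ (1 / 3 : ℝ)| ≤ 1) :
    weylSum d E f ħ x ξ
      = (((2 * Real.pi * ħ) ^ d : ℝ) : ℂ)⁻¹ * profile d E f u ((ħ ^ (1 / 3 : ℝ) : ℝ) : ℂ) := by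
  rw [weylSum_eq_integral hħ E f x ξ hsupp, profile, oscIntegral]
  congr 2
  ext τ
  set ε : ℝ := ħ ^ (1 / 3 : ℝ) with hε
  set s : ℝ := 2 * Real.pi * τ with hs
  have hε0 : 0 < ε := Real.rpow_pos_of_pos hħ _
  have hε3 : ħ = ε ^ 3 := by
    rw [hε, ← Real.rpow_natCast, ← Real.rpow_mul hħ.le]
    norm_num
  have hκ : (ħ / (2 * E)) ^ (2 / 3 : ℝ) = (2 * E) ^ (-(2 / 3) : ℝ) * ε ^ 2 := by
    rw [Real.div_rpow hħ.le (by positivity), Real.rpow_neg (by positivity), hε,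
      ← Real.rpow_natCast, ← Real.rpow_mul hħ.le]
    norm_num
    ring
  set κ : ℝ := (2 * E) ^ (-(2 / 3) : ℝ)
  have hT := tanHalf_eq_mul_tanQuot ((s * ε : ℝ) : ℂ)
  have hq := tanQuot_eq ((s * ε : ℝ) : ℂ)
  rw [oscIntegrand, amplitude, cubicPhase, linearPhase, ← Complex.ofReal_mul, mul_comm ε s]
  congr 3
  · push_cast
    rfl
  · have hεC : (ε : ℂ) ≠ 0 := Complex.ofReal_ne_zero.mpr hε0.ne'
    have hT' : ((2 * Real.tan (s * ε / 2) : ℝ) : ℂ) = tanHalf ((s * ε : ℝ) : ℂ) := by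
      rw [tanHalf]
      push_cast
      rfl
    have h1 : (((s * ε * E - 2 * hamiltonian x ξ * Real.tan (s * ε / 2)) / ħ : ℝ) : ℂ)
        = (s * ε * E - hamiltonian x ξ * ((2 * Real.tan (s * ε / 2) : ℝ) : ℂ)) / ε ^ 3 := by
      rw [hε3]
      push_cast
      ring
    rw [h1, hT', hT, hH, hκ, div_mul_eq_mul_div, div_eq_iff (pow_ne_zero 3 hεC)]
    clear_value s
    subst hs
    push_cast at hq ⊢
    linear_combination (-(E : ℂ) * (2 * Real.pi * τ) * ε * Complex.I) * hq

/-! ### The asymptotic expansion -/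

theorem amplitude_neg (d : ℕ) (z : ℂ) : amplitude d (-z) = amplitude d z := by
  rw [amplitude, amplitude, neg_div, Complex.cos_neg]

theorem cubicPhase_neg (E : ℝ) (z : ℂ) : cubicPhase E (-z) = cubicPhase E z := by
  rw [cubicPhase, cubicPhase, tanRem_neg]

theorem linearPhase_neg (E : ℝ) (z : ℂ) : linearPhase E (-z) = linearPhase E z := by
  rw [linearPhase, linearPhase, tanQuot_neg]

theorem profile_neg (d : ℕ) (E : ℝ) (f : ℝ → ℂ) (u : ℝ) (ε : ℂ) :
    profile d E f u (-ε) = profile d E f u ε :=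
  oscIntegral_neg (amplitude_neg d) (cubicPhase_neg E) (linearPhase_neg E) u ε

theorem continuous_fourier_schwartz (f : 𝓢(ℝ, ℂ)) : Continuous (𝓕 (f : ℝ → ℂ)) := by
  rw [← SchwartzMap.fourier_coe]
  exact (𝓕 f).continuous

theorem integrable_fourier_schwartz (f : 𝓢(ℝ, ℂ)) : Integrable (𝓕 (f : ℝ → ℂ)) := by
  rw [← SchwartzMap.fourier_coe]
  exact (𝓕 f).integrable

theorem differentiableOn_profile (d : ℕ) (E : ℝ) (f : 𝓢(ℝ, ℂ)) {T : ℝ} (hT : 0 < T)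
    (hfT : ∀ τ, 𝓕 (f : ℝ → ℂ) τ ≠ 0 → |τ| ≤ T) (u : ℝ) :
    DifferentiableOn ℂ (profile d E f u) (ball 0 (2 / (2 * Real.pi * T))) :=
  differentiableOn_oscIntegral (continuous_fourier_schwartz f) hT hfT
    (differentiableOn_inv_cos_half_pow d) (differentiableOn_tanRem.const_mul _)
    (differentiableOn_tanQuot.const_mul _) u

theorem exists_norm_profile_le (d : ℕ) (E : ℝ) (f : 𝓢(ℝ, ℂ)) {T : ℝ} (hT : 0 < T)
    (hfT : ∀ τ, 𝓕 (f : ℝ → ℂ) τ ≠ 0 → |τ| ≤ T) :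
    ∃ C, ∀ u : ℝ,
      (∀ ε : ℂ, ‖ε‖ ^ 2 * (1 + |u|) * (2 * Real.pi * T) ^ 2 ≤ 1 → ‖profile d E f u ε‖ ≤ C) ∧
      ∀ ε : ℝ, |ε| * (2 * Real.pi * T) ≤ 1 → ‖profile d E f u ε‖ ≤ C := by
  have hg := integrable_fourier_schwartz f
  obtain ⟨D, hD⟩ := exists_norm_le_of_differentiableOn (differentiableOn_inv_cos_half_pow d)
  obtain ⟨G, hG⟩ := exists_norm_le_of_differentiableOn differentiableOn_tanRem
  set κ : ℝ := (2 * E) ^ (-(2 / 3) : ℝ) with hκ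
  have hB (z : ℂ) (hz : ‖z‖ ≤ 1) : |(cubicPhase E z).re| ≤ |E| * G := by
    refine (Complex.abs_re_le_norm _).trans ?_
    rw [cubicPhase, norm_mul, norm_neg, norm_mul, Complex.norm_I, one_mul, Complex.norm_real,
      Real.norm_eq_abs]
    exact mul_le_mul_of_nonneg_left (hG z hz) (abs_nonneg _)
  have hC (z : ℂ) (hz : ‖z‖ ≤ 1) : |(linearPhase E z).re| ≤ |κ| * G * ‖z‖ ^ 2 := by
    -- The constant term `1` of `tanQuot` is multiplied by a purely imaginary number and drops out
    -- of the real part, which is therefore of second order.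
    have h1 : (linearPhase E z).re = (-(Complex.I * (κ : ℂ)) * (z ^ 2 * tanRem z)).re := by
      rw [linearPhase, ← hκ, tanQuot_eq, mul_add, Complex.add_re]
      simp
    rw [h1]
    refine (Complex.abs_re_le_norm _).trans ?_
    rw [norm_mul, norm_neg, norm_mul, Complex.norm_I, one_mul, Complex.norm_real,
      Real.norm_eq_abs, norm_mul, norm_pow]
    calc |κ| * (‖z‖ ^ 2 * ‖tanRem z‖) ≤ |κ| * (‖z‖ ^ 2 * G) := by
          gcongr
          exact hG z hz
      _ = _ := by ring
  refine ⟨max ((∫ τ, ‖𝓕 (f : ℝ → ℂ) τ‖) * (D * Real.exp ((2 * Real.pi * T) ^ 3 * (|E| * G)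
    + 2 * Real.pi * T * (|κ| * G)))) ((∫ τ, ‖𝓕 (f : ℝ → ℂ) τ‖) * D), fun u => ⟨fun ε hε => ?_,
    fun ε hε => ?_⟩⟩
  · exact (norm_oscIntegral_le hg hT hfT hD hB hC u hε).trans (le_max_left _ _)
  · refine (norm_oscIntegral_ofReal_le hg hfT hD (fun θ => ?_) (fun θ => ?_) u hε).trans
      (le_max_right _ _)
    · simp [cubicPhase, tanRem_ofReal_im]
    · simp [linearPhase, tanQuot_ofReal_im]

theorem exists_expansion_profile (d : ℕ) (E : ℝ) (f : 𝓢(ℝ, ℂ)) {T : ℝ} (hT : 0 < T)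
    (hfT : ∀ τ, 𝓕 (f : ℝ → ℂ) τ ≠ 0 → |τ| ≤ T) :
    ∃ C, 0 ≤ C ∧ ∀ u : ℝ,
      (∀ m, ‖taylorCoeff (2 * m) (profile d E f u)‖
        ≤ C * ((2 * Real.pi * T) ^ 2 * (1 + |u|)) ^ m) ∧
      ∀ (M : ℕ) (ε : ℝ), 0 ≤ ε → ε * (2 * Real.pi * T) ≤ 1 →
        ‖profile d E f u ε - ∑ m ∈ Finset.range M,
            taylorCoeff (2 * m) (profile d E f u) * (ε : ℂ) ^ (2 * m)‖
          ≤ C * (2 * M + 2) * (4 * (2 * Real.pi * T) ^ 2) ^ M * ((1 + |u|) * ε ^ 2) ^ M := by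
  obtain ⟨C, hC⟩ := exists_norm_profile_le d E f hT hfT
  set S : ℝ := 2 * Real.pi * T with hS
  have hS0 : 0 < S := by positivity
  refine ⟨C, (norm_nonneg _).trans ((hC 0).2 0 (by simp)), fun u => ?_⟩
  -- The largest radius allowed by the uniform bound. It gives `(2ε/r)² = 4S²(1 + |u|)ε²`, so
  -- truncation after `2M` coefficients, the odd ones being zero, has the required error.
  set r : ℝ := (S * √(1 + |u|))⁻¹ with hr
  have hu : 0 < 1 + |u| := by positivity
  have hr0 : 0 < r := by positivity
  have hr2 : (r ^ 2)⁻¹ = S ^ 2 * (1 + |u|) := by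
    rw [hr, inv_pow, inv_inv, mul_pow, Real.sq_sqrt hu.le]
  have hrS : r < 2 / S := by
    rw [hr, lt_div_iff₀ hS0, mul_inv, mul_right_comm, inv_mul_cancel₀ hS0.ne', one_mul]
    refine lt_of_le_of_lt (inv_le_one_of_one_le₀ ?_) one_lt_two
    rw [Real.one_le_sqrt]
    linarith [abs_nonneg u]
  have hdiff : DiffContOnCl ℂ (profile d E f u) (ball 0 r) :=
    (differentiableOn_profile d E f hT hfT u).diffContOnCl_ball (closedBall_subset_ball hrS)
  have hbound (z : ℂ) (hz : z ∈ closedBall (0 : ℂ) r) : ‖profile d E f u z‖ ≤ C := by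
    refine (hC u).1 z ?_
    rw [mem_closedBall_zero_iff] at hz
    calc ‖z‖ ^ 2 * (1 + |u|) * S ^ 2 ≤ r ^ 2 * (1 + |u|) * S ^ 2 := by gcongr
      _ = r ^ 2 * (r ^ 2)⁻¹ := by rw [hr2]; ring
      _ = 1 := mul_inv_cancel₀ (by positivity)
      _ ≤ 1 := le_rfl
  refine ⟨fun m => ?_, fun M ε hε hεS => ?_⟩
  · refine (norm_taylorCoeff_le hr0 hdiff
      (fun z hz => hbound z (sphere_subset_closedBall hz)) (2 * m)).trans (le_of_eq ?_)
    rw [pow_mul, div_eq_mul_inv, ← inv_pow, hr2]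
  · have h := norm_sub_sum_taylorCoeff_le hr0 hdiff hbound hε
      ((hC u).2 ε (by rwa [abs_of_nonneg hε])) (2 * M)
    rw [sum_taylorCoeff_even (profile_neg d E f u)] at h
    refine h.trans (le_of_eq ?_)
    have h2 : (2 * ε / r) ^ 2 = 4 * S ^ 2 * ((1 + |u|) * ε ^ 2) := by
      rw [div_pow, div_eq_mul_inv, hr2]
      ring
    rw [pow_mul, h2, mul_pow]
    push_cast
    ring

/-! ### The Airy function on the real line -/

/-- The integrand `exp(v³/3 - x v)` of the contour integral of the Airy function. -/
def airyKernel (x : ℝ) (v : ℂ) : ℂ := Complex.exp (v ^ 3 / 3 - x * v)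

/-- The integral of `airyKernel` along the vertical line `Re v = c`. -/
def airyLine (x c : ℝ) : ℂ := ∫ s : ℝ, airyKernel x (c + s * Complex.I)

theorem norm_airyKernel (x c s : ℝ) :
    ‖airyKernel x (c + s * Complex.I)‖ = Real.exp (c ^ 3 / 3 - x * c) * Real.exp (-c * s ^ 2) := by
  rw [airyKernel, Complex.norm_exp, ← Real.exp_add]
  congr 1
  have h : ((c : ℂ) + s * Complex.I) ^ 3 / 3 - x * (c + s * Complex.I)
      = ((c ^ 3 / 3 - x * c + -c * s ^ 2 : ℝ) : ℂ)
        + ((c ^ 2 * s - s ^ 3 / 3 - x * s : ℝ) : ℂ) * Complex.I := by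
    push_cast
    linear_combination ((c : ℂ) * s ^ 2 + s ^ 3 / 3 * Complex.I) * Complex.I_sq
  rw [h, Complex.add_re, Complex.ofReal_re, Complex.re_ofReal_mul, Complex.I_re, mul_zero,
    add_zero]

theorem continuous_airyKernel (x c : ℝ) :
    Continuous fun s : ℝ => airyKernel x (c + s * Complex.I) := by
  unfold airyKernel
  fun_prop

theorem integrable_airyKernel (x : ℝ) {c : ℝ} (hc : 0 < c) :
    Integrable fun s : ℝ => airyKernel x (c + s * Complex.I) :=
  ((integrable_exp_neg_mul_sq hc).const_mul (Real.exp (c ^ 3 / 3 - x * c))).mono'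
    (continuous_airyKernel x c).aestronglyMeasurable
    (Eventually.of_forall fun s => (norm_airyKernel x c s).le)

theorem norm_airyLine_le (x : ℝ) {c : ℝ} (hc : 0 < c) :
    ‖airyLine x c‖ ≤ Real.exp (c ^ 3 / 3 - x * c) * √(Real.pi / c) := by
  rw [airyLine, ← integral_gaussian, ← integral_const_mul]
  exact norm_integral_le_of_norm_le ((integrable_exp_neg_mul_sq hc).const_mul _)
    (Eventually.of_forall fun s => (norm_airyKernel x c s).le)

theorem hasDerivAt_airyKernel (x : ℝ) (v : ℂ) :
    HasDerivAt (airyKernel x) ((v ^ 2 - x) * airyKernel x v) v := by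
  have h : HasDerivAt (fun v : ℂ => v ^ 3 / 3 - x * v) (v ^ 2 - x) v := by
    refine (((hasDerivAt_pow 3 v).div_const 3).sub
      ((hasDerivAt_id v).const_mul (x : ℂ))).congr_deriv ?_
    push_cast
    ring
  exact h.cexp.congr_deriv (mul_comm _ _)

theorem hasDerivAt_airyLine (x : ℝ) {c : ℝ} (hc : 0 < c) : HasDerivAt (airyLine x) 0 c := by
  set F' : ℝ → ℝ → ℂ := fun c s =>
    ((c + s * Complex.I) ^ 2 - x) * airyKernel x (c + s * Complex.I) with hF'
  set K : ℝ := Real.exp ((2 * c) ^ 3 / 3 + |x| * (2 * c)) with hK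
  have hbound (s a : ℝ) (ha : a ∈ Set.Icc (c / 2) (2 * c)) :
      ‖F' a s‖ ≤ (((2 * c) ^ 2 + |x|) * K) * Real.exp (-(c / 2) * s ^ 2)
        + K * (s ^ (2 : ℝ) * Real.exp (-(c / 2) * s ^ 2)) := by
    have ha0 : 0 < a := lt_of_lt_of_le (by positivity) ha.1
    have h1 : ‖((a : ℂ) + s * Complex.I) ^ 2 - x‖ ≤ (2 * c) ^ 2 + |x| + s ^ 2 := by
      have h2 : ‖((a : ℂ) + s * Complex.I)‖ ^ 2 = a ^ 2 + s ^ 2 := by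
        rw [← Complex.normSq_eq_norm_sq, Complex.normSq_add_mul_I]
      calc _ ≤ ‖((a : ℂ) + s * Complex.I) ^ 2‖ + ‖(x : ℂ)‖ := norm_sub_le _ _
        _ = a ^ 2 + s ^ 2 + |x| := by
            rw [norm_pow, h2, Complex.norm_real, Real.norm_eq_abs]
        _ ≤ _ := by
            have := pow_le_pow_left₀ ha0.le ha.2 2
            linarith
    have h2 : ‖airyKernel x (a + s * Complex.I)‖ ≤ K * Real.exp (-(c / 2) * s ^ 2) := by
      rw [norm_airyKernel]
      refine mul_le_mul (Real.exp_le_exp.mpr ?_) (Real.exp_le_exp.mpr ?_) (Real.exp_pos _).le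
        (Real.exp_pos _).le
      · have h3 := pow_le_pow_left₀ ha0.le ha.2 3
        have h4 : -(x * a) ≤ |x| * (2 * c) :=
          calc -(x * a) ≤ |x * a| := neg_le_abs _
            _ = |x| * a := by rw [abs_mul, abs_of_pos ha0]
            _ ≤ _ := mul_le_mul_of_nonneg_left ha.2 (abs_nonneg x)
        linarith
      · nlinarith [sq_nonneg s, ha.1]
    rw [hF', norm_mul, Real.rpow_two]
    calc _ ≤ ((2 * c) ^ 2 + |x| + s ^ 2) * (K * Real.exp (-(c / 2) * s ^ 2)) :=
          mul_le_mul h1 h2 (norm_nonneg _) (by positivity)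
      _ = _ := by ring
  have hc2 : 0 < c / 2 := by positivity
  have hint : Integrable fun s : ℝ => (((2 * c) ^ 2 + |x|) * K) * Real.exp (-(c / 2) * s ^ 2)
        + K * (s ^ (2 : ℝ) * Real.exp (-(c / 2) * s ^ 2)) :=
    ((integrable_exp_neg_mul_sq hc2).const_mul _).add
      ((integrable_rpow_mul_exp_neg_mul_sq hc2 (by norm_num)).const_mul _)
  have hcont : Continuous (F' c) := by
    have := continuous_airyKernel x c
    rw [hF']
    fun_prop
  have hline (a s : ℝ) : HasDerivAt (fun a : ℝ => airyKernel x (a + s * Complex.I)) (F' a s) a := by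
    have h1 : HasDerivAt (fun a : ℝ => (a : ℂ) + s * Complex.I) 1 a :=
      (Complex.ofRealCLM.hasDerivAt).add_const _
    exact ((hasDerivAt_airyKernel x _).comp a h1).congr_deriv (mul_one _)
  have hmain := hasDerivAt_integral_of_dominated_loc_of_deriv_le (μ := volume)
    (F := fun a s : ℝ => airyKernel x (a + s * Complex.I)) (F' := F')
    (Icc_mem_nhds (by linarith) (by linarith) : Set.Icc (c / 2) (2 * c) ∈ 𝓝 c)
    (Eventually.of_forall fun a => (continuous_airyKernel x a).aestronglyMeasurable)
    (integrable_airyKernel x hc) hcont.aestronglyMeasurable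
    (Eventually.of_forall fun s a ha => hbound s a ha) hint
    (Eventually.of_forall fun s a _ => hline a s)
  -- By holomorphy the derivative in `c` is `-i` times the derivative in `s`, and a derivative
  -- integrates to zero over the line.
  have hzero : ∫ s, F' c s = 0 := by
    have h1 (s : ℝ) : HasDerivAt (fun s : ℝ => -Complex.I * airyKernel x (c + s * Complex.I))
        (F' c s) s := by
      have h2 : HasDerivAt (fun s : ℝ => (c : ℂ) + s * Complex.I) Complex.I s := by
        simpa using ((Complex.ofRealCLM.hasDerivAt (x := s)).mul_const Complex.I).const_add (c : ℂ)
      refine (((hasDerivAt_airyKernel x _).comp s h2).const_mul (-Complex.I)).congr_deriv ?_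
      rw [hF']
      linear_combination -((c + s * Complex.I) ^ 2 - x) * airyKernel x (c + s * Complex.I)
        * Complex.I_sq
    exact integral_eq_zero_of_hasDerivAt_of_integrable h1 hmain.1
      ((integrable_airyKernel x hc).const_mul _)
  exact hmain.2.congr_deriv hzero

/-- The Airy function may be computed on any vertical line in the right half plane. -/
theorem airyAi_eq_airyLine (x : ℝ) {c : ℝ} (hc : 0 < c) :
    airyAi x = (2 * Real.pi : ℂ)⁻¹ * airyLine x c := by
  have h1 : airyLine x 1 = airyLine x c :=
    isOpen_Ioi.is_const_of_deriv_eq_zero (s := Set.Ioi (0 : ℝ)) isPreconnected_Ioi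
      (fun a ha => (hasDerivAt_airyLine x ha).differentiableAt.differentiableWithinAt)
      (fun a ha => (hasDerivAt_airyLine x ha).deriv) (Set.mem_Ioi.mpr one_pos) hc
  rw [← h1, airyAi, airyLine, integral_mul_const, mul_inv]
  simp only [airyKernel, Complex.ofReal_one]
  rw [mul_assoc, mul_comm _ Complex.I, inv_mul_cancel_left₀ Complex.I_ne_zero]

theorem norm_airyAi_le (x : ℝ) {c : ℝ} (hc : 0 < c) :
    ‖airyAi x‖ ≤ Real.exp (c ^ 3 / 3 - x * c) * √(Real.pi / c) := by
  rw [airyAi_eq_airyLine x hc, norm_mul]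
  refine (mul_le_of_le_one_left (norm_nonneg _) ?_).trans (norm_airyLine_le x hc)
  rw [norm_inv, norm_mul, Complex.norm_ofNat, Complex.norm_real, Real.norm_of_nonneg Real.pi_pos.le]
  exact inv_le_one_of_one_le₀ (by nlinarith [Real.pi_gt_three])

/-- The contour is adapted to `y`. For `y ≥ 0` the line `Re v = 1` supplies `exp(-y)`, which absorbs
the factor `exp(εy)`; for `y ≤ 0` the abscissa `1/(1 + |y|)` keeps the exponent bounded and costs
only a power. Linear growth suffices against Schwartz decay. -/
theorem norm_exp_mul_airyAi_le {ε : ℝ} (hε0 : 0 ≤ ε) (hε1 : ε ≤ 1) (y : ℝ) :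
    ‖Complex.exp (ε * y : ℝ) * airyAi y‖ ≤ Real.exp 2 * √Real.pi * (1 + |y|) := by
  rw [norm_mul, Complex.norm_exp, Complex.ofReal_re]
  have hy1 : 1 ≤ 1 + |y| := by linarith [abs_nonneg y]
  have hy0 : 0 < 1 + |y| := by positivity
  rcases le_total 0 y with hy | hy
  · have h := norm_airyAi_le y one_pos
    rw [div_one] at h
    calc Real.exp (ε * y) * ‖airyAi y‖
        ≤ Real.exp y * (Real.exp (1 ^ 3 / 3 - y * 1) * √Real.pi) :=
          mul_le_mul (Real.exp_le_exp.mpr (by nlinarith)) h (norm_nonneg _) (Real.exp_pos _).le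
      _ = Real.exp (1 / 3) * √Real.pi * 1 := by
          rw [← mul_assoc, ← Real.exp_add, show y + (1 ^ 3 / 3 - y * 1) = 1 / 3 by ring, mul_one]
      _ ≤ _ := mul_le_mul (mul_le_mul_of_nonneg_right (Real.exp_le_exp.mpr (by norm_num))
          (Real.sqrt_nonneg _)) hy1 zero_le_one (by positivity)
  · have h := norm_airyAi_le y (inv_pos.mpr hy0)
    have h1 : Real.exp (ε * y) ≤ 1 := Real.exp_le_one_iff.mpr (by nlinarith)
    have h2 : Real.exp ((1 + |y|)⁻¹ ^ 3 / 3 - y * (1 + |y|)⁻¹) ≤ Real.exp 2 := by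
      refine Real.exp_le_exp.mpr ?_
      have h3 : (1 + |y|)⁻¹ ≤ 1 := inv_le_one_of_one_le₀ hy1
      have h4 : (1 + |y|)⁻¹ ^ 3 ≤ 1 := pow_le_one₀ (by positivity) h3
      have h5 : -y * (1 + |y|)⁻¹ ≤ 1 := by
        rw [← div_eq_mul_inv, div_le_one hy0]
        linarith [neg_le_abs y]
      linarith
    have h3 : √(Real.pi / (1 + |y|)⁻¹) ≤ √Real.pi * (1 + |y|) := by
      rw [div_inv_eq_mul, Real.sqrt_mul Real.pi_pos.le]
      refine mul_le_mul_of_nonneg_left ?_ (Real.sqrt_nonneg _)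
      rw [Real.sqrt_le_left hy0.le]
      nlinarith
    calc _ ≤ 1 * (Real.exp ((1 + |y|)⁻¹ ^ 3 / 3 - y * (1 + |y|)⁻¹)
            * √(Real.pi / (1 + |y|)⁻¹)) := mul_le_mul h1 h (norm_nonneg _) zero_le_one
      _ ≤ Real.exp 2 * (√Real.pi * (1 + |y|)) := by
          rw [one_mul]
          exact mul_le_mul h2 h3 (Real.sqrt_nonneg _) (Real.exp_pos _).le
      _ = _ := by ring

theorem stronglyMeasurable_airyAi : StronglyMeasurable fun x : ℝ => airyAi x := by
  refine StronglyMeasurable.const_mul (StronglyMeasurable.integral_prod_right ?_) _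
  exact Continuous.stronglyMeasurable (by unfold Function.uncurry; fun_prop)

/-! ### The leading coefficient -/

theorem airyConst_pos {E : ℝ} (hE : 0 < E) : 0 < airyConst E :=
  Real.rpow_pos_of_pos (by positivity) _

theorem exists_integrable_bound_leadingIntegrand {E : ℝ} (hE : 0 < E) (f : 𝓢(ℝ, ℂ)) (u : ℝ) :
    ∃ b : ℝ → ℝ, Integrable b ∧ ∀ ε : ℝ, 0 ≤ ε → ε ≤ 1 → ∀ l : ℝ,
      ‖Complex.exp (ε * (l + u / E) : ℝ) * leadingIntegrand E f u l‖ ≤ b l := by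
  set c := airyConst E with hc
  have hc0 : 0 < c := airyConst_pos hE
  set Q : ℝ := Real.exp 2 * √Real.pi with hQ
  refine ⟨fun l => Q * (1 + |u / E|) * ‖f (l / c)‖ + Q * c * (‖l / c‖ ^ 1 * ‖f (l / c)‖),
    ((f.integrable.norm.comp_div hc0.ne').const_mul _).add
      (((f.integrable_pow_mul volume 1).comp_div hc0.ne').const_mul _), fun ε h0 h1 l => ?_⟩
  rw [leadingIntegrand, mul_left_comm, norm_mul]
  have h2 : 1 + |l + u / E| ≤ 1 + |u / E| + c * ‖l / c‖ := by
    rw [Real.norm_eq_abs, abs_div l c, abs_of_pos hc0, mul_div_cancel₀ _ hc0.ne']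
    linarith [abs_add_le l (u / E)]
  calc _ ≤ ‖f (l / c)‖ * (Q * (1 + |u / E| + c * ‖l / c‖)) :=
        mul_le_mul_of_nonneg_left ((norm_exp_mul_airyAi_le h0 h1 _).trans
          (mul_le_mul_of_nonneg_left h2 (by positivity))) (norm_nonneg _)
    _ = _ := by ring

theorem aestronglyMeasurable_leadingIntegrand (E : ℝ) (f : 𝓢(ℝ, ℂ)) (u : ℝ) :
    AEStronglyMeasurable (leadingIntegrand E f u) := by
  have h : StronglyMeasurable fun l : ℝ => airyAi ((l + u / E : ℝ) : ℂ) :=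
    stronglyMeasurable_airyAi.comp_measurable (measurable_id.add_const _)
  have h2 : Continuous fun l : ℝ => f (l / airyConst E) :=
    f.continuous.comp (continuous_id.div_const _)
  exact (h2.stronglyMeasurable.mul h).aestronglyMeasurable

theorem integrable_leadingIntegrand {E : ℝ} (hE : 0 < E) (f : 𝓢(ℝ, ℂ)) (u : ℝ) :
    Integrable (leadingIntegrand E f u) := by
  obtain ⟨b, hb, h⟩ := exists_integrable_bound_leadingIntegrand hE f u
  refine hb.mono' (aestronglyMeasurable_leadingIntegrand E f u) (Eventually.of_forall fun l => ?_)
  simpa using h 0 le_rfl zero_le_one l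

/-- The Fourier transform of the damped Airy multiplier. -/
def airyMultiplier (c a ε τ : ℝ) : ℂ :=
  Complex.exp ((ε + (2 * Real.pi * τ / c : ℝ) * Complex.I) ^ 3 / 3
    - (2 * Real.pi * τ / c * a : ℝ) * Complex.I)

theorem airyMultiplier_eq (c a ε τ : ℝ) : airyMultiplier c a ε τ
    = Complex.exp (ε * a : ℝ) * airyKernel a (ε + (2 * Real.pi * τ / c : ℝ) * Complex.I) := by
  rw [airyMultiplier, airyKernel, ← Complex.exp_add]
  congr 1
  push_cast
  ring

theorem integrable_airyMultiplier {c : ℝ} (hc : 0 < c) (a : ℝ) {ε : ℝ} (hε : 0 < ε) :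
    Integrable (airyMultiplier c a ε) := by
  have h := ((integrable_airyKernel a hε).comp_mul_left' (R := 2 * Real.pi / c)
    (by positivity)).const_mul (Complex.exp (ε * a : ℝ))
  refine h.congr (Eventually.of_forall fun τ => ?_)
  simp only [airyMultiplier_eq, mul_div_right_comm]

theorem norm_airyMultiplier (c a ε τ : ℝ) : ‖airyMultiplier c a ε τ‖
    = Real.exp (ε ^ 3 / 3) * Real.exp (-ε * (2 * Real.pi * τ / c) ^ 2) := by
  rw [airyMultiplier_eq, norm_mul, norm_airyKernel, Complex.norm_exp, Complex.ofReal_re,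
    ← mul_assoc, ← Real.exp_add]
  congr 2
  ring

/-- This is the contour formula for the Airy function on the line `Re v = ε`, rescaled by `s =
2πτ/c`; the Jacobian is the factor `c`. The damping makes the multiplier integrable. -/
theorem fourier_airyMultiplier {c : ℝ} (hc : 0 < c) (a : ℝ) {ε : ℝ} (hε : 0 < ε) (t : ℝ) :
    𝓕 (airyMultiplier c a ε) t
      = c * (Complex.exp (ε * (c * t + a) : ℝ) * airyAi ((c * t + a : ℝ) : ℂ)) := by
  rw [Real.fourier_real_eq_integral_exp_smul, airyAi_eq_airyLine _ hε, airyLine]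
  have h := Measure.integral_comp_mul_left
    (fun s : ℝ => airyKernel (c * t + a) (ε + s * Complex.I)) (2 * Real.pi / c)
  have hpos : 0 < 2 * Real.pi / c := by positivity
  rw [abs_of_pos (inv_pos.mpr hpos), Complex.real_smul] at h
  have h2 : ((2 * Real.pi : ℂ)⁻¹ * c) * ∫ s : ℝ, airyKernel (c * t + a) (ε + s * Complex.I)
      = ∫ τ : ℝ, airyKernel (c * t + a) (ε + (2 * Real.pi / c * τ : ℝ) * Complex.I) := by
    rw [h]
    push_cast
    rw [inv_div]
    ring
  rw [show ∀ z : ℂ, (c : ℂ) * (Complex.exp (ε * (c * t + a) : ℝ) * ((2 * Real.pi : ℂ)⁻¹ * z))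
    = Complex.exp (ε * (c * t + a) : ℝ) * (((2 * Real.pi : ℂ)⁻¹ * c) * z) from fun z => by ring,
    h2, ← integral_const_mul]
  congr 1
  ext τ
  rw [airyMultiplier, airyKernel, smul_eq_mul, ← Complex.exp_add, ← Complex.exp_add]
  congr 1
  have hcC : (c : ℂ) ≠ 0 := Complex.ofReal_ne_zero.mpr hc.ne'
  push_cast
  field_simp
  ring

theorem integral_exp_mul_leadingIntegrand {E : ℝ} (hE : 0 < E) (f : 𝓢(ℝ, ℂ)) (u : ℝ) {ε : ℝ}
    (hε : 0 < ε) : ∫ l : ℝ, Complex.exp (ε * (l + u / E) : ℝ) * leadingIntegrand E f u l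
      = ∫ τ : ℝ, 𝓕 (f : ℝ → ℂ) τ * airyMultiplier (airyConst E) (u / E) ε τ := by
  have hc := airyConst_pos hE
  have h1 : ∫ τ : ℝ, 𝓕 (f : ℝ → ℂ) τ * airyMultiplier (airyConst E) (u / E) ε τ
      = ∫ t : ℝ, f t * 𝓕 (airyMultiplier (airyConst E) (u / E) ε) t := by
    simpa using! VectorFourier.integral_bilin_fourierIntegral_eq_flip
      (ContinuousLinearMap.mul ℂ ℂ) (L := innerₗ ℝ) Real.continuous_fourierChar
      continuous_inner f.integrable (integrable_airyMultiplier hc (u / E) hε)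
  have h2 := Measure.integral_comp_mul_left
    (fun l : ℝ => Complex.exp (ε * (l + u / E) : ℝ) * leadingIntegrand E f u l) (airyConst E)
  rw [abs_of_pos (inv_pos.mpr hc), eq_inv_smul_iff₀ hc.ne', ← integral_smul] at h2
  rw [h1, ← h2]
  congr 1
  ext t
  rw [fourier_airyMultiplier hc _ hε, leadingIntegrand, mul_div_cancel_left₀ _ hc.ne',
    Complex.real_smul]
  ring

/-- At `ε = 0` the multiplier has modulus `1` and is not integrable, so Parseval is used for `ε > 0`
and both sides pass to the limit by dominated convergence. -/
theorem leadingCoeff_eq_integral {E : ℝ} (hE : 0 < E) (f : 𝓢(ℝ, ℂ)) (u : ℝ) :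
    leadingCoeff E f u = ∫ τ : ℝ, 𝓕 (f : ℝ → ℂ) τ * airyMultiplier (airyConst E) (u / E) 0 τ := by
  have hε : ∀ᶠ ε : ℝ in 𝓝[>] 0, ε ∈ Set.Ioc (0 : ℝ) 1 := Ioc_mem_nhdsGT one_pos
  have hL : Tendsto
      (fun ε : ℝ => ∫ l : ℝ, Complex.exp (ε * (l + u / E) : ℝ) * leadingIntegrand E f u l)
      (𝓝[>] 0) (𝓝 (leadingCoeff E f u)) := by
    obtain ⟨b, hb, h⟩ := exists_integrable_bound_leadingIntegrand hE f u
    refine tendsto_integral_filter_of_dominated_convergence b ?_ ?_ hb ?_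
    · refine Eventually.of_forall fun ε => AEStronglyMeasurable.mul ?_
        (aestronglyMeasurable_leadingIntegrand E f u)
      exact Continuous.aestronglyMeasurable (by fun_prop)
    · filter_upwards [hε] with ε hε
      exact Eventually.of_forall (h ε hε.1.le hε.2)
    · refine Eventually.of_forall fun l => ?_
      have hcont : Continuous fun ε : ℝ =>
          Complex.exp (ε * (l + u / E) : ℝ) * leadingIntegrand E f u l := by fun_prop
      simpa using (hcont.tendsto 0).mono_left nhdsWithin_le_nhds
  have hR : Tendsto
      (fun ε : ℝ => ∫ τ : ℝ, 𝓕 (f : ℝ → ℂ) τ * airyMultiplier (airyConst E) (u / E) ε τ)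
      (𝓝[>] 0) (𝓝 (∫ τ : ℝ, 𝓕 (f : ℝ → ℂ) τ * airyMultiplier (airyConst E) (u / E) 0 τ)) := by
    refine tendsto_integral_filter_of_dominated_convergence
      (fun τ => ‖𝓕 (f : ℝ → ℂ) τ‖ * Real.exp 1) ?_ ?_
      ((integrable_fourier_schwartz f).norm.mul_const _) ?_
    · refine Eventually.of_forall fun ε => Continuous.aestronglyMeasurable ?_
      refine (continuous_fourier_schwartz f).mul ?_
      unfold airyMultiplier
      fun_prop
    · filter_upwards [hε] with ε hε
      refine Eventually.of_forall fun τ => ?_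
      rw [norm_mul, norm_airyMultiplier]
      refine mul_le_mul_of_nonneg_left ?_ (norm_nonneg _)
      refine (mul_le_of_le_one_right (Real.exp_pos _).le (Real.exp_le_one_iff.mpr ?_)).trans
        (Real.exp_le_exp.mpr ?_)
      · nlinarith [hε.1, sq_nonneg (2 * Real.pi * τ / airyConst E)]
      · linarith [pow_le_one₀ hε.1.le hε.2 (n := 3)]
    · refine Eventually.of_forall fun τ => ?_
      have hcont : Continuous fun ε : ℝ =>
          𝓕 (f : ℝ → ℂ) τ * airyMultiplier (airyConst E) (u / E) ε τ := by
        unfold airyMultiplier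
        fun_prop
      exact (hcont.tendsto 0).mono_left nhdsWithin_le_nhds
  refine tendsto_nhds_unique hL (hR.congr' ?_)
  filter_upwards [hε] with ε hε
  exact (integral_exp_mul_leadingIntegrand hE f u hε.1).symm

theorem profile_zero (d : ℕ) {E : ℝ} (hE : 0 < E) (f : 𝓢(ℝ, ℂ)) (u : ℝ) :
    profile d E f u 0 = leadingCoeff E f u := by
  rw [leadingCoeff_eq_integral hE, profile, oscIntegral]
  congr 1
  ext τ
  have hc := airyConst_pos hE
  have h3 : airyConst E ^ 3 = 4 / E := by
    rw [airyConst, ← Real.rpow_natCast, ← Real.rpow_mul (by positivity)]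
    norm_num
  -- The two identities for `airyConst E` match the phases: `s³E/12 = (s/C_E)³/3` and `(2E)^(-2/3) u
  -- s = (s/C_E)(u/E)`.
  have hκ : (2 * E) ^ (-(2 / 3) : ℝ) = (airyConst E * E)⁻¹ := by
    have h : (2 * E) ^ (-(2 / 3) : ℝ) = ((2 * E) ^ (2 : ℕ)) ^ (-(1 / 3) : ℝ) := by
      rw [← Real.rpow_natCast, ← Real.rpow_mul (by positivity)]
      norm_num
    rw [h, Real.rpow_neg (by positivity)]
    congr 1
    have hE3 : E = (E ^ 3) ^ (1 / 3 : ℝ) := by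
      rw [← Real.rpow_natCast, ← Real.rpow_mul hE.le]
      norm_num
    nth_rewrite 3 [hE3]
    rw [airyConst, ← Real.mul_rpow (by positivity) (by positivity)]
    congr 1
    field_simp
    norm_num
  have h3C : (airyConst E : ℂ) ^ 3 = 4 / E := by
    rw [← Complex.ofReal_pow, h3]
    push_cast
    rfl
  have hcC : (airyConst E : ℂ) ≠ 0 := Complex.ofReal_ne_zero.mpr hc.ne'
  have hEC : (E : ℂ) ≠ 0 := Complex.ofReal_ne_zero.mpr hE.ne'
  rw [oscIntegrand, airyMultiplier, amplitude, cubicPhase, linearPhase, hκ, zero_mul, tanRem_zero,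
    tanQuot_zero, zero_div, Complex.cos_zero, one_pow, inv_one, one_mul]
  congr 2
  have h4 : ((0 : ℝ) + (2 * Real.pi * τ / airyConst E : ℝ) * Complex.I) ^ 3 / 3
      = -((2 * Real.pi * τ) ^ 3 * (E / 12)) * Complex.I := by
    push_cast
    rw [zero_add, mul_pow, div_pow, h3C, Complex.I_pow_three]
    field_simp
    ring
  rw [h4]
  push_cast
  field_simp
  ring

/-! ### Asymptotics of the localized Wigner sum -/

theorem exists_support_bound {g : ℝ → ℂ} (hg : HasCompactSupport g) :
    ∃ T, 0 < T ∧ ∀ τ, g τ ≠ 0 → |τ| ≤ T := by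
  obtain ⟨T, hT0, hT⟩ := hg.isCompact.isBounded.exists_pos_norm_le
  exact ⟨T, hT0, fun τ hτ => hT τ (subset_tsupport g hτ)⟩

theorem taylorCoeff_zero_profile (d : ℕ) {E : ℝ} (hE : 0 < E) (f : 𝓢(ℝ, ℂ)) (u : ℝ) :
    taylorCoeff (2 * 0) (profile d E f u) = leadingCoeff E f u := by
  rw [mul_zero, taylorCoeff, iteratedDeriv_zero, profile_zero d hE]
  simp

theorem exists_bound_taylorCoeff_profile (d : ℕ) (E : ℝ) (f : 𝓢(ℝ, ℂ))
    (hf : HasCompactSupport (𝓕 (f : ℝ → ℂ))) (m : ℕ) {K : Set ℝ} (hK : IsCompact K) :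
    ∃ B : ℝ, ∀ u ∈ K, ‖taylorCoeff (2 * m) (profile d E f u)‖ ≤ B := by
  obtain ⟨T, hT, hfT⟩ := exists_support_bound hf
  obtain ⟨C, hC0, hC⟩ := exists_expansion_profile d E f hT hfT
  obtain ⟨R, hR⟩ := hK.isBounded.exists_norm_le
  refine ⟨C * ((2 * Real.pi * T) ^ 2 * (1 + R)) ^ m, fun u hu => ((hC u).1 m).trans ?_⟩
  have := hR u hu
  rw [Real.norm_eq_abs] at this
  gcongr

theorem exists_weylSum_expansion (d : ℕ) {E : ℝ} (hE : 0 < E) (f : 𝓢(ℝ, ℂ))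
    (hf : HasCompactSupport (𝓕 (f : ℝ → ℂ))) (M : ℕ) :
    ∃ C ħ₀ : ℝ, 0 < ħ₀ ∧ ∀ ħ : ℝ, 0 < ħ → ħ < ħ₀ → ∀ (u : ℝ) (x ξ : Conf d),
      hamiltonian x ξ = E + u * (ħ / (2 * E)) ^ (2 / 3 : ℝ) →
      ‖weylSum d E f ħ x ξ - (((2 * Real.pi * ħ) ^ d : ℝ) : ℂ)⁻¹ *
          ∑ m ∈ Finset.range M, ((ħ ^ (2 * (m : ℝ) / 3) : ℝ) : ℂ) *
            taylorCoeff (2 * m) (profile d E f u)‖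
        ≤ C * ((1 + |u|) ^ M * ħ ^ (-(d : ℝ) + 2 * (M : ℝ) / 3)) := by
  obtain ⟨T, hT, hfT⟩ := exists_support_bound hf
  obtain ⟨C, hC0, hC⟩ := exists_expansion_profile d E f hT hfT
  set S : ℝ := 2 * Real.pi * T with hS
  have hS0 : 0 < S := by positivity
  -- The threshold `ħ₀ = S^(-3)` means `εS ≤ 1`: all angles `2πτε` on the support are then at most
  -- `1`, as both the integral representation and the bound for real `ε` require.
  refine ⟨((2 * Real.pi) ^ d)⁻¹ * (C * (2 * M + 2) * (4 * S ^ 2) ^ M), S⁻¹ ^ 3, by positivity,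
    fun ħ hħ hħ0 u x ξ hH => ?_⟩
  set ε : ℝ := ħ ^ (1 / 3 : ℝ) with hε
  have hε0 : 0 < ε := Real.rpow_pos_of_pos hħ _
  have hpow (m : ℕ) : ħ ^ (2 * (m : ℝ) / 3) = ε ^ (2 * m) := by
    rw [hε, ← Real.rpow_natCast, ← Real.rpow_mul hħ.le]
    congr 1
    push_cast
    ring
  have hεS : ε * S ≤ 1 := by
    rw [← le_div_iff₀ hS0, one_div]
    refine (pow_le_pow_iff_left₀ hε0.le (by positivity) three_ne_zero).mp ?_
    rw [hε, ← Real.rpow_natCast, ← Real.rpow_mul hħ.le]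
    norm_num at hħ0 ⊢
    exact hħ0.le
  have hsupp (τ : ℝ) (hτ : 𝓕 (f : ℝ → ℂ) τ ≠ 0) : |2 * Real.pi * τ * ħ ^ (1 / 3 : ℝ)| ≤ 1 := by
    rw [← hε, abs_mul, abs_mul, abs_of_pos Real.two_pi_pos, abs_of_pos hε0, mul_comm]
    refine le_trans (mul_le_mul_of_nonneg_left ?_ hε0.le) hεS
    exact mul_le_mul_of_nonneg_left (hfT τ hτ) Real.two_pi_pos.le
  have hsum : ∑ m ∈ Finset.range M, ((ħ ^ (2 * (m : ℝ) / 3) : ℝ) : ℂ) *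
        taylorCoeff (2 * m) (profile d E f u)
      = ∑ m ∈ Finset.range M, taylorCoeff (2 * m) (profile d E f u) * (ε : ℂ) ^ (2 * m) := by
    refine Finset.sum_congr rfl fun m _ => ?_
    rw [hpow, Complex.ofReal_pow, mul_comm]
  rw [weylSum_eq_profile hħ hE f hH hsupp, ← hε, hsum, ← mul_sub, norm_mul, norm_inv,
    Complex.norm_real, Real.norm_of_nonneg (by positivity), Real.rpow_add hħ, Real.rpow_neg hħ.le,
    Real.rpow_natCast, hpow, mul_pow (2 * Real.pi), mul_inv]
  refine (mul_le_mul_of_nonneg_left ((hC u).2 M ε hε0.le hεS) (by positivity)).trans (le_of_eq ?_)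
  rw [mul_pow (1 + |u|), ← pow_mul]
  ring

end

end WignerWeyl

theorem theorem1p2 (d : ℕ) (hd : 1 ≤ d) (E : ℝ) (hE : 0 < E) (f : 𝓢(ℝ, ℂ))
    (hf : HasCompactSupport (𝓕 (f : ℝ → ℂ))) :
    -- the localized sums and the leading integral converge absolutely
    (∀ ħ : ℝ, 0 < ħ → ∀ x ξ : WignerWeyl.Conf d,
      Summable (WignerWeyl.weylTerm d E f ħ x ξ)) ∧
    (∀ u : ℝ, Integrable (WignerWeyl.leadingIntegrand E f u)) ∧
    -- leading asymptotics
    (∃ C ħ₀ : ℝ, 0 < ħ₀ ∧ ∀ ħ : ℝ, 0 < ħ → ħ < ħ₀ →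
      ∀ u : ℝ, |u| < ħ ^ (-(2 / 3) : ℝ) →
      ∀ x ξ : WignerWeyl.Conf d,
        WignerWeyl.hamiltonian x ξ = E + u * (ħ / (2 * E)) ^ (2 / 3 : ℝ) →
        ‖WignerWeyl.weylSum d E f ħ x ξ
            - (((2 * Real.pi * ħ) ^ d : ℝ) : ℂ)⁻¹ * WignerWeyl.leadingCoeff E f u‖
          ≤ C * ((1 + |u|) * ħ ^ (-(d : ℝ) + 2 / 3))) ∧
    -- full asymptotic expansion in powers of `ħ^(2/3)`
    (∃ I : ℕ → ℝ → ℂ,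
      I 0 = WignerWeyl.leadingCoeff E f ∧
      (∀ m : ℕ, ∀ K : Set ℝ, IsCompact K → ∃ B : ℝ, ∀ u ∈ K, ‖I m u‖ ≤ B) ∧
      ∀ M : ℕ, ∃ C ħ₀ : ℝ, 0 < ħ₀ ∧ ∀ ħ : ℝ, 0 < ħ → ħ < ħ₀ →
        ∀ u : ℝ, |u| < ħ ^ (-(2 / 3) : ℝ) →
        ∀ x ξ : WignerWeyl.Conf d,
          WignerWeyl.hamiltonian x ξ = E + u * (ħ / (2 * E)) ^ (2 / 3 : ℝ) →
          ‖WignerWeyl.weylSum d E f ħ x ξ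
              - (((2 * Real.pi * ħ) ^ d : ℝ) : ℂ)⁻¹ *
                ∑ m ∈ Finset.range M, ((ħ ^ (2 * (m : ℝ) / 3) : ℝ) : ℂ) * I m u‖
            ≤ C * ((1 + |u|) ^ M * ħ ^ (-(d : ℝ) + 2 * (M : ℝ) / 3))) := by
  refine ⟨fun ħ hħ x ξ => WignerWeyl.summable_weylTerm hħ E f x ξ,
    WignerWeyl.integrable_leadingIntegrand hE f, ?_,
    fun m u => WignerWeyl.taylorCoeff (2 * m) (WignerWeyl.profile d E f u),
    funext (WignerWeyl.taylorCoeff_zero_profile d hE f),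
    fun m K hK => WignerWeyl.exists_bound_taylorCoeff_profile d E f hf m hK, fun M => ?_⟩
  -- The leading asymptotics are the case `M = 1`, whose single term has `ħ` to the power zero.
  · obtain ⟨C, ħ₀, h0, h⟩ := WignerWeyl.exists_weylSum_expansion d hE f hf 1
    refine ⟨C, ħ₀, h0, fun ħ hħ hħ0 u _ x ξ hH => ?_⟩
    have h1 := h ħ hħ hħ0 u x ξ hH
    rw [Finset.sum_range_one, WignerWeyl.taylorCoeff_zero_profile d hE, Nat.cast_zero, mul_zero,
      zero_div, Real.rpow_zero, Complex.ofReal_one, one_mul, pow_one, Nat.cast_one, mul_one] at h1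
    exact h1
  · obtain ⟨C, ħ₀, h0, h⟩ := WignerWeyl.exists_weylSum_expansion d hE f hf M
    exact ⟨C, ħ₀, h0, fun ħ hħ hħ0 u _ x ξ hH => h ħ hħ hħ0 u x ξ hH⟩
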